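/- Let $H$ be a separable (real) Hilbert space and let $X_1,X_2,\dots$ be $H$-valued random variables on a probability space, with canonical filtration $\mathcal F_t=\sigma(X_1,\dots,X_t)$ ($\mathcal F_0$ trivial). Assume that, almost surely and for all $t\ge 1$, $\|X_t\|\le \tfrac12$, $\mathbb E[X_t\mid\mathcal F_{t-1}]=\mu$, $\mathbb E[\|X_t-\mu\|^2\mid\mathcal F_{t-1}]=\sigma^2$, and that $\mathbb V[\|X_t-\mu\|^2\mid\mathcal F_{t-1}]$ is constant across $t$. **Estimators.** Let $\psi_E(\lambda)=-\log(1-\lambda)-\lambda$, $\psi_P(\lambda)=e^\lambda-\lambda-1$, and fix constants $c_1\in(0,1)$, $c_2,c_3\in(0,1]$, $c_4\in H$ with $\|c_4\|\le\frac12$, $c_5>0$, and $\alpha\in(0,1)$. For $n\geq 3$ put $\alpha_{1,n}=\frac{1}{\log n}\alpha$, $\alpha_{2,n}=\frac{\log n-1}{\log n}\alpha$ (so $\alpha_{1,n}+\alpha_{2,n}=\alpha$). Let either $\beta_n=\alpha$ for all $n$ or $\beta_n=\alpha_{1,n}$ for all $n$. Define $$\bar\mu_t=\frac{c_4+\sum_{i\le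 t-1}X_i}{t},\qquad \widehat\sigma_t^2=\frac{c_3+\sum_{i\le t-1}\|X_i-\bar\mu_i\|^2}{t},\qquad \tilde\lambda_t=\sqrt{\frac{2\log(2/\beta_n)}{\widehat\sigma_t^2\,t\log(1+t)}}\wedge c_5 .$$ Let the mean estimator $\widehat\mu_t$ be either the running mean $\bar\mu_t$ (for all $t$), or the weighted mean $\sum_{i\le t-1}\tilde\lambda_iX_i/\sum_{i\le t-1}\tilde\lambda_i$ for $t\ge2$ with $\widehat\mu_1=0$. For $1\le i\le n$ and $\delta\in(0,1)$ put $$\widehat m_{4,t}^2=\frac{c_2+\sum_{i\le t-1}\big(\|X_i-\widehat\mu_i\|^2-\widehat\sigma_i^2\big)^2}{t},\qquad \lambda_{i,\delta}=\sqrt{\frac{2\log(1/\delta)}{\widehat m_{4,i}^2\,n}}\wedge c_1 .$$ **Bounds.** For weights $(\lambda_i)$ let $$D_n=\frac{\sum_{i\le n}\lambda_i\|X_i-\widehat\mu_i\|^2}{\sum_{i\le n}\lambda_i},\qquad R_{n,\delta}=\frac{\log(1/\delta)+\sum_{i\le n}\psi_E(\lambda_i)\big(\|X_i-\widehat\mu_i\|^2-\widehat\sigma_i^2\big)^2}{\sum_{i\le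 n}\lambda_i}.$$ For $t\ge2$ let $$\tilde A_t=\frac{\big(\sum_{i\le t-1}\psi_P(\tilde\lambda_i)\big)^2}{\big(\sum_{i\le t-1}\tilde\lambda_i\big)^2},\quad \tilde B_{t,\delta}=\frac{2\log(2/\delta)\sum_{i\le t-1}\psi_P(\tilde\lambda_i)}{\big(\sum_{i\le t-1}\tilde\lambda_i\big)^2},\quad \tilde C_{t,\delta}=\frac{\log^2(2/\delta)}{\big(\sum_{i\le t-1}\tilde\lambda_i\big)^2},$$ and $\tilde A_1=\tilde B_{1,\delta}=0$, $\tilde C_{1,\delta}=\frac14$. Let $A_n=\frac{\sum_{i\le n}\lambda_i\tilde A_i}{\sum_{i\le n}\lambda_i}$, $B_{n,\delta}=1+\frac{\sum_{i\le n}\lambda_i\tilde B_{i,\delta}}{\sum_{i\le n}\lambda_i}$, $C_{n,\delta}=\frac{\sum_{i\le n}\lambda_i\tilde C_{i,\delta}}{\sum_{i\le n}\lambda_i}$. - The upper bound is $U_n^{HS}=D_n^{HS}+R_{n,\alpha}$, with $\lambda_i=\lambda_{i,\alpha}$ in both terms. - The lower bound is $$L_n^{HS}=\frac{-B_{n,\alpha_{1,n}}+\sqrt{B_{n,\alpha_{1,n}}^2+4A_n\big(D_n^{HS}-C_{n,\alpha_{1,n}}-R_{n,\alpha_{2,n}}\big)}}{2A_n},$$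 where the weights in all terms (and in the $D_n^{HS}$ it is compared with) are either (a) $\lambda_i=\lambda_{i,\alpha_{2,n}}$ if $i\ge2$ and $\frac{\log(2/\alpha_{1,n})+\widehat\sigma_i^2\sum_{k\le i-1}\psi_P(\tilde\lambda_k)}{\sum_{k\le i-1}\tilde\lambda_k}\le1$, and $\lambda_i=0$ otherwise; or (b) $\lambda_i=\lambda_{i,\alpha_{2,n}}$ for all $i$. **Claim.** For each choice of $\beta_n$ and of the mean estimator, and for both choices (a), (b) of the weights in $L_n^{HS}$, as $n\to\infty$, $$\sqrt n\,(U_n^{HS}-D_n^{HS})\xrightarrow{a.s.}\sqrt{2\,\mathbb V[\|X_i-\mu\|^2]\log(1/\alpha)},\qquad \sqrt n\,(D_n^{HS}-L_n^{HS})\xrightarrow{a.s.}\sqrt{2\,\mathbb V[\|X_i-\mu\|^2]\log(1/\alpha)},$$ where the variance $\mathbb V[\|X_i-\mu\|^2]$ is the same for every $i\ge1$. -/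

import Mathlib

open MeasureTheory ProbabilityTheory Filter Topology

namespace HilbertVariance

noncomputable section

/-- The function `ψ_E(l) = -log (1 - l) - l`. -/
def psiE (l : ℝ) : ℝ := -Real.log (1 - l) - l

/-- The function `ψ_P(l) = exp l - l - 1`. -/
def psiP (l : ℝ) : ℝ := Real.exp l - l - 1

/-! ### The probabilistic assumptions. A stream is indexed by `t = 1, 2, …`; `X 0` is not used. -/

section Assumptions

variable {Ω H : Type*} [MeasurableSpace Ω] [NormedAddCommGroup H] [InnerProductSpace ℝ H]
  [CompleteSpace H] [MeasurableSpace H]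

/-- The canonical filtration `F_t = σ(X_1, …, X_t)`; `F_0` is trivial. -/
@[reducible] def canonicalSigma (X : ℕ → Ω → H) (t : ℕ) : MeasurableSpace Ω :=
  ⨆ i ∈ Finset.Icc 1 t, MeasurableSpace.comap (X i) inferInstance

/-- Random variables in the ball of diameter one centred at the origin, with constant conditional
mean `μ` and constant conditional variance `σ ^ 2`. -/
structure BoundedStream (P : Measure Ω) (X : ℕ → Ω → H) (μ : H) (σ : ℝ) : Prop where
  measurable : ∀ t, 1 ≤ t → Measurable (X t)
  norm_le : ∀ t, 1 ≤ t → ∀ᵐ ω ∂P, ‖X t ω‖ ≤ 1 / 2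
  condMean : ∀ t, 1 ≤ t → P[X t | canonicalSigma X (t - 1)] =ᵐ[P] fun _ => μ
  condSecondMoment : ∀ t, 1 ≤ t →
    P[fun ω => ‖X t ω - μ‖ ^ 2 | canonicalSigma X (t - 1)] =ᵐ[P] fun _ => σ ^ 2

/-- The conditional variance of `‖X_t - μ‖ ^ 2` given `F_{t-1}` is constant across `t`.
As `F_0` is trivial, the common value is a number. -/
def ConstantCondVar (P : Measure Ω) (X : ℕ → Ω → H) (μ : H) : Prop :=
  ∃ v : ℝ, ∀ t, 1 ≤ t →
    condVar (canonicalSigma X (t - 1)) (fun ω => ‖X t ω - μ‖ ^ 2) P =ᵐ[P] fun _ => v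

end Assumptions

/-! ### Statistics of a sample path `x 1, x 2, …` -/

section Statistics

variable {H : Type*} [NormedAddCommGroup H] [InnerProductSpace ℝ H]

/-- The tuning constants, with their admissible ranges. -/
structure Tuning (H : Type*) [NormedAddCommGroup H] where
  c₁ : ℝ
  c₂ : ℝ
  c₃ : ℝ
  c₄ : H
  c₅ : ℝ
  c₁_pos : 0 < c₁
  c₁_lt_one : c₁ < 1
  c₂_pos : 0 < c₂
  c₂_le_one : c₂ ≤ 1
  c₃_pos : 0 < c₃
  c₃_le_one : c₃ ≤ 1
  norm_c₄_le : ‖c₄‖ ≤ 1 / 2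
  c₅_pos : 0 < c₅

/-- The running mean `(c₄ + ∑_{i ≤ t-1} x_i) / t`. -/
def runningMean (c : Tuning H) (x : ℕ → H) (t : ℕ) : H :=
  (t : ℝ)⁻¹ • (c.c₄ + ∑ i ∈ Finset.Icc 1 (t - 1), x i)

/-- The variance estimator `(c₃ + ∑_{i ≤ t-1} ‖x_i - runningMean_i‖²) / t`. -/
def sigmaHatSq (c : Tuning H) (x : ℕ → H) (t : ℕ) : ℝ :=
  (c.c₃ + ∑ i ∈ Finset.Icc 1 (t - 1), ‖x i - runningMean c x i‖ ^ 2) / t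

/-- The mean plug-ins `√(2 log(2/β) / (σ̂_t² t log(1+t))) ∧ c₅` of level `β`. -/
def lamTilde (c : Tuning H) (β : ℝ) (x : ℕ → H) (t : ℕ) : ℝ :=
  min (√(2 * Real.log (2 / β) / (sigmaHatSq c x t * t * Real.log (1 + t)))) c.c₅

/-- `∑_{i ≤ t-1} lamTilde_i`. -/
def sumLamTilde (c : Tuning H) (β : ℝ) (x : ℕ → H) (t : ℕ) : ℝ :=
  ∑ i ∈ Finset.Icc 1 (t - 1), lamTilde c β x i

/-- `∑_{i ≤ t-1} ψ_P(lamTilde_i)`. -/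
def sumPsiP (c : Tuning H) (β : ℝ) (x : ℕ → H) (t : ℕ) : ℝ :=
  ∑ i ∈ Finset.Icc 1 (t - 1), psiP (lamTilde c β x i)

/-- The weighted mean `∑_{i ≤ t-1} lamTilde_i x_i / ∑_{i ≤ t-1} lamTilde_i` for `t ≥ 2`; at `t = 1`
it is the centre of the ball. -/
def weightedMean (c : Tuning H) (β : ℝ) (x : ℕ → H) (t : ℕ) : H :=
  if t ≤ 1 then 0
  else (sumLamTilde c β x t)⁻¹ • ∑ i ∈ Finset.Icc 1 (t - 1), lamTilde c β x i • x i

/-- The two predictable mean estimators. -/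
inductive MeanRule
  | running
  | weighted

/-- The predictable mean estimator `μ̂_t` selected by a rule. -/
def muHat (c : Tuning H) (rule : MeanRule) (β : ℝ) (x : ℕ → H) (t : ℕ) : H :=
  match rule with
  | MeanRule.running => runningMean c x t
  | MeanRule.weighted => weightedMean c β x t

/-- The fourth moment estimator
`(c₂ + ∑_{i ≤ t-1} (‖x_i - μ̂_i‖² - σ̂_i²)²) / t`. -/
def m4HatSq (c : Tuning H) (mu : ℕ → H) (x : ℕ → H) (t : ℕ) : ℝ :=
  (c.c₂ + ∑ i ∈ Finset.Icc 1 (t - 1), (‖x i - mu i‖ ^ 2 - sigmaHatSq c x i) ^ 2) / t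

/-- The plug-ins of the upper confidence interval with sample size `n`, at level `δ`:
`√(2 log(1/δ) / (m̂_{4,i}² n)) ∧ c₁`. -/
def lamUpper (c : Tuning H) (mu : ℕ → H) (x : ℕ → H) (n : ℕ) (δ : ℝ) (i : ℕ) : ℝ :=
  min (√(2 * Real.log (1 / δ) / (m4HatSq c mu x i * n))) c.c₁

open Classical in
/-- The plug-ins of the lower confidence interval with sample size `n`: those of the upper one at
level `δ₂`, except that they vanish where `i = 1` or where the approximate radius of the mean
confidence sequence (at level `δ₁`, built on plug-ins of level `β`) exceeds one. -/
def lamLower (c : Tuning H) (mu : ℕ → H) (β : ℝ) (x : ℕ → H) (n : ℕ) (δ₁ δ₂ : ℝ) (i : ℕ) : ℝ :=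
  if 2 ≤ i ∧
      (Real.log (2 / δ₁) + sigmaHatSq c x i * sumPsiP c β x i) / sumLamTilde c β x i ≤ 1
  then lamUpper c mu x n δ₂ i else 0

/-- The weighted average `∑_{i ≤ t} lam_i f_i / ∑_{i ≤ t} lam_i`. -/
def wAvg (lam f : ℕ → ℝ) (t : ℕ) : ℝ :=
  (∑ i ∈ Finset.Icc 1 t, lam i * f i) / ∑ i ∈ Finset.Icc 1 t, lam i

/-- The centre `D_t = ∑_{i ≤ t} lam_i ‖x_i - μ̂_i‖² / ∑_{i ≤ t} lam_i`. -/
def center (lam : ℕ → ℝ) (mu x : ℕ → H) (t : ℕ) : ℝ :=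
  wAvg lam (fun i => ‖x i - mu i‖ ^ 2) t

/-- The radius `R_{t,δ}`. -/
def radius (c : Tuning H) (lam : ℕ → ℝ) (mu x : ℕ → H) (δ : ℝ) (t : ℕ) : ℝ :=
  (Real.log (1 / δ) +
      ∑ i ∈ Finset.Icc 1 t, psiE (lam i) * (‖x i - mu i‖ ^ 2 - sigmaHatSq c x i) ^ 2) /
    ∑ i ∈ Finset.Icc 1 t, lam i

/-- The upper bound `U_t = D_t + R_{t,δ}`. -/
def upperBound (c : Tuning H) (lam : ℕ → ℝ) (mu x : ℕ → H) (δ : ℝ) (t : ℕ) : ℝ :=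
  center lam mu x t + radius c lam mu x δ t

/- For `t ≥ 2` the squared radius `((log(2/δ) + s ∑ ψ_P) / ∑ lamTilde)²` of the mean confidence
sequence is `Atilde s² + Btilde s + Ctilde`. For `t = 1` that radius is `1/2`, so that the
coefficients are `0`, `0`, `1/4`. -/

def Atilde (c : Tuning H) (β : ℝ) (x : ℕ → H) (t : ℕ) : ℝ :=
  if t ≤ 1 then 0 else sumPsiP c β x t ^ 2 / sumLamTilde c β x t ^ 2

def Btilde (c : Tuning H) (β : ℝ) (x : ℕ → H) (δ : ℝ) (t : ℕ) : ℝ :=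
  if t ≤ 1 then 0 else 2 * Real.log (2 / δ) * sumPsiP c β x t / sumLamTilde c β x t ^ 2

def Ctilde (c : Tuning H) (β : ℝ) (x : ℕ → H) (δ : ℝ) (t : ℕ) : ℝ :=
  if t ≤ 1 then 1 / 4 else Real.log (2 / δ) ^ 2 / sumLamTilde c β x t ^ 2

def Acoef (c : Tuning H) (lam : ℕ → ℝ) (β : ℝ) (x : ℕ → H) (t : ℕ) : ℝ :=
  wAvg lam (Atilde c β x) t

def Bcoef (c : Tuning H) (lam : ℕ → ℝ) (β : ℝ) (x : ℕ → H) (δ : ℝ) (t : ℕ) : ℝ :=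
  1 + wAvg lam (Btilde c β x δ) t

def Ccoef (c : Tuning H) (lam : ℕ → ℝ) (β : ℝ) (x : ℕ → H) (δ : ℝ) (t : ℕ) : ℝ :=
  wAvg lam (Ctilde c β x δ) t

/-- The lower bound `L_t`, with mean plug-ins of level `β` and levels `δ₁`, `δ₂`:
`(-B + √(B² + 4 A (D - C - R))) / (2 A)`. -/
def lowerBound (c : Tuning H) (lam : ℕ → ℝ) (mu : ℕ → H) (β : ℝ) (x : ℕ → H) (δ₁ δ₂ : ℝ)
    (t : ℕ) : ℝ :=
  (-Bcoef c lam β x δ₁ t +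
      √(Bcoef c lam β x δ₁ t ^ 2 +
        4 * Acoef c lam β x t *
          (center lam mu x t - Ccoef c lam β x δ₁ t - radius c lam mu x δ₂ t))) /
    (2 * Acoef c lam β x t)

end Statistics

/-- `α_{1,n} = α / log n`. -/
def alphaOne (α : ℝ) (n : ℕ) : ℝ := 1 / Real.log n * α

/-- `α_{2,n} = ((log n - 1) / log n) α`. -/
def alphaTwo (α : ℝ) (n : ℕ) : ℝ := (Real.log n - 1) / Real.log n * α

end

end HilbertVariance

/-! Randomness enters only through a strong law with rate: partial sums of bounded martingale
differences are almost surely `O(n ^ (9/16))`. Applied to `X_t - μ`, to `‖X_t - μ‖² - σ²` and to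
`(‖X_t - μ‖² - σ²)² - v`, with `v` the constant conditional variance, it makes almost every path a
`RegularPath`; everything after that is deterministic. Since the conditional mean of `‖X_t - μ‖²` is
constant too, `v` is the variance in the limit.

On a regular path all plug-in estimators converge at the common rate `i ^ (-3/8)`, with constants
that do not depend on the level of the mean plug-ins and hence not on `n`. If `v > 0`, then `√n
λ_{n,i}` is uniformly close to `s₀ = √(2 log(1/α) / v)` once `i ≥ √n`, and the fewer than `√n`
remaining indices do not affect averages. As `ψ_E(λ) ~ λ² / 2`, the sum in the numerator of the
radius tends to `s₀² v / 2 = log(1/α)`, the same value as its other term, while the denominator is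
`~ s₀ √n`. Hence `√n R → 2 log(1/α) / s₀ = √(2 v log(1/α))` (`tendsto_sqrt_mul_radius`). If `v = 0`,
the plug-ins are larger, their sum is at least of order `n ^ (7/8)`, and `√n R → 0`.

The lower bound solves `A L² + B L = D - C - R`, so `D - L = R + C + A L² + (B - 1) L`. No single
weight carries more than order `n ^ (-7/8)` of the total (`IsSpread`), and the averaged coefficients
decay like `i ^ (-3/4)` up to logarithms, so `√n` times `A`, `B - 1` and `C` vanishes. The exception
is `σ² = 0`: there `A` need not be small, but `D`, `C`, `R`, and therefore `L`, are all `o(n ^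
(-1/2))`. -/

namespace HilbertVariance

noncomputable section

/-! ### A strong law with rate for Hilbert space valued martingale differences. -/

section Martingale

variable {Ω E : Type*} {mΩ : MeasurableSpace Ω} [NormedAddCommGroup E] [InnerProductSpace ℝ E]

/-- Weighted telescoping: for antitone weights `k ^ (-9/8)`, the weighted sum of the increments of
`‖W_k‖ ^ 2` dominates the last term. -/
theorem rpow_mul_norm_sq_le_sum_increments (y : ℕ → E) (n : ℕ) :
    (n : ℝ) ^ (-(9 / 8) : ℝ) * ‖∑ i ∈ Finset.range n, y i‖ ^ 2 ≤
      ∑ k ∈ Finset.range n, ((k : ℝ) + 1) ^ (-(9 / 8) : ℝ) *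
        (2 * inner ℝ (∑ i ∈ Finset.range k, y i) (y k) + ‖y k‖ ^ 2) := by
  induction n with
  | zero => simp
  | succ n ih =>
    rw [Finset.sum_range_succ, Finset.sum_range_succ, norm_add_sq_real]
    push_cast
    have h1 : ((n : ℝ) + 1) ^ (-(9 / 8) : ℝ) * ‖∑ i ∈ Finset.range n, y i‖ ^ 2 ≤
        (n : ℝ) ^ (-(9 / 8) : ℝ) * ‖∑ i ∈ Finset.range n, y i‖ ^ 2 := by
      -- The weight is not antitone at `n = 0`, where `0 ^ (-9/8)` is `0` by convention; there the
      -- empty sum vanishes instead.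
      rcases Nat.eq_zero_or_pos n with rfl | hn
      · simp
      · have hn' : (0 : ℝ) < n := by exact_mod_cast hn
        gcongr ?_ * _
        exact Real.rpow_le_rpow_of_nonpos hn' (by linarith) (by norm_num)
    nlinarith

theorem summable_succ_rpow_neg : Summable fun k : ℕ => ((k : ℝ) + 1) ^ (-(9 / 8) : ℝ) := by
  have h := (summable_nat_add_iff 1).2 (Real.summable_nat_rpow.2 (by norm_num : (-(9/8) : ℝ) < -1))
  simpa using h

theorem condExp_succ_sub_const [CompleteSpace E] {P : Measure Ω} [IsProbabilityMeasure P]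
    (ℱ : Filtration ℕ mΩ) (f : ℕ → Ω → E) (e : E) (hf : ∀ t, 1 ≤ t → Integrable (f t) P)
    (hfe : ∀ t, 1 ≤ t → P[f t | ℱ (t - 1)] =ᵐ[P] fun _ => e) (t : ℕ) :
    P[fun ω => f (t + 1) ω - e | ℱ t] =ᵐ[P] fun _ => 0 := by
  have h1 := condExp_sub (hf (t + 1) (by omega)) (integrable_const (μ := P) e) (ℱ t)
  have h2 := condExp_const (μ := P) (ℱ.le t) e
  filter_upwards [h1, hfe (t + 1) (by omega)] with ω h3 h4
  refine h3.trans ?_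
  rw [Pi.sub_apply, h2]
  simp only [Nat.add_sub_cancel] at h4
  rw [h4, sub_self]

/-- A strong law with rate for bounded Hilbert space valued martingale differences. -/
theorem ae_exists_norm_sum_le [CompleteSpace E] (P : Measure Ω) [IsProbabilityMeasure P] (ℱ : Filtration ℕ mΩ)
    (ξ : ℕ → Ω → E) (M : ℝ) (hξ : ∀ t, 1 ≤ t → StronglyMeasurable[ℱ t] (ξ t))
    (hb : ∀ t, 1 ≤ t → ∀ᵐ ω ∂P, ‖ξ t ω‖ ≤ M)
    (hc : ∀ t, P[ξ (t + 1) | ℱ t] =ᵐ[P] fun _ => 0) :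
    ∀ᵐ ω ∂P, ∃ C : ℝ, ∀ n : ℕ, ‖∑ i ∈ Finset.Icc 1 n, ξ i ω‖ ≤ C * (n : ℝ) ^ (9 / 16 : ℝ) := by
  set W : ℕ → Ω → E := fun n ω => ∑ i ∈ Finset.range n, ξ (i + 1) ω with hW
  set a : ℕ → ℝ := fun k => ((k : ℝ) + 1) ^ (-(9 / 8) : ℝ) with ha
  have ha0 : ∀ k, 0 ≤ a k := fun k => by positivity
  set inc : ℕ → Ω → ℝ := fun k ω =>
    a k * (2 * inner ℝ (W k ω) (ξ (k + 1) ω) + ‖ξ (k + 1) ω‖ ^ 2) with hinc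
  set S : ℕ → Ω → ℝ := fun n ω => ∑ k ∈ Finset.range n, inc k ω with hS
  have hξm : ∀ t, StronglyMeasurable (ξ (t + 1)) := fun t => (hξ (t + 1) (by omega)).mono (ℱ.le _)
  have hWm : ∀ n, StronglyMeasurable[ℱ n] (W n) := fun n =>
    Finset.stronglyMeasurable_fun_sum _ fun i hi =>
      (hξ (i + 1) (by omega)).mono (ℱ.mono (by have := Finset.mem_range.1 hi; omega))
  have hball : ∀ᵐ ω ∂P, ∀ t, ‖ξ (t + 1) ω‖ ≤ M := ae_all_iff.2 fun t => hb (t + 1) (by omega)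
  have hM0 : 0 ≤ M := by
    obtain ⟨ω, hω⟩ := hball.exists
    exact (norm_nonneg _).trans (hω 0)
  have hWb : ∀ n, ∀ᵐ ω ∂P, ‖W n ω‖ ≤ n * M := by
    intro n
    filter_upwards [hball] with ω hω
    calc ‖W n ω‖ ≤ ∑ i ∈ Finset.range n, M := norm_sum_le_of_le _ fun i _ => hω i
      _ = n * M := by simp
  have hξi : ∀ t, Integrable (ξ (t + 1)) P := fun t =>
    Integrable.of_bound (hξm t).aestronglyMeasurable M (hb (t + 1) (by omega))
  have hinner_int : ∀ k, Integrable (fun ω => inner ℝ (W k ω) (ξ (k + 1) ω)) P := by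
    intro k
    refine Integrable.of_bound
      (((hWm k).mono (ℱ.le _)).inner (hξm k)).aestronglyMeasurable (k * M * M) ?_
    filter_upwards [hball, hWb k] with ω h1 h2
    exact (norm_inner_le_norm _ _).trans (by gcongr; exact h1 k)
  have hsq_int : ∀ k, Integrable (fun ω => ‖ξ (k + 1) ω‖ ^ 2) P := by
    intro k
    refine Integrable.of_bound ((hξm k).norm.pow 2).aestronglyMeasurable (M ^ 2) ?_
    filter_upwards [hball] with ω h1
    rw [Real.norm_of_nonneg (by positivity)]
    gcongr
    exact h1 k
  have hinc_int : ∀ k, Integrable (inc k) P := fun k =>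
    (((hinner_int k).const_mul 2).add (hsq_int k)).const_mul (a k)
  have hinner : ∀ k, P[fun ω => inner ℝ (W k ω) (ξ (k + 1) ω) | ℱ k] =ᵐ[P] fun _ => 0 := by
    intro k
    have h := condExp_bilin_of_aestronglyMeasurable_left (μ := P) (m := ℱ k) (innerSL ℝ (E := E))
      (hWm k).aestronglyMeasurable (hinner_int k) (hξi k)
    filter_upwards [h, hc k] with ω h1 h2
    rw [h2, map_zero] at h1
    exact h1
  have hcond : ∀ k, P[inc k | ℱ k] =ᵐ[P] fun ω => a k * (P[fun ω => ‖ξ (k + 1) ω‖ ^ 2 | ℱ k]) ω := by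
    intro k
    have h1 := condExp_smul (μ := P) (a k)
      (fun ω => 2 * inner ℝ (W k ω) (ξ (k + 1) ω) + ‖ξ (k + 1) ω‖ ^ 2) (ℱ k)
    have h2 := condExp_add (μ := P) ((hinner_int k).const_mul 2) (hsq_int k) (ℱ k)
    have h3 := condExp_smul (μ := P) (2 : ℝ) (fun ω => inner ℝ (W k ω) (ξ (k + 1) ω)) (ℱ k)
    filter_upwards [h1, h2, h3, hinner k] with ω e1 e2 e3 e4
    have e1' : (P[inc k | ℱ k]) ω = a k * (P[fun ω => 2 * inner ℝ (W k ω) (ξ (k + 1) ω) +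
      ‖ξ (k + 1) ω‖ ^ 2 | ℱ k]) ω := e1
    have e2' : (P[fun ω => 2 * inner ℝ (W k ω) (ξ (k + 1) ω) + ‖ξ (k + 1) ω‖ ^ 2 | ℱ k]) ω =
      (P[fun ω => 2 * inner ℝ (W k ω) (ξ (k + 1) ω) | ℱ k]) ω +
      (P[fun ω => ‖ξ (k + 1) ω‖ ^ 2 | ℱ k]) ω := e2
    have e3' : (P[fun ω => 2 * inner ℝ (W k ω) (ξ (k + 1) ω) | ℱ k]) ω =
      2 * (P[fun ω => inner ℝ (W k ω) (ξ (k + 1) ω) | ℱ k]) ω := e3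
    rw [e1', e2', e3', e4]
    ring
  have hSm : ∀ n, StronglyMeasurable[ℱ n] (S n) := by
    intro n
    refine Finset.stronglyMeasurable_fun_sum _ fun k hk => ?_
    have hk' := Finset.mem_range.1 hk
    have h1 := (hWm k).mono (ℱ.mono hk'.le)
    have h2 := (hξ (k + 1) (by omega)).mono (ℱ.mono (show k + 1 ≤ n by omega))
    exact (((h1.inner h2).const_mul 2).add (h2.norm.pow 2)).const_mul (a k)
  have hS_int : ∀ n, Integrable (S n) P := fun n => integrable_finsetSum _ fun k _ => hinc_int k
  -- The cross term has conditional mean zero, since `W k` is known at time `k`. What is left of the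
  -- increment is a nonnegative multiple of a conditional second moment.
  have hsub : Submartingale S ℱ P := by
    refine submartingale_of_condExp_sub_nonneg_nat hSm hS_int fun k => ?_
    have : S (k + 1) - S k = inc k := by
      ext ω
      simp [hS, Finset.sum_range_succ]
    rw [this]
    have hnn : 0 ≤ᵐ[P] P[fun ω => ‖ξ (k + 1) ω‖ ^ 2 | ℱ k] :=
      condExp_nonneg (ae_of_all _ fun ω => by positivity)
    filter_upwards [hcond k, hnn] with ω h1 h2
    rw [h1]
    exact mul_nonneg (ha0 k) h2
  have hSlow : ∀ (n : ℕ) ω, (n : ℝ) ^ (-(9 / 8) : ℝ) * ‖W n ω‖ ^ 2 ≤ S n ω := fun n ω =>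
    rpow_mul_norm_sq_le_sum_increments (fun i => ξ (i + 1) ω) n
  have hSnn : ∀ n ω, 0 ≤ S n ω := fun n ω => le_trans (by positivity) (hSlow n ω)
  have hinc_le : ∀ k, ∫ ω, inc k ω ∂P ≤ a k * M ^ 2 := by
    intro k
    rw [← integral_condExp (ℱ.le k), integral_congr_ae (hcond k), integral_const_mul,
      integral_condExp (ℱ.le k)]
    refine mul_le_mul_of_nonneg_left ?_ (ha0 k)
    calc ∫ ω, ‖ξ (k + 1) ω‖ ^ 2 ∂P ≤ ∫ _, M ^ 2 ∂P := by
          refine integral_mono_ae (hsq_int k) (integrable_const _) ?_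
          filter_upwards [hball] with ω h1
          have := h1 k
          gcongr
      _ = M ^ 2 := by simp
  have hSle : ∀ n, ∫ ω, S n ω ∂P ≤ (∑' k, a k) * M ^ 2 := by
    intro n
    rw [integral_finsetSum _ fun k _ => hinc_int k]
    calc ∑ k ∈ Finset.range n, ∫ ω, inc k ω ∂P ≤ ∑ k ∈ Finset.range n, a k * M ^ 2 :=
          Finset.sum_le_sum fun k _ => hinc_le k
      _ = (∑ k ∈ Finset.range n, a k) * M ^ 2 := by rw [Finset.sum_mul]
      _ ≤ _ := by
          gcongr
          exact summable_succ_rpow_neg.sum_le_tsum _ fun k _ => ha0 k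
  -- `S` is nonnegative, so its `L¹` norm is its mean, which is at most `M²` times the sum of the
  -- weights. Submartingale convergence then gives almost sure boundedness of `S`, the only
  -- consequence used.
  have hbdd : ∀ n, eLpNorm (S n) 1 P ≤ (((∑' k, a k) * M ^ 2).toNNReal : ENNReal) := by
    intro n
    rw [eLpNorm_one_eq_lintegral_enorm, ← ofReal_integral_norm_eq_lintegral_enorm (hS_int n)]
    refine ENNReal.ofReal_le_ofReal ?_
    simp_rw [Real.norm_of_nonneg (hSnn n _)]
    exact hSle n
  filter_upwards [hsub.exists_ae_tendsto_of_bdd hbdd] with ω hω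
  obtain ⟨l, hl⟩ := hω
  obtain ⟨B, hB⟩ := hl.bddAbove_range
  refine ⟨√B, fun n => ?_⟩
  have hsum : ∑ i ∈ Finset.Icc 1 n, ξ i ω = W n ω := by
    simp only [hW]
    rw [Finset.range_eq_Ico, Finset.sum_Ico_add' (fun i => ξ i ω) 0 n 1]
    congr 1
  rw [hsum]
  rcases Nat.eq_zero_or_pos n with rfl | hn
  · simp [hW]
  have hn' : (0 : ℝ) < n := by exact_mod_cast hn
  have h1 : (n : ℝ) ^ (-(9 / 8) : ℝ) * ‖W n ω‖ ^ 2 ≤ B := (hSlow n ω).trans (hB ⟨n, rfl⟩)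
  have h2 : ‖W n ω‖ ^ 2 ≤ B * (n : ℝ) ^ (9 / 8 : ℝ) := by
    rw [Real.rpow_neg hn'.le, inv_mul_le_iff₀ (by positivity)] at h1
    linarith
  have hsq : √((n : ℝ) ^ (9 / 8 : ℝ)) = (n : ℝ) ^ (9 / 16 : ℝ) := by
    rw [Real.sqrt_eq_rpow, ← Real.rpow_mul hn'.le]
    norm_num
  rw [← hsq, ← Real.sqrt_mul' _ (by positivity)]
  exact Real.le_sqrt_of_sq_le h2

end Martingale

/-! ### From the stochastic assumptions to regular sample paths. -/

/-- The almost sure properties of a sample path on which the asymptotics rest: `s` is the variance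
of the observations and `v` that of their squared distance to the mean. -/
structure RegularPath {H : Type*} [NormedAddCommGroup H] (x : ℕ → H) (μ : H) (s v : ℝ) : Prop where
  norm_le : ∀ i, 1 ≤ i → ‖x i‖ ≤ 1 / 2
  norm_mean_le : ‖μ‖ ≤ 1 / 2
  var_nonneg : 0 ≤ s
  varSq_nonneg : 0 ≤ v
  sum_mean : ∃ C : ℝ, ∀ n : ℕ, ‖∑ i ∈ Finset.Icc 1 n, (x i - μ)‖ ≤ C * (n : ℝ) ^ (9 / 16 : ℝ)
  sum_var : ∃ C : ℝ, ∀ n : ℕ,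
    |∑ i ∈ Finset.Icc 1 n, (‖x i - μ‖ ^ 2 - s)| ≤ C * (n : ℝ) ^ (9 / 16 : ℝ)
  sum_varSq : ∃ C : ℝ, ∀ n : ℕ,
    |∑ i ∈ Finset.Icc 1 n, ((‖x i - μ‖ ^ 2 - s) ^ 2 - v)| ≤ C * (n : ℝ) ^ (9 / 16 : ℝ)
  -- The plug-ins divide by estimates of `s` and `v`. Where one of these vanishes the rates above
  -- are too weak, and the exact identities replace them.
  eq_mean : s = 0 → ∀ i, 1 ≤ i → x i = μ
  norm_sq_eq : v = 0 → ∀ i, 1 ≤ i → ‖x i - μ‖ ^ 2 = s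

section Stream

variable {Ω H : Type*} {mΩ : MeasurableSpace Ω} [NormedAddCommGroup H] [MeasurableSpace H]
  {X : ℕ → Ω → H}

/-- The canonical filtration of a sequence of random variables. -/
def canonicalFiltration (X : ℕ → Ω → H) (hX : ∀ t, 1 ≤ t → Measurable (X t)) :
    Filtration ℕ mΩ where
  seq := canonicalSigma X
  mono' s t hst := biSup_mono fun i hi => by
    simp only [Finset.mem_Icc] at hi ⊢
    omega
  le' t := iSup₂_le fun i hi => (hX i (Finset.mem_Icc.1 hi).1).comap_le

theorem stronglyMeasurable_canonicalFiltration [TopologicalSpace.SeparableSpace H] [BorelSpace H]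
    (hX : ∀ t, 1 ≤ t → Measurable (X t)) (t : ℕ) (ht : 1 ≤ t) :
    StronglyMeasurable[canonicalFiltration X hX t] (X t) := by
  have := UniformSpace.secondCountable_of_separable H
  refine Measurable.stronglyMeasurable ?_
  refine Measurable.mono (comap_measurable (X t)) ?_ le_rfl
  exact le_iSup₂_of_le (f := fun i (_ : i ∈ Finset.Icc 1 t) =>
    MeasurableSpace.comap (X i) inferInstance) t (Finset.mem_Icc.2 ⟨ht, le_rfl⟩) le_rfl

/-- The variance of the squared distance to the mean is the constant conditional variance, and
almost every path is regular. -/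
theorem BoundedStream.regularPath [InnerProductSpace ℝ H] [CompleteSpace H]
    [TopologicalSpace.SeparableSpace H] [BorelSpace H] {P : Measure Ω} [IsProbabilityMeasure P]
    {μ : H} {σ : ℝ} (hX : BoundedStream P X μ σ) (hV : ConstantCondVar P X μ) :
    ∃ v : ℝ, (∀ j, 1 ≤ j → variance (fun ω => ‖X j ω - μ‖ ^ 2) P = v) ∧
      ∀ᵐ ω ∂P, RegularPath (fun i => X i ω) μ (σ ^ 2) v := by
  obtain ⟨v, hv⟩ := hV
  set ℱ := canonicalFiltration X hX.measurable with hℱ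
  have hXm := stronglyMeasurable_canonicalFiltration hX.measurable
  have hcm : ∀ t, 1 ≤ t → P[X t | ℱ (t - 1)] =ᵐ[P] fun _ => μ := hX.condMean
  have hcv : ∀ t, 1 ≤ t → P[fun ω => ‖X t ω - μ‖ ^ 2 | ℱ (t - 1)] =ᵐ[P] fun _ => σ ^ 2 :=
    hX.condSecondMoment
  have hXi : ∀ t, 1 ≤ t → Integrable (X t) P := fun t ht =>
    Integrable.of_bound ((hXm t ht).mono (ℱ.le t)).aestronglyMeasurable _ (hX.norm_le t ht)
  have hμ : ‖μ‖ ≤ 1 / 2 := by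
    have h1 : ∫ ω, X 1 ω ∂P = μ := by
      rw [← integral_condExp (ℱ.le 0), integral_congr_ae (hcm 1 le_rfl)]
      simp
    rw [← h1]
    simpa using norm_integral_le_of_norm_le_const (hX.norm_le 1 le_rfl)
  have hdm : ∀ t, 1 ≤ t → StronglyMeasurable[ℱ t] fun ω => X t ω - μ := fun t ht =>
    (hXm t ht).sub stronglyMeasurable_const
  have hdb : ∀ t, 1 ≤ t → ∀ᵐ ω ∂P, ‖X t ω - μ‖ ≤ 1 := fun t ht => by
    filter_upwards [hX.norm_le t ht] with ω h
    linarith [norm_sub_le (X t ω) μ]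
  have hYm : ∀ t, 1 ≤ t → StronglyMeasurable[ℱ t] fun ω => ‖X t ω - μ‖ ^ 2 := fun t ht =>
    (hdm t ht).norm.pow 2
  have hYb : ∀ t, 1 ≤ t → ∀ᵐ ω ∂P, ‖X t ω - μ‖ ^ 2 ≤ 1 := fun t ht => by
    filter_upwards [hdb t ht] with ω h
    exact pow_le_one₀ (norm_nonneg _) h
  have hYi : ∀ t, 1 ≤ t → Integrable (fun ω => ‖X t ω - μ‖ ^ 2) P := fun t ht =>
    Integrable.of_bound ((hYm t ht).mono (ℱ.le t)).aestronglyMeasurable 1 (by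
      filter_upwards [hYb t ht] with ω h
      rwa [Real.norm_of_nonneg (by positivity)])
  have hYE : ∀ t, 1 ≤ t → ∫ ω, ‖X t ω - μ‖ ^ 2 ∂P = σ ^ 2 := fun t ht => by
    rw [← integral_condExp (ℱ.le (t - 1)), integral_congr_ae (hcv t ht)]
    simp
  have hs1 : σ ^ 2 ≤ 1 := by
    rw [← hYE 1 le_rfl]
    calc ∫ ω, ‖X 1 ω - μ‖ ^ 2 ∂P ≤ ∫ _, (1 : ℝ) ∂P :=
          integral_mono_ae (hYi 1 le_rfl) (integrable_const _) (hYb 1 le_rfl)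
      _ = 1 := by simp
  have hZm : ∀ t, 1 ≤ t → StronglyMeasurable[ℱ t] fun ω => (‖X t ω - μ‖ ^ 2 - σ ^ 2) ^ 2 :=
    fun t ht => ((hYm t ht).sub stronglyMeasurable_const).pow 2
  have hDb : ∀ t, 1 ≤ t → ∀ᵐ ω ∂P, |‖X t ω - μ‖ ^ 2 - σ ^ 2| ≤ 1 := fun t ht => by
    filter_upwards [hYb t ht] with ω h
    rw [abs_le]
    constructor <;> nlinarith [sq_nonneg σ, sq_nonneg ‖X t ω - μ‖]
  have hZb : ∀ t, 1 ≤ t → ∀ᵐ ω ∂P, (‖X t ω - μ‖ ^ 2 - σ ^ 2) ^ 2 ≤ 1 := fun t ht => by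
    filter_upwards [hDb t ht] with ω h
    exact (sq_le_one_iff_abs_le_one _).2 h
  have hZi : ∀ t, 1 ≤ t → Integrable (fun ω => (‖X t ω - μ‖ ^ 2 - σ ^ 2) ^ 2) P := fun t ht =>
    Integrable.of_bound ((hZm t ht).mono (ℱ.le t)).aestronglyMeasurable 1 (by
      filter_upwards [hZb t ht] with ω h
      rwa [Real.norm_of_nonneg (by positivity)])
  -- `condVar` centres at the conditional mean, which is almost everywhere the constant `σ²`.
  have hZc : ∀ t, 1 ≤ t →
      P[fun ω => (‖X t ω - μ‖ ^ 2 - σ ^ 2) ^ 2 | ℱ (t - 1)] =ᵐ[P] fun _ => v := fun t ht => by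
    refine EventuallyEq.trans (condExp_congr_ae ?_) (hv t ht)
    filter_upwards [hX.condSecondMoment t ht] with ω h
    simp only [Pi.pow_apply, Pi.sub_apply]
    rw [h]
  have hZE : ∀ t, 1 ≤ t → ∫ ω, (‖X t ω - μ‖ ^ 2 - σ ^ 2) ^ 2 ∂P = v := fun t ht => by
    rw [← integral_condExp (ℱ.le (t - 1)), integral_congr_ae (hZc t ht)]
    simp
  have hv0 : 0 ≤ v := by
    rw [← hZE 1 le_rfl]
    positivity
  have hmean := ae_exists_norm_sum_le P ℱ (fun t ω => X t ω - μ) 1 hdm hdb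
    (condExp_succ_sub_const ℱ X μ hXi hcm)
  have hvar := ae_exists_norm_sum_le P ℱ (fun t ω => ‖X t ω - μ‖ ^ 2 - σ ^ 2) 1
    (fun t ht => (hYm t ht).sub stronglyMeasurable_const) hDb
    (condExp_succ_sub_const ℱ (fun t ω => ‖X t ω - μ‖ ^ 2) (σ ^ 2) hYi hcv)
  have hvarSq := ae_exists_norm_sum_le P ℱ (fun t ω => (‖X t ω - μ‖ ^ 2 - σ ^ 2) ^ 2 - v) (1 + v)
    (fun t ht => (hZm t ht).sub stronglyMeasurable_const)
    (fun t ht => by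
      filter_upwards [hZb t ht] with ω h
      rw [Real.norm_eq_abs, abs_le]
      constructor <;> nlinarith [sq_nonneg (‖X t ω - μ‖ ^ 2 - σ ^ 2)])
    (condExp_succ_sub_const ℱ (fun t ω => (‖X t ω - μ‖ ^ 2 - σ ^ 2) ^ 2) v hZi hZc)
  -- A nonnegative variable with mean zero vanishes almost surely.
  have hdeg1 : ∀ᵐ ω ∂P, σ ^ 2 = 0 → ∀ i, 1 ≤ i → X i ω = μ := by
    by_cases hs : σ ^ 2 = 0
    · have : ∀ i, 1 ≤ i → ∀ᵐ ω ∂P, X i ω = μ := fun i hi => by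
        have h := (integral_eq_zero_iff_of_nonneg (fun ω => by positivity) (hYi i hi)).1
          ((hYE i hi).trans hs)
        filter_upwards [h] with ω h
        simpa [sub_eq_zero] using h
      filter_upwards [ae_all_iff.2 fun i => eventually_all.2 (this i)] with ω h _
      exact h
    · exact ae_of_all _ fun ω h => absurd h hs
  have hdeg2 : ∀ᵐ ω ∂P, v = 0 → ∀ i, 1 ≤ i → ‖X i ω - μ‖ ^ 2 = σ ^ 2 := by
    by_cases hs : v = 0
    · have : ∀ i, 1 ≤ i → ∀ᵐ ω ∂P, ‖X i ω - μ‖ ^ 2 = σ ^ 2 := fun i hi => by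
        have h := (integral_eq_zero_iff_of_nonneg (fun ω => by positivity) (hZi i hi)).1
          ((hZE i hi).trans hs)
        filter_upwards [h] with ω h
        simpa [sub_eq_zero] using h
      filter_upwards [ae_all_iff.2 fun i => eventually_all.2 (this i)] with ω h _
      exact h
    · exact ae_of_all _ fun ω h => absurd h hs
  refine ⟨v, fun j hj => ?_, ?_⟩
  · rw [variance_eq_integral ((hYm j hj).mono (ℱ.le j)).measurable.aemeasurable, hYE j hj]
    exact hZE j hj
  · filter_upwards [hmean, hvar, hvarSq, hdeg1, hdeg2,
      ae_all_iff.2 fun i => eventually_all.2 (hX.norm_le i)] with ω h1 h2 h3 h4 h5 h6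
    exact ⟨h6, hμ, sq_nonneg σ, hv0, h1, h2, h3, h4, h5⟩

end Stream

/-! ### Elementary inequalities: power sums, logarithms, `ψ_P`, `ψ_E`, weighted sums and averages.
-/

section RealBounds

/-- A comparison with `∫ x ^ (q - 1)`, proved by induction: the step is Bernoulli's inequality `(1 -
1/(n+1)) ^ q ≤ 1 - q/(n+1)` for exponents in `(0, 1]`. -/
theorem sum_rpow_sub_one_le {q : ℝ} (hq0 : 0 < q) (hq1 : q ≤ 1) (n : ℕ) :
    ∑ k ∈ Finset.Icc 1 n, (k : ℝ) ^ (q - 1) ≤ (n : ℝ) ^ q / q := by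
  induction n with
  | zero => simp [hq0.ne']
  | succ n ih =>
    rw [Finset.sum_Icc_succ_top (by omega)]
    have hn : (0 : ℝ) < (n : ℝ) + 1 := by positivity
    have h1 : ((n : ℝ) / (n + 1)) ^ q ≤ 1 - q / (n + 1) := by
      have h := rpow_one_add_le_one_add_mul_self (s := -1 / ((n : ℝ) + 1)) (p := q)
        (by rw [le_div_iff₀ hn]; linarith [(Nat.cast_nonneg n : (0 : ℝ) ≤ n)]) hq0.le hq1
      have e : 1 + -1 / ((n : ℝ) + 1) = n / (n + 1) := by field_simp; ring
      rw [e] at h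
      calc _ ≤ _ := h
        _ = _ := by ring
    rw [Real.div_rpow (by positivity) hn.le, div_le_iff₀ (by positivity)] at h1
    have h2 : ((n : ℝ) + 1) ^ (q - 1) = ((n : ℝ) + 1) ^ q / (n + 1) := by
      rw [Real.rpow_sub hn, Real.rpow_one]
    push_cast
    rw [h2]
    have h3 : (n : ℝ) ^ q / q ≤ (1 - q / (n + 1)) * ((n : ℝ) + 1) ^ q / q := by gcongr
    have h4 : (1 - q / ((n : ℝ) + 1)) * ((n : ℝ) + 1) ^ q / q + ((n : ℝ) + 1) ^ q / (n + 1) =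
        ((n : ℝ) + 1) ^ q / q := by
      field_simp
      ring
    linarith

/-- Trades the logarithm in the mean plug-ins for a small power, so that later estimates only
compare exponents. -/
theorem log_one_add_le {t : ℝ} (ht : 1 ≤ t) : Real.log (1 + t) ≤ 16 * t ^ (1 / 8 : ℝ) := by
  have h2 : (2 : ℝ) ^ (1 / 8 : ℝ) ≤ 2 := by
    simpa using Real.rpow_le_rpow_of_exponent_le (by norm_num : (1 : ℝ) ≤ 2)
      (by norm_num : (1 / 8 : ℝ) ≤ 1)
  calc Real.log (1 + t) ≤ (1 + t) ^ (1 / 8 : ℝ) / (1 / 8) :=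
        Real.log_le_rpow_div (by linarith) (by norm_num)
    _ ≤ (2 * t) ^ (1 / 8 : ℝ) / (1 / 8) := by gcongr; linarith
    _ = 8 * 2 ^ (1 / 8 : ℝ) * t ^ (1 / 8 : ℝ) := by
        rw [Real.mul_rpow (by norm_num) (by linarith)]; ring
    _ ≤ 16 * t ^ (1 / 8 : ℝ) := by gcongr; linarith

theorem half_le_log_one_add {t : ℝ} (ht : 1 ≤ t) : 1 / 2 ≤ Real.log (1 + t) := by
  have h1 : Real.log 2 ≤ Real.log (1 + t) := Real.log_le_log (by norm_num) (by linarith)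
  linarith [Real.log_two_gt_d9]

theorem one_le_two_mul_log {β : ℝ} (h0 : 0 < β) (h1 : β ≤ 1) : 1 ≤ 2 * Real.log (2 / β) := by
  have h2 : Real.log 2 ≤ Real.log (2 / β) :=
    Real.log_le_log (by norm_num) (by rw [le_div_iff₀ h0]; linarith)
  linarith [Real.log_two_gt_d9]

theorem psiP_nonneg (l : ℝ) : 0 ≤ psiP l := by
  unfold psiP
  linarith [Real.add_one_le_exp l]

theorem psiP_pos {l : ℝ} (hl : l ≠ 0) : 0 < psiP l := by
  unfold psiP
  linarith [Real.add_one_lt_exp hl]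

/-- Two uses of `exp l - 1 ≤ l * exp l`. -/
theorem psiP_le {l b : ℝ} (h0 : 0 ≤ l) (hb : l ≤ b) : psiP l ≤ Real.exp b * l ^ 2 := by
  have h1 : Real.exp l - 1 ≤ l * Real.exp l := by
    have h := Real.add_one_le_exp (-l)
    have h2 : Real.exp (-l) * Real.exp l = 1 := by rw [← Real.exp_add]; simp
    nlinarith [Real.exp_pos l]
  have h2 : Real.exp l * l ^ 2 ≤ Real.exp b * l ^ 2 := by gcongr
  have h3 : l * (Real.exp l - 1) ≤ l * (l * Real.exp l) := by gcongr
  have h4 := Real.add_one_le_exp l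
  unfold psiP
  nlinarith

theorem psiE_nonneg {l : ℝ} (h1 : l < 1) : 0 ≤ psiE l := by
  unfold psiE
  linarith [Real.log_le_sub_one_of_pos (by linarith : 0 < 1 - l)]

/-- The remainder of the Taylor series of `log (1 - l)` after two terms, the linear one being
cancelled in `psiE`. -/
theorem abs_psiE_sub_le {l b : ℝ} (h0 : 0 ≤ l) (hb : l ≤ b) (hb1 : b < 1) :
    |psiE l - l ^ 2 / 2| ≤ l ^ 3 / (1 - b) := by
  have h := Real.abs_log_sub_add_sum_range_le (x := l) (by rw [abs_of_nonneg h0]; linarith) 2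
  rw [abs_of_nonneg h0] at h
  have e : psiE l - l ^ 2 / 2 =
      -(∑ i ∈ Finset.range 2, l ^ (i + 1) / ((i : ℝ) + 1) + Real.log (1 - l)) := by
    simp [Finset.sum_range_succ, psiE]
    ring
  rw [e, abs_neg]
  refine h.trans ?_
  have : 0 < 1 - b := by linarith
  gcongr

theorem psiE_le {l b : ℝ} (h0 : 0 ≤ l) (hb : l ≤ b) (hb1 : b < 1) :
    psiE l ≤ (1 + 1 / (1 - b)) * l ^ 2 := by
  have h := (abs_le.1 (abs_psiE_sub_le h0 hb hb1)).2
  have hb' : 0 < 1 - b := by linarith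
  have h2 : l ^ 3 / (1 - b) ≤ 1 / (1 - b) * l ^ 2 := by
    rw [div_mul_eq_mul_div, one_mul]
    gcongr ?_ / _
    nlinarith [sq_nonneg l]
  nlinarith [sq_nonneg l]

/-- Summation by parts: with antitone nonnegative weights, a bound on the partial sums carries over
to the weighted partial sums. -/
theorem norm_sum_smul_le {E : Type*} [NormedAddCommGroup E] [NormedSpace ℝ E] (lam d : ℕ → ℝ)
    (ξ : ℕ → E) (hlam : ∀ i, 1 ≤ i → lam (i + 1) ≤ lam i) (hlam0 : ∀ i, 1 ≤ i → 0 ≤ lam i)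
    (hw : ∀ n, ‖∑ i ∈ Finset.Icc 1 n, ξ i‖ ≤ ∑ i ∈ Finset.Icc 1 n, d i) (n : ℕ) :
    ‖∑ i ∈ Finset.Icc 1 n, lam i • ξ i‖ ≤ ∑ i ∈ Finset.Icc 1 n, lam i * d i := by
  rcases Nat.eq_zero_or_pos n with rfl | hn
  · simp
  -- Subtracting the boundary term makes the induction work: each step adds `(lam n - lam (n+1))`
  -- times a partial sum, and that coefficient is nonnegative.
  have key : ∀ n, 1 ≤ n →
      ‖∑ i ∈ Finset.Icc 1 n, lam i • ξ i - lam n • ∑ i ∈ Finset.Icc 1 n, ξ i‖ ≤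
        ∑ i ∈ Finset.Icc 1 n, lam i * d i - lam n * ∑ i ∈ Finset.Icc 1 n, d i := by
    intro n hn
    induction n, hn using Nat.le_induction with
    | base => simp
    | succ n hn ih =>
      rw [Finset.sum_Icc_succ_top (by omega), Finset.sum_Icc_succ_top (by omega),
        Finset.sum_Icc_succ_top (by omega), Finset.sum_Icc_succ_top (by omega)]
      have e : ∑ i ∈ Finset.Icc 1 n, lam i • ξ i + lam (n + 1) • ξ (n + 1) -
          lam (n + 1) • (∑ i ∈ Finset.Icc 1 n, ξ i + ξ (n + 1)) =
          (∑ i ∈ Finset.Icc 1 n, lam i • ξ i - lam n • ∑ i ∈ Finset.Icc 1 n, ξ i) +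
          (lam n - lam (n + 1)) • ∑ i ∈ Finset.Icc 1 n, ξ i := by
        module
      rw [e]
      refine (norm_add_le _ _).trans ?_
      rw [norm_smul, Real.norm_of_nonneg (by linarith [hlam n hn])]
      have := mul_le_mul_of_nonneg_left (hw n) (by linarith [hlam n hn] : 0 ≤ lam n - lam (n + 1))
      nlinarith
  have h1 := key n hn
  have h2 : ‖lam n • ∑ i ∈ Finset.Icc 1 n, ξ i‖ ≤ lam n * ∑ i ∈ Finset.Icc 1 n, d i := by
    rw [norm_smul, Real.norm_of_nonneg (hlam0 n hn)]
    exact mul_le_mul_of_nonneg_left (hw n) (hlam0 n hn)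
  have h3 := norm_add_le (∑ i ∈ Finset.Icc 1 n, lam i • ξ i - lam n • ∑ i ∈ Finset.Icc 1 n, ξ i)
    (lam n • ∑ i ∈ Finset.Icc 1 n, ξ i)
  rw [sub_add_cancel] at h3
  linarith

theorem rpow_le_rpow_of_one_le_cast {i : ℕ} (hi : 1 ≤ i) {p q : ℝ} (h : p ≤ q) :
    (i : ℝ) ^ p ≤ (i : ℝ) ^ q :=
  Real.rpow_le_rpow_of_exponent_le (by exact_mod_cast hi) h

theorem rpow_le_one_of_one_le_cast {i : ℕ} (hi : 1 ≤ i) {p : ℝ} (h : p ≤ 0) :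
    (i : ℝ) ^ p ≤ 1 :=
  Real.rpow_le_one_of_one_le_of_nonpos (by exact_mod_cast hi) h

theorem one_le_rpow_of_one_le_cast {i : ℕ} (hi : 1 ≤ i) {p : ℝ} (h : 0 ≤ p) :
    1 ≤ (i : ℝ) ^ p :=
  Real.one_le_rpow (by exact_mod_cast hi) h

/-- A perturbation of size `O(k ^ (-3/8))`, and the addition of a constant to the numerator, keep
the rate `n ^ (-3/8)` of an average. -/
theorem exists_abs_shifted_average_sub_le (a b : ℕ → ℝ) (s c₀ C₁ C₂ : ℝ)
    (h₁ : ∀ n : ℕ, |∑ k ∈ Finset.Icc 1 n, (a k - s)| ≤ C₁ * (n : ℝ) ^ (9 / 16 : ℝ))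
    (h₂ : ∀ k : ℕ, 1 ≤ k → |b k - a k| ≤ C₂ * (k : ℝ) ^ (-(3 / 8) : ℝ)) (i : ℕ) (hi : 1 ≤ i) :
    |(c₀ + ∑ k ∈ Finset.Icc 1 (i - 1), b k) / i - s| ≤
      (|c₀ - s| + 8 / 5 * C₂ + C₁) * (i : ℝ) ^ (-(3 / 8) : ℝ) := by
  have hi' : (0 : ℝ) < i := by exact_mod_cast hi
  have hC1 : 0 ≤ C₁ := by
    have := (abs_nonneg _).trans (h₁ 1)
    simpa using this
  have hC2 : 0 ≤ C₂ := by
    have := (abs_nonneg _).trans (h₂ 1 le_rfl)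
    simpa using this
  -- Of the `i` copies of `s`, one goes to `c₀` and `i - 1` go to the summands.
  have e : (c₀ + ∑ k ∈ Finset.Icc 1 (i - 1), b k) / i - s =
      ((c₀ - s) + ∑ k ∈ Finset.Icc 1 (i - 1), (b k - a k) +
        ∑ k ∈ Finset.Icc 1 (i - 1), (a k - s)) / i := by
    simp only [Finset.sum_sub_distrib, Finset.sum_const, Nat.card_Icc, nsmul_eq_mul,
      Nat.add_sub_cancel, Nat.cast_sub hi]
    field_simp
    push_cast
    ring
  rw [e, abs_div, abs_of_pos hi', div_le_iff₀ hi', mul_assoc]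
  have e2 : (i : ℝ) ^ (-(3 / 8) : ℝ) * i = (i : ℝ) ^ (5 / 8 : ℝ) := by
    rw [← Real.rpow_add_one hi'.ne']
    norm_num
  rw [e2]
  have hle : ((i - 1 : ℕ) : ℝ) ≤ i := by exact_mod_cast Nat.sub_le i 1
  have b1 : |c₀ - s| ≤ |c₀ - s| * (i : ℝ) ^ (5 / 8 : ℝ) :=
    le_mul_of_one_le_right (abs_nonneg _) (one_le_rpow_of_one_le_cast hi (by norm_num))
  have b2 : |∑ k ∈ Finset.Icc 1 (i - 1), (b k - a k)| ≤ 8 / 5 * C₂ * (i : ℝ) ^ (5 / 8 : ℝ) := by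
    calc |∑ k ∈ Finset.Icc 1 (i - 1), (b k - a k)|
        ≤ ∑ k ∈ Finset.Icc 1 (i - 1), |b k - a k| := Finset.abs_sum_le_sum_abs _ _
      _ ≤ ∑ k ∈ Finset.Icc 1 (i - 1), C₂ * (k : ℝ) ^ (-(3 / 8) : ℝ) :=
          Finset.sum_le_sum fun k hk => h₂ k (Finset.mem_Icc.1 hk).1
      _ = C₂ * ∑ k ∈ Finset.Icc 1 (i - 1), (k : ℝ) ^ ((5 / 8 : ℝ) - 1) := by
          rw [← Finset.mul_sum]; norm_num
      _ ≤ C₂ * (((i - 1 : ℕ) : ℝ) ^ (5 / 8 : ℝ) / (5 / 8)) := by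
          gcongr
          exact sum_rpow_sub_one_le (by norm_num) (by norm_num) _
      _ ≤ C₂ * ((i : ℝ) ^ (5 / 8 : ℝ) / (5 / 8)) := by gcongr
      _ = _ := by ring
  have b3 : |∑ k ∈ Finset.Icc 1 (i - 1), (a k - s)| ≤ C₁ * (i : ℝ) ^ (5 / 8 : ℝ) :=
    calc _ ≤ C₁ * ((i - 1 : ℕ) : ℝ) ^ (9 / 16 : ℝ) := h₁ _
      _ ≤ C₁ * (i : ℝ) ^ (9 / 16 : ℝ) := by gcongr
      _ ≤ _ := by
          gcongr C₁ * ?_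
          exact rpow_le_rpow_of_one_le_cast hi (by norm_num)
  have := abs_add_three (c₀ - s) (∑ k ∈ Finset.Icc 1 (i - 1), (b k - a k))
    (∑ k ∈ Finset.Icc 1 (i - 1), (a k - s))
  linarith

/-- Quantities that approach a positive limit at a common rate, and are at least `c / k`, are
bounded below by a common positive constant. -/
theorem exists_pos_lower_bound {c s : ℝ} (hc : 0 < c) (hs : 0 < s) (C : ℝ) :
    ∃ m : ℝ, 0 < m ∧ ∀ (k : ℕ) (y : ℝ), 1 ≤ k → c / k ≤ y →
      |y - s| ≤ C * (k : ℝ) ^ (-(3 / 8) : ℝ) → m ≤ y := by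
  have h : Tendsto (fun k : ℕ => C * (k : ℝ) ^ (-(3 / 8) : ℝ)) atTop (𝓝 (C * 0)) :=
    ((tendsto_rpow_neg_atTop (by norm_num)).comp tendsto_natCast_atTop_atTop).const_mul C
  rw [mul_zero] at h
  obtain ⟨N, hN⟩ := eventually_atTop.1 (h.eventually (gt_mem_nhds (half_pos hs)))
  -- Past `N` the limit keeps `y` above `s / 2`; up to `N` the bound `c / k` takes over.
  refine ⟨min (s / 2) (c / (N + 1)), by positivity, fun k y hk hy hys => ?_⟩
  rcases le_total N k with hNk | hNk
  · have := hN k hNk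
    have := (abs_le.1 hys).1
    exact (min_le_left _ _).trans (by linarith)
  · refine (min_le_right _ _).trans (le_trans ?_ hy)
    have h1 : (0 : ℝ) < k := by exact_mod_cast hk
    have h2 : (k : ℝ) ≤ N := by exact_mod_cast hNk
    gcongr
    linarith

end RealBounds

/-! ### Rates of the running mean and of the variance estimator on a regular path. -/

section Path

theorem cast_pred_add_one {i : ℕ} (hi : 1 ≤ i) : ((i - 1 : ℕ) : ℝ) + 1 = i := by
  exact_mod_cast Nat.sub_add_cancel hi

theorem RegularPath.norm_sub_le {H : Type*} [NormedAddCommGroup H] {x : ℕ → H} {μ : H} {s v : ℝ}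
    (hx : RegularPath x μ s v) {i : ℕ} (hi : 1 ≤ i) : ‖x i - μ‖ ≤ 1 :=
  (_root_.norm_sub_le _ _).trans (by linarith [hx.norm_le i hi, hx.norm_mean_le])

/-- Factor the difference of squares: the crude bound `C` controls the sum of the norms, the rate
`e` their difference. -/
theorem RegularPath.abs_norm_sq_sub_le {H : Type*} [NormedAddCommGroup H] {x : ℕ → H} {μ : H}
    {s v : ℝ} (hx : RegularPath x μ s v) {i : ℕ} (hi : 1 ≤ i) {m : H} {C e : ℝ} (hC : ‖m - μ‖ ≤ C) (he : ‖m - μ‖ ≤ e) :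
    |‖x i - m‖ ^ 2 - ‖x i - μ‖ ^ 2| ≤ (2 + C) * e := by
  have h1 : |‖x i - m‖ - ‖x i - μ‖| ≤ ‖m - μ‖ := by
    refine (abs_norm_sub_norm_le _ _).trans ?_
    rw [sub_sub_sub_cancel_left, norm_sub_rev]
  have h2 := hx.norm_sub_le hi
  have h3 : ‖x i - m‖ ≤ ‖x i - μ‖ + ‖m - μ‖ := by linarith [(abs_le.1 h1).2]
  have e1 : ‖x i - m‖ ^ 2 - ‖x i - μ‖ ^ 2 =
      (‖x i - m‖ - ‖x i - μ‖) * (‖x i - m‖ + ‖x i - μ‖) := by ring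
  rw [e1, abs_mul, abs_of_nonneg (by positivity : 0 ≤ ‖x i - m‖ + ‖x i - μ‖), mul_comm]
  have h4 := norm_nonneg (m - μ)
  exact mul_le_mul (by linarith) (h1.trans he) (abs_nonneg _) (by linarith)

variable {H : Type*} [NormedAddCommGroup H] [InnerProductSpace ℝ H]

/-- The path gives the exponent `9/16 - 1 = -7/16`; it is relaxed to `-3/8`, the rate shared by all
estimators. -/
theorem RegularPath.exists_norm_runningMean_sub_le {x : ℕ → H} {μ : H} {s v : ℝ}
    (hx : RegularPath x μ s v) (c : Tuning H) :
    ∃ C : ℝ, 0 ≤ C ∧ ∀ i : ℕ, 1 ≤ i → ‖runningMean c x i - μ‖ ≤ C * (i : ℝ) ^ (-(3 / 8) : ℝ) := by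
  obtain ⟨C, hC⟩ := hx.sum_mean
  have hC0 : 0 ≤ C := by simpa using (norm_nonneg _).trans (hC 1)
  refine ⟨1 + C, by linarith, fun i hi => ?_⟩
  have hi' : (0 : ℝ) < i := by exact_mod_cast hi
  have e : runningMean c x i - μ =
      (i : ℝ)⁻¹ • ((c.c₄ - μ) + ∑ k ∈ Finset.Icc 1 (i - 1), (x k - μ)) := by
    have h2 : μ = (i : ℝ)⁻¹ • ((i : ℝ) • μ) := by
      rw [smul_smul, inv_mul_cancel₀ hi'.ne', one_smul]
    conv_lhs => rw [runningMean, h2, ← smul_sub]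
    congr 1
    simp only [Finset.sum_sub_distrib, Finset.sum_const, Nat.card_Icc, Nat.add_sub_cancel]
    rw [← Nat.cast_smul_eq_nsmul ℝ, ← cast_pred_add_one hi]
    module
  rw [e, norm_smul, norm_inv, Real.norm_of_nonneg hi'.le, inv_mul_le_iff₀ hi']
  have e2 : (i : ℝ) * ((1 + C) * (i : ℝ) ^ (-(3 / 8) : ℝ)) = (1 + C) * (i : ℝ) ^ (5 / 8 : ℝ) := by
    have : (i : ℝ) ^ (5 / 8 : ℝ) = (i : ℝ) ^ (-(3 / 8) : ℝ) * i := by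
      rw [← Real.rpow_add_one hi'.ne']
      norm_num
    rw [this]
    ring
  rw [e2]
  have h1 : ‖c.c₄ - μ‖ ≤ 1 :=
    (_root_.norm_sub_le _ _).trans (by linarith [c.norm_c₄_le, hx.norm_mean_le])
  have h2 : ((i - 1 : ℕ) : ℝ) ^ (9 / 16 : ℝ) ≤ (i : ℝ) ^ (5 / 8 : ℝ) :=
    calc ((i - 1 : ℕ) : ℝ) ^ (9 / 16 : ℝ) ≤ (i : ℝ) ^ (9 / 16 : ℝ) := by
          gcongr
          exact_mod_cast Nat.sub_le i 1
      _ ≤ _ := rpow_le_rpow_of_one_le_cast hi (by norm_num)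
  have h3 := one_le_rpow_of_one_le_cast hi (by norm_num : (0 : ℝ) ≤ 5 / 8)
  refine (norm_add_le _ _).trans ?_
  have h4 := (hC (i - 1)).trans (mul_le_mul_of_nonneg_left h2 hC0)
  linarith

/-- A convex combination of points of the ball, `c₄` being one of them. -/
theorem norm_runningMean_le (c : Tuning H) {x : ℕ → H} (hx : ∀ i, 1 ≤ i → ‖x i‖ ≤ 1 / 2) {i : ℕ}
    (hi : 1 ≤ i) : ‖runningMean c x i‖ ≤ 1 / 2 := by
  have hi' : (0 : ℝ) < i := by exact_mod_cast hi
  rw [runningMean, norm_smul, norm_inv, Real.norm_of_nonneg hi'.le, inv_mul_le_iff₀ hi']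
  have h : ‖∑ k ∈ Finset.Icc 1 (i - 1), x k‖ ≤ ∑ k ∈ Finset.Icc 1 (i - 1), (1 / 2 : ℝ) :=
    norm_sum_le_of_le _ fun k hk => hx k (Finset.mem_Icc.1 hk).1
  simp only [Finset.sum_const, Nat.card_Icc, Nat.add_sub_cancel, nsmul_eq_mul] at h
  have := norm_add_le c.c₄ (∑ k ∈ Finset.Icc 1 (i - 1), x k)
  linarith [c.norm_c₄_le, cast_pred_add_one hi]

theorem sigmaHatSq_mul (c : Tuning H) (x : ℕ → H) {i : ℕ} (hi : 1 ≤ i) :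
    sigmaHatSq c x i * i =
      c.c₃ + ∑ k ∈ Finset.Icc 1 (i - 1), ‖x k - runningMean c x k‖ ^ 2 := by
  have hi' : (i : ℝ) ≠ 0 := by positivity
  rw [sigmaHatSq, div_mul_cancel₀ _ hi']

theorem sigmaHatSq_lower (c : Tuning H) (x : ℕ → H) (i : ℕ) : c.c₃ / i ≤ sigmaHatSq c x i := by
  unfold sigmaHatSq
  gcongr
  exact le_add_of_nonneg_right (by positivity)

theorem sigmaHatSq_pos (c : Tuning H) (x : ℕ → H) {i : ℕ} (hi : 1 ≤ i) :
    0 < sigmaHatSq c x i := by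
  have hi' : (0 : ℝ) < i := by exact_mod_cast hi
  have := c.c₃_pos
  exact lt_of_lt_of_le (by positivity) (sigmaHatSq_lower c x i)

theorem sigmaHatSq_le_one (c : Tuning H) {x : ℕ → H} (hx : ∀ i, 1 ≤ i → ‖x i‖ ≤ 1 / 2) {i : ℕ}
    (hi : 1 ≤ i) : sigmaHatSq c x i ≤ 1 := by
  have hi' : (0 : ℝ) < i := by exact_mod_cast hi
  rw [sigmaHatSq, div_le_one hi']
  have h : ∑ k ∈ Finset.Icc 1 (i - 1), ‖x k - runningMean c x k‖ ^ 2 ≤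
      ∑ k ∈ Finset.Icc 1 (i - 1), (1 : ℝ) := by
    refine Finset.sum_le_sum fun k hk => pow_le_one₀ (norm_nonneg _) ?_
    have hk1 := (Finset.mem_Icc.1 hk).1
    exact (_root_.norm_sub_le _ _).trans (by linarith [hx k hk1, norm_runningMean_le c hx hk1])
  simp only [Finset.sum_const, Nat.card_Icc, Nat.add_sub_cancel, nsmul_eq_mul, mul_one] at h
  linarith [c.c₃_le_one, cast_pred_add_one hi]

/-- The estimator itself may fluctuate, but `t σ̂_t²` is a growing sum. This is why the mean
plug-ins are antitone, as summation by parts requires. -/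
theorem sigmaHatSq_mul_mono (c : Tuning H) (x : ℕ → H) {k i : ℕ} (hk : 1 ≤ k) (hki : k ≤ i) :
    sigmaHatSq c x k * k ≤ sigmaHatSq c x i * i := by
  rw [sigmaHatSq_mul c x hk, sigmaHatSq_mul c x (hk.trans hki)]
  gcongr

theorem RegularPath.exists_abs_sigmaHatSq_sub_le {x : ℕ → H} {μ : H} {s v : ℝ}
    (hx : RegularPath x μ s v) (c : Tuning H) :
    ∃ C : ℝ, 0 ≤ C ∧ ∀ i : ℕ, 1 ≤ i → |sigmaHatSq c x i - s| ≤ C * (i : ℝ) ^ (-(3 / 8) : ℝ) := by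
  obtain ⟨C, hC0, hC⟩ := hx.exists_norm_runningMean_sub_le c
  obtain ⟨C₁, hC₁⟩ := hx.sum_var
  have h := exists_abs_shifted_average_sub_le (fun k => ‖x k - μ‖ ^ 2)
    (fun k => ‖x k - runningMean c x k‖ ^ 2) s c.c₃ C₁ ((2 + C) * C) hC₁ (fun k hk => by
      rw [mul_assoc]
      refine hx.abs_norm_sq_sub_le hk ((hC k hk).trans ?_) (hC k hk)
      exact mul_le_of_le_one_right hC0 (rpow_le_one_of_one_le_cast hk (by norm_num)))
  exact ⟨_, by simpa using (abs_nonneg _).trans (h 1 le_rfl), h⟩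

/-- The path is constant, so the deviation from the running mean at time `k` is exactly `(μ - c₄) /
k`, whose squares are summable. -/
theorem RegularPath.exists_sigmaHatSq_le_of_eq_zero {x : ℕ → H} {μ : H} {s v : ℝ}
    (hx : RegularPath x μ s v) (c : Tuning H) (hs : s = 0) :
    ∃ C : ℝ, 0 ≤ C ∧ ∀ i : ℕ, 1 ≤ i → sigmaHatSq c x i ≤ C / i := by
  set T : ℝ := ∑' k : ℕ, ((k : ℝ) ^ 2)⁻¹ with hT
  have hsum : Summable fun k : ℕ => ((k : ℝ) ^ 2)⁻¹ := Real.summable_nat_pow_inv.2 (by norm_num)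
  have hT0 : 0 ≤ T := tsum_nonneg fun k => by positivity
  refine ⟨c.c₃ + T, by linarith [c.c₃_pos], fun i hi => ?_⟩
  have hxe := hx.eq_mean hs
  unfold sigmaHatSq
  gcongr
  refine le_trans (Finset.sum_le_sum fun k hk => ?_) (hsum.sum_le_tsum (Finset.Icc 1 (i - 1))
    fun k _ => by positivity)
  have hk1 := (Finset.mem_Icc.1 hk).1
  have hk' : (0 : ℝ) < k := by exact_mod_cast hk1
  have e : x k - runningMean c x k = (k : ℝ)⁻¹ • (μ - c.c₄) := by
    have h1 : ∑ j ∈ Finset.Icc 1 (k - 1), x j = ((k : ℝ) - 1) • μ := by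
      rw [Finset.sum_congr rfl fun j hj => hxe j (Finset.mem_Icc.1 hj).1]
      rw [Finset.sum_const, Nat.card_Icc, Nat.add_sub_cancel, ← Nat.cast_smul_eq_nsmul ℝ,
        ← cast_pred_add_one hk1, add_sub_cancel_right]
    have h2 : μ = (k : ℝ)⁻¹ • ((k : ℝ) • μ) := by
      rw [smul_smul, inv_mul_cancel₀ hk'.ne', one_smul]
    rw [runningMean, h1, hxe k hk1]
    conv_lhs => rw [h2]
    rw [← smul_sub]
    congr 1
    rw [← h2]
    module
  have h3 : ‖μ - c.c₄‖ ≤ 1 :=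
    (_root_.norm_sub_le _ _).trans (by linarith [c.norm_c₄_le, hx.norm_mean_le])
  rw [e, norm_smul, norm_inv, Real.norm_of_nonneg hk'.le, mul_pow, inv_pow]
  exact mul_le_of_le_one_right (by positivity) (pow_le_one₀ (norm_nonneg _) h3)

theorem RegularPath.exists_sigmaHatSq_lower {x : ℕ → H} {μ : H} {s v : ℝ}
    (hx : RegularPath x μ s v) (c : Tuning H) (hs : 0 < s) :
    ∃ m : ℝ, 0 < m ∧ ∀ k : ℕ, 1 ≤ k → m ≤ sigmaHatSq c x k := by
  obtain ⟨C, -, hC⟩ := hx.exists_abs_sigmaHatSq_sub_le c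
  obtain ⟨m, hm0, hm⟩ := exists_pos_lower_bound c.c₃_pos hs C
  exact ⟨m, hm0, fun k hk => hm k _ hk (sigmaHatSq_lower c x k) (hC k hk)⟩

/-- The variance estimates are almost antitone. -/
theorem RegularPath.exists_sigmaHatSq_le_mul {x : ℕ → H} {μ : H} {s v : ℝ}
    (hx : RegularPath x μ s v) (c : Tuning H) :
    ∃ C : ℝ, 1 ≤ C ∧ ∀ k i : ℕ, 1 ≤ k → k ≤ i → sigmaHatSq c x i ≤ C * sigmaHatSq c x k := by
  suffices ∃ C : ℝ, ∀ k i : ℕ, 1 ≤ k → k ≤ i → sigmaHatSq c x i ≤ C * sigmaHatSq c x k by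
    obtain ⟨C, hC⟩ := this
    refine ⟨C, ?_, hC⟩
    have h1 := hC 1 1 le_rfl le_rfl
    have h2 := sigmaHatSq_pos c x le_rfl
    by_contra! h
    nlinarith
  -- For `s = 0` the estimates are of exact order `1 / i`; for `s > 0` they lie between a positive
  -- constant and `1`.
  rcases hx.var_nonneg.eq_or_lt with hs | hs
  · obtain ⟨C, hC0, hC⟩ := hx.exists_sigmaHatSq_le_of_eq_zero c hs.symm
    refine ⟨C / c.c₃, fun k i hk hki => (hC i (hk.trans hki)).trans ?_⟩
    have hk' : (0 : ℝ) < k := by exact_mod_cast hk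
    have h3 := c.c₃_pos
    calc C / i ≤ C / k := by gcongr
      _ = C / c.c₃ * (c.c₃ / k) := by field_simp
      _ ≤ _ := by
          gcongr
          exact sigmaHatSq_lower c x k
  · obtain ⟨m, hm0, hm⟩ := hx.exists_sigmaHatSq_lower c hs
    refine ⟨1 / m, fun k i hk hki => (sigmaHatSq_le_one c hx.norm_le (hk.trans hki)).trans ?_⟩
    rw [one_div, ← div_eq_inv_mul, le_div_iff₀ hm0, one_mul]
    exact hm k hk

/-! ### The mean plug-ins, with bounds uniform in their level. -/

section LamTilde

variable (c : Tuning H) (x : ℕ → H)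

/-- The denominator in the mean plug-ins. -/
def lamTildeDenom (t : ℕ) : ℝ := sigmaHatSq c x t * t * Real.log (1 + t)

theorem lamTildeDenom_lower {t : ℕ} (ht : 1 ≤ t) :
    sigmaHatSq c x t * t / 2 ≤ lamTildeDenom c x t := by
  have h1 := half_le_log_one_add (t := t) (by exact_mod_cast ht)
  have h2 : 0 ≤ sigmaHatSq c x t * t := mul_nonneg (sigmaHatSq_pos c x ht).le (by positivity)
  unfold lamTildeDenom
  nlinarith

theorem lamTildeDenom_upper {t : ℕ} (ht : 1 ≤ t) :
    lamTildeDenom c x t ≤ 16 * sigmaHatSq c x t * (t : ℝ) ^ (9 / 8 : ℝ) := by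
  have ht' : (0 : ℝ) < t := by exact_mod_cast ht
  have h1 := log_one_add_le (t := t) (by exact_mod_cast ht)
  have h2 : 0 ≤ sigmaHatSq c x t * t := mul_nonneg (sigmaHatSq_pos c x ht).le (by positivity)
  have e : (t : ℝ) ^ (9 / 8 : ℝ) = (t : ℝ) ^ (1 / 8 : ℝ) * t := by
    rw [← Real.rpow_add_one ht'.ne']
    norm_num
  calc lamTildeDenom c x t ≤ sigmaHatSq c x t * t * (16 * (t : ℝ) ^ (1 / 8 : ℝ)) := by
        unfold lamTildeDenom
        gcongr
    _ = _ := by rw [e]; ring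

theorem lamTildeDenom_pos {t : ℕ} (ht : 1 ≤ t) : 0 < lamTildeDenom c x t := by
  have ht' : (0 : ℝ) < t := by exact_mod_cast ht
  have := sigmaHatSq_pos c x ht
  exact lt_of_lt_of_le (by positivity) (lamTildeDenom_lower c x ht)

theorem lamTildeDenom_mono {k i : ℕ} (hk : 1 ≤ k) (hki : k ≤ i) :
    lamTildeDenom c x k ≤ lamTildeDenom c x i := by
  unfold lamTildeDenom
  have hi : 1 ≤ i := hk.trans hki
  have hk' : (1 : ℝ) ≤ k := by exact_mod_cast hk
  have hki' : (k : ℝ) ≤ i := by exact_mod_cast hki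
  have h1 := half_le_log_one_add (t := k) hk'
  have h2 : 0 ≤ sigmaHatSq c x i * i := mul_nonneg (sigmaHatSq_pos c x hi).le (by positivity)
  refine mul_le_mul (sigmaHatSq_mul_mono c x hk hki) ?_ (by linarith) h2
  exact Real.log_le_log (by linarith) (by linarith)

variable {β : ℝ} (hβ0 : 0 < β) (hβ1 : β ≤ 1)

include hβ0 hβ1

theorem lamTilde_pos {t : ℕ} (ht : 1 ≤ t) : 0 < lamTilde c β x t := by
  have h1 := one_le_two_mul_log hβ0 hβ1
  have h2 := lamTildeDenom_pos c x ht
  exact lt_min (Real.sqrt_pos.2 (div_pos (by linarith) h2)) c.c₅_pos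

theorem lamTilde_anti {k i : ℕ} (hk : 1 ≤ k) (hki : k ≤ i) :
    lamTilde c β x i ≤ lamTilde c β x k := by
  have h1 := one_le_two_mul_log hβ0 hβ1
  have h2 := lamTildeDenom_pos c x hk
  exact min_le_min_right _ (Real.sqrt_le_sqrt (div_le_div_of_nonneg_left (by linarith) h2
    (lamTildeDenom_mono c x hk hki)))

theorem lamTilde_sq_le {t : ℕ} (ht : 1 ≤ t) :
    lamTilde c β x t ^ 2 ≤ 2 * Real.log (2 / β) * (2 / (sigmaHatSq c x t * t)) := by
  have ht' : (0 : ℝ) < t := by exact_mod_cast ht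
  have h1 := one_le_two_mul_log hβ0 hβ1
  have h2 := lamTildeDenom_pos c x ht
  have h3 := sigmaHatSq_pos c x ht
  calc lamTilde c β x t ^ 2 ≤ √(2 * Real.log (2 / β) / lamTildeDenom c x t) ^ 2 :=
        pow_le_pow_left₀ (lamTilde_pos c x hβ0 hβ1 ht).le (min_le_left _ _) 2
    _ = 2 * Real.log (2 / β) / lamTildeDenom c x t :=
        Real.sq_sqrt (div_nonneg (by linarith) h2.le)
    _ ≤ 2 * Real.log (2 / β) / (sigmaHatSq c x t * t / 2) :=
        div_le_div_of_nonneg_left (by linarith) (by positivity) (lamTildeDenom_lower c x ht)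
    _ = _ := by field_simp

/-- The numerator under the root is at least `1` and, as `σ̂² ≤ 1`, the denominator is at most `16 t
^ (9/8)`; the root gives the constant `1/4`. -/
theorem lamTilde_lower (hx : ∀ i, 1 ≤ i → ‖x i‖ ≤ 1 / 2) {t : ℕ} (ht : 1 ≤ t) :
    min (1 / 4) c.c₅ * (t : ℝ) ^ (-(9 / 16) : ℝ) ≤ lamTilde c β x t := by
  have ht' : (0 : ℝ) < t := by exact_mod_cast ht
  have h1 := one_le_two_mul_log hβ0 hβ1
  have h2 := lamTildeDenom_pos c x ht
  have h5 := c.c₅_pos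
  refine le_min ?_ ?_
  · calc min (1 / 4) c.c₅ * (t : ℝ) ^ (-(9 / 16) : ℝ) ≤ 1 / 4 * (t : ℝ) ^ (-(9 / 16) : ℝ) := by
          gcongr
          exact min_le_left _ _
      _ ≤ √(2 * Real.log (2 / β) / lamTildeDenom c x t) := by
          refine Real.le_sqrt_of_sq_le ?_
          rw [mul_pow, ← Real.rpow_natCast, ← Real.rpow_natCast, ← Real.rpow_mul ht'.le]
          have e : ((t : ℝ) ^ (-(9 / 16) * (2 : ℕ) : ℝ)) = ((t : ℝ) ^ (9 / 8 : ℝ))⁻¹ := by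
            rw [← Real.rpow_neg ht'.le]
            norm_num
          rw [e, le_div_iff₀ h2]
          have h3 := lamTildeDenom_upper c x ht
          have h4 := sigmaHatSq_le_one c hx ht
          have h6 : lamTildeDenom c x t ≤ 16 * (t : ℝ) ^ (9 / 8 : ℝ) := by
            refine h3.trans ?_
            gcongr
            linarith
          have h7 : ((t : ℝ) ^ (9 / 8 : ℝ))⁻¹ * lamTildeDenom c x t ≤ 16 := by
            rw [inv_mul_le_iff₀ (by positivity)]
            linarith
          norm_num
          linarith
  · calc min (1 / 4) c.c₅ * (t : ℝ) ^ (-(9 / 16) : ℝ) ≤ c.c₅ * 1 := by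
          gcongr
          · exact min_le_right _ _
          · exact rpow_le_one_of_one_le_cast ht (by norm_num)
      _ = c.c₅ := mul_one _

theorem mul_lamTilde_le_sumLamTilde (t : ℕ) :
    ((t - 1 : ℕ) : ℝ) * lamTilde c β x (t - 1) ≤ sumLamTilde c β x t := by
  unfold sumLamTilde
  calc ((t - 1 : ℕ) : ℝ) * lamTilde c β x (t - 1)
      = ∑ i ∈ Finset.Icc 1 (t - 1), lamTilde c β x (t - 1) := by simp
    _ ≤ _ := Finset.sum_le_sum fun i hi =>
        lamTilde_anti c x hβ0 hβ1 (Finset.mem_Icc.1 hi).1 (Finset.mem_Icc.1 hi).2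

theorem sumLamTilde_lower (hx : ∀ i, 1 ≤ i → ‖x i‖ ≤ 1 / 2) {t : ℕ} (ht : 2 ≤ t) :
    min (1 / 4) c.c₅ / 2 * (t : ℝ) ^ (7 / 16 : ℝ) ≤ sumLamTilde c β x t := by
  refine le_trans ?_ (mul_lamTilde_le_sumLamTilde c x hβ0 hβ1 t)
  have h5 := c.c₅_pos
  have ht1 : 1 ≤ t - 1 := by omega
  have ht' : (0 : ℝ) < ((t - 1 : ℕ) : ℝ) := by exact_mod_cast ht1
  have h1 := lamTilde_lower c x hβ0 hβ1 hx ht1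
  have e : ((t - 1 : ℕ) : ℝ) ^ (7 / 16 : ℝ) =
      ((t - 1 : ℕ) : ℝ) ^ (-(9 / 16) : ℝ) * ((t - 1 : ℕ) : ℝ) := by
    rw [← Real.rpow_add_one ht'.ne']
    norm_num
  have h2 : (t : ℝ) ^ (7 / 16 : ℝ) ≤ 2 * ((t - 1 : ℕ) : ℝ) ^ (7 / 16 : ℝ) := by
    have h3 : (t : ℝ) ≤ 2 * ((t - 1 : ℕ) : ℝ) := by exact_mod_cast (by omega : t ≤ 2 * (t - 1))
    have h4 : (2 : ℝ) ^ (7 / 16 : ℝ) ≤ 2 := by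
      simpa using Real.rpow_le_rpow_of_exponent_le (by norm_num : (1 : ℝ) ≤ 2)
        (by norm_num : (7 / 16 : ℝ) ≤ 1)
    calc (t : ℝ) ^ (7 / 16 : ℝ) ≤ (2 * ((t - 1 : ℕ) : ℝ)) ^ (7 / 16 : ℝ) := by gcongr
      _ = (2 : ℝ) ^ (7 / 16 : ℝ) * ((t - 1 : ℕ) : ℝ) ^ (7 / 16 : ℝ) :=
          Real.mul_rpow (by norm_num) ht'.le
      _ ≤ _ := by gcongr
  calc min (1 / 4) c.c₅ / 2 * (t : ℝ) ^ (7 / 16 : ℝ)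
      ≤ min (1 / 4) c.c₅ / 2 * (2 * ((t - 1 : ℕ) : ℝ) ^ (7 / 16 : ℝ)) := by gcongr
    _ = ((t - 1 : ℕ) : ℝ) * (min (1 / 4) c.c₅ * ((t - 1 : ℕ) : ℝ) ^ (-(9 / 16) : ℝ)) := by
        rw [e]; ring
    _ ≤ _ := by gcongr

theorem sumLamTilde_pos {t : ℕ} (ht : 2 ≤ t) : 0 < sumLamTilde c β x t :=
  Finset.sum_pos (fun _ hi => lamTilde_pos c x hβ0 hβ1 (Finset.mem_Icc.1 hi).1)
    ⟨1, Finset.mem_Icc.2 ⟨le_rfl, by omega⟩⟩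

theorem sumPsiP_pos {t : ℕ} (ht : 2 ≤ t) : 0 < sumPsiP c β x t :=
  Finset.sum_pos (fun _ hi => psiP_pos (lamTilde_pos c x hβ0 hβ1 (Finset.mem_Icc.1 hi).1).ne')
    ⟨1, Finset.mem_Icc.2 ⟨le_rfl, by omega⟩⟩

/-- A consequence of the cap `c₅` alone. It gives the one bound on `Atilde` that survives when `s =
0`. -/
theorem sumPsiP_le_mul_sumLamTilde (t : ℕ) :
    sumPsiP c β x t ≤ Real.exp c.c₅ * c.c₅ * sumLamTilde c β x t := by
  unfold sumPsiP sumLamTilde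
  rw [Finset.mul_sum]
  refine Finset.sum_le_sum fun i hi => ?_
  have h0 := (lamTilde_pos c x hβ0 hβ1 (Finset.mem_Icc.1 hi).1).le
  have h5 : lamTilde c β x i ≤ c.c₅ := min_le_right _ _
  calc psiP (lamTilde c β x i) ≤ Real.exp c.c₅ * lamTilde c β x i ^ 2 := psiP_le h0 h5
    _ = Real.exp c.c₅ * lamTilde c β x i * lamTilde c β x i := by ring
    _ ≤ Real.exp c.c₅ * c.c₅ * lamTilde c β x i := by gcongr

/-- Up to constants `ψ_P(λ_k) ≤ λ_k² ≤ log(2/β) / (σ̂_k² k)`, and the almost antitone `σ̂²` cancels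
`σ̂_k²` against `σ̂_t²`. The harmonic sum that remains is dominated by `t ^ (1/16)`. -/
theorem sigmaHatSq_mul_sumPsiP_le {C : ℝ} (hC0 : 0 ≤ C)
    (hC : ∀ k i : ℕ, 1 ≤ k → k ≤ i → sigmaHatSq c x i ≤ C * sigmaHatSq c x k) (t : ℕ) :
    sigmaHatSq c x t * sumPsiP c β x t ≤
      64 * Real.exp c.c₅ * C * Real.log (2 / β) * (t : ℝ) ^ (1 / 16 : ℝ) := by
  have hK := one_le_two_mul_log hβ0 hβ1
  unfold sumPsiP
  rw [Finset.mul_sum]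
  have hterm : ∀ k ∈ Finset.Icc 1 (t - 1), sigmaHatSq c x t * psiP (lamTilde c β x k) ≤
      4 * Real.exp c.c₅ * C * Real.log (2 / β) * (k : ℝ) ^ ((1 / 16 : ℝ) - 1) := by
    intro k hk
    obtain ⟨hk1, hk2⟩ := Finset.mem_Icc.1 hk
    have hk' : (0 : ℝ) < k := by exact_mod_cast hk1
    have h0 := (lamTilde_pos c x hβ0 hβ1 hk1).le
    have h3 := sigmaHatSq_pos c x hk1
    have h4 : (k : ℝ)⁻¹ ≤ (k : ℝ) ^ ((1 / 16 : ℝ) - 1) := by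
      rw [← Real.rpow_neg_one]
      exact rpow_le_rpow_of_one_le_cast hk1 (by norm_num)
    calc sigmaHatSq c x t * psiP (lamTilde c β x k)
        ≤ (C * sigmaHatSq c x k) * (Real.exp c.c₅ * lamTilde c β x k ^ 2) :=
          mul_le_mul (hC k t hk1 (by omega)) (psiP_le h0 (min_le_right _ _)) (psiP_nonneg _)
            (by positivity)
      _ ≤ (C * sigmaHatSq c x k) * (Real.exp c.c₅ *
            (2 * Real.log (2 / β) * (2 / (sigmaHatSq c x k * k)))) := by
          gcongr
          exact lamTilde_sq_le c x hβ0 hβ1 hk1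
      _ = 4 * Real.exp c.c₅ * C * Real.log (2 / β) * (k : ℝ)⁻¹ := by
          field_simp
          ring
      _ ≤ _ := mul_le_mul_of_nonneg_left h4
          (mul_nonneg (by positivity) (by linarith))
  refine (Finset.sum_le_sum hterm).trans ?_
  rw [← Finset.mul_sum]
  have h1 := sum_rpow_sub_one_le (q := 1 / 16) (by norm_num) (by norm_num) (t - 1)
  have h2 : ((t - 1 : ℕ) : ℝ) ^ (1 / 16 : ℝ) ≤ (t : ℝ) ^ (1 / 16 : ℝ) := by
    gcongr
    exact_mod_cast Nat.sub_le t 1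
  calc _ ≤ 4 * Real.exp c.c₅ * C * Real.log (2 / β) * (16 * (t : ℝ) ^ (1 / 16 : ℝ)) := by
        refine mul_le_mul_of_nonneg_left ?_ (mul_nonneg (by positivity) (by linarith))
        linarith
    _ = _ := by ring

/-- Earlier mean plug-ins exceed a later one at most by a factor of order `√(t / i)`, up to a
logarithm. -/
theorem lamTilde_le_mul {C : ℝ} (hC1 : 1 ≤ C)
    (hC : ∀ k i : ℕ, 1 ≤ k → k ≤ i → sigmaHatSq c x i ≤ C * sigmaHatSq c x k) {i t : ℕ}
    (hi : 1 ≤ i) (hit : i ≤ t) :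
    lamTilde c β x i ≤
      32 * C * (t : ℝ) ^ (9 / 16 : ℝ) * (i : ℝ) ^ (-(1 / 2) : ℝ) * lamTilde c β x t := by
  have hK := one_le_two_mul_log hβ0 hβ1
  have ht : 1 ≤ t := hi.trans hit
  have hi' : (0 : ℝ) < i := by exact_mod_cast hi
  have ht' : (0 : ℝ) < t := by exact_mod_cast ht
  have hit' : (i : ℝ) ≤ t := by exact_mod_cast hit
  have hc5 := c.c₅_pos
  set B : ℝ := 32 * C * (t : ℝ) ^ (9 / 16 : ℝ) * (i : ℝ) ^ (-(1 / 2) : ℝ) with hB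
  have hDi := lamTildeDenom_pos c x hi
  have hDt := lamTildeDenom_pos c x ht
  have hσ := sigmaHatSq_pos c x hi
  have hB0 : 0 < B := by positivity
  -- Needed for the cap: with `1 ≤ B` the comparison of the square roots passes to their minima with
  -- `c₅`.
  have hB1 : 1 ≤ B := by
    have h1 : 1 ≤ (t : ℝ) ^ (9 / 16 : ℝ) * (i : ℝ) ^ (-(1 / 2) : ℝ) := by
      calc (1 : ℝ) = (i : ℝ) ^ (1 / 2 : ℝ) * (i : ℝ) ^ (-(1 / 2) : ℝ) := by
            rw [← Real.rpow_add hi']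
            norm_num
        _ ≤ (t : ℝ) ^ (1 / 2 : ℝ) * (i : ℝ) ^ (-(1 / 2) : ℝ) := by gcongr
        _ ≤ _ := by
            gcongr ?_ * _
            exact rpow_le_rpow_of_one_le_cast ht (by norm_num)
    rw [hB, mul_assoc]
    nlinarith
  have hBsq : lamTildeDenom c x t ≤ B ^ 2 * lamTildeDenom c x i := by
    have e : B ^ 2 = 1024 * C ^ 2 * (t : ℝ) ^ (9 / 8 : ℝ) * (i : ℝ)⁻¹ := by
      have e1 : ((t : ℝ) ^ (9 / 16 : ℝ)) ^ 2 = (t : ℝ) ^ (9 / 8 : ℝ) := by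
        rw [← Real.rpow_natCast, ← Real.rpow_mul ht'.le]
        norm_num
      have e2 : ((i : ℝ) ^ (-(1 / 2) : ℝ)) ^ 2 = (i : ℝ)⁻¹ := by
        rw [← Real.rpow_natCast, ← Real.rpow_mul hi'.le, ← Real.rpow_neg_one]
        norm_num
      rw [hB, mul_pow, mul_pow, mul_pow, e1, e2]
      norm_num
    calc lamTildeDenom c x t ≤ 16 * sigmaHatSq c x t * (t : ℝ) ^ (9 / 8 : ℝ) :=
          lamTildeDenom_upper c x ht
      _ ≤ 16 * (C * sigmaHatSq c x i) * (t : ℝ) ^ (9 / 8 : ℝ) := by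
          gcongr
          exact hC i t hi hit
      _ ≤ 512 * C ^ 2 * sigmaHatSq c x i * (t : ℝ) ^ (9 / 8 : ℝ) := by
          gcongr ?_ * _
          have : C ≤ C ^ 2 := by nlinarith
          nlinarith
      _ = B ^ 2 * (sigmaHatSq c x i * i / 2) := by
          rw [e]
          field_simp
          norm_num
      _ ≤ _ := by
          gcongr
          exact lamTildeDenom_lower c x hi
  have hsqrt : √(2 * Real.log (2 / β) / lamTildeDenom c x i) ≤
      B * √(2 * Real.log (2 / β) / lamTildeDenom c x t) := by
    rw [← Real.sqrt_sq hB0.le, ← Real.sqrt_mul (sq_nonneg B)]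
    refine Real.sqrt_le_sqrt ?_
    rw [← mul_div_assoc, div_le_div_iff₀ hDi hDt]
    have := mul_le_mul_of_nonneg_left hBsq (by linarith : 0 ≤ 2 * Real.log (2 / β))
    linarith
  change min (√(2 * Real.log (2 / β) / lamTildeDenom c x i)) c.c₅ ≤
    B * min (√(2 * Real.log (2 / β) / lamTildeDenom c x t)) c.c₅
  rw [mul_min_of_nonneg _ _ hB0.le]
  exact min_le_min hsqrt (by nlinarith)

end LamTilde

end Path

/-! ### The weighted mean, the residuals, and the coefficients of the lower bound. -/

section Path

variable {H : Type*} [NormedAddCommGroup H] [InnerProductSpace ℝ H]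

/-- Summation by parts turns the rate of the unweighted sums into one for the weighted sums.
Bounding earlier plug-ins by the last one, at cost `m ^ (9/16) i ^ (-1/2)`, leaves `m ^ (9/16) ∑ i ^
(-15/16)`, of order `m ^ (5/8)`, times `λ_m`, while the denominator is at least `m λ_m`. Only ratios
of plug-ins matter, so the constant is free of `β`. -/
theorem RegularPath.exists_norm_weightedMean_sub_le {x : ℕ → H} {μ : H} {s v : ℝ}
    (hx : RegularPath x μ s v) (c : Tuning H) :
    ∃ C : ℝ, 0 ≤ C ∧ ∀ β : ℝ, 0 < β → β ≤ 1 → ∀ i : ℕ, 1 ≤ i →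
      ‖weightedMean c β x i - μ‖ ≤ C * (i : ℝ) ^ (-(3 / 8) : ℝ) := by
  obtain ⟨C, hC⟩ := hx.sum_mean
  have hC0 : 0 ≤ C := by simpa using (norm_nonneg _).trans (hC 1)
  obtain ⟨G, hG1, hG⟩ := hx.exists_sigmaHatSq_le_mul c
  have hG0 : 0 ≤ G := by linarith
  refine ⟨1024 * C * G + 1, by positivity, fun β hβ0 hβ1 t ht => ?_⟩
  rcases ht.eq_or_lt with rfl | ht2
  · have e : weightedMean c β x 1 = 0 := if_pos le_rfl
    rw [e, zero_sub, norm_neg]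
    simp only [Nat.cast_one, Real.one_rpow, mul_one]
    have : 0 ≤ 1024 * C * G := by positivity
    linarith [hx.norm_mean_le]
  have ht2' : 2 ≤ t := ht2
  set m := t - 1 with hm
  have hm1 : 1 ≤ m := by omega
  have hm' : (0 : ℝ) < m := by exact_mod_cast hm1
  have ht' : (0 : ℝ) < t := by positivity
  have hS := sumLamTilde_pos c x hβ0 hβ1 ht2'
  have hlm := lamTilde_pos c x hβ0 hβ1 hm1
  have e : weightedMean c β x t - μ = (sumLamTilde c β x t)⁻¹ •
      ∑ i ∈ Finset.Icc 1 m, lamTilde c β x i • (x i - μ) := by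
    have h1 : weightedMean c β x t = (sumLamTilde c β x t)⁻¹ •
      ∑ i ∈ Finset.Icc 1 m, lamTilde c β x i • x i := if_neg (by omega)
    simp only [smul_sub, Finset.sum_sub_distrib]
    rw [h1, ← Finset.sum_smul]
    change _ = _ - (sumLamTilde c β x t)⁻¹ • sumLamTilde c β x t • μ
    rw [smul_smul, inv_mul_cancel₀ hS.ne', one_smul]
  -- The bound `n ^ (9/16)` is `n` copies of `n ^ (-7/16)`, each at most `i ^ (-7/16)`: the
  -- partial-sum form that summation by parts takes.
  have hw : ∀ n : ℕ, ‖∑ i ∈ Finset.Icc 1 n, (x i - μ)‖ ≤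
      ∑ i ∈ Finset.Icc 1 n, C * (i : ℝ) ^ (-(7 / 16) : ℝ) := by
    intro n
    rcases Nat.eq_zero_or_pos n with rfl | hn
    · simp
    have hn' : (0 : ℝ) < n := by exact_mod_cast hn
    calc _ ≤ C * (n : ℝ) ^ (9 / 16 : ℝ) := hC n
      _ = ∑ i ∈ Finset.Icc 1 n, C * (n : ℝ) ^ (-(7 / 16) : ℝ) := by
          have : (n : ℝ) ^ (9 / 16 : ℝ) = (n : ℝ) ^ (-(7 / 16) : ℝ) * n := by
            rw [← Real.rpow_add_one hn'.ne']
            norm_num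
          rw [this]
          simp
          ring
      _ ≤ _ := by
          refine Finset.sum_le_sum fun i hi => ?_
          obtain ⟨hi1, hi2⟩ := Finset.mem_Icc.1 hi
          have hi' : (0 : ℝ) < i := by exact_mod_cast hi1
          have hin : (i : ℝ) ≤ n := by exact_mod_cast hi2
          gcongr C * ?_
          exact Real.rpow_le_rpow_of_nonpos hi' hin (by norm_num)
  have habel := norm_sum_smul_le (lamTilde c β x) (fun i => C * (i : ℝ) ^ (-(7 / 16) : ℝ))
    (fun i => x i - μ) (fun i hi => lamTilde_anti c x hβ0 hβ1 hi (Nat.le_succ i))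
    (fun i hi => (lamTilde_pos c x hβ0 hβ1 hi).le) hw m
  have hsum : ∑ i ∈ Finset.Icc 1 m, lamTilde c β x i * (C * (i : ℝ) ^ (-(7 / 16) : ℝ)) ≤
      512 * C * G * (m : ℝ) ^ (5 / 8 : ℝ) * lamTilde c β x m := by
    calc ∑ i ∈ Finset.Icc 1 m, lamTilde c β x i * (C * (i : ℝ) ^ (-(7 / 16) : ℝ))
        ≤ ∑ i ∈ Finset.Icc 1 m, 32 * C * G * (m : ℝ) ^ (9 / 16 : ℝ) * lamTilde c β x m *
            (i : ℝ) ^ ((1 / 16 : ℝ) - 1) := by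
          refine Finset.sum_le_sum fun i hi => ?_
          obtain ⟨hi1, hi2⟩ := Finset.mem_Icc.1 hi
          have hi' : (0 : ℝ) < i := by exact_mod_cast hi1
          have e1 : (i : ℝ) ^ ((1 / 16 : ℝ) - 1) =
              (i : ℝ) ^ (-(1 / 2) : ℝ) * (i : ℝ) ^ (-(7 / 16) : ℝ) := by
            rw [← Real.rpow_add hi']
            norm_num
          have h1 := lamTilde_le_mul c x hβ0 hβ1 hG1 hG hi1 hi2
          calc _ ≤ (32 * G * (m : ℝ) ^ (9 / 16 : ℝ) * (i : ℝ) ^ (-(1 / 2) : ℝ) *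
                lamTilde c β x m) * (C * (i : ℝ) ^ (-(7 / 16) : ℝ)) := by gcongr
            _ = _ := by rw [e1]; ring
      _ = 32 * C * G * (m : ℝ) ^ (9 / 16 : ℝ) * lamTilde c β x m *
            ∑ i ∈ Finset.Icc 1 m, (i : ℝ) ^ ((1 / 16 : ℝ) - 1) := by rw [Finset.mul_sum]
      _ ≤ 32 * C * G * (m : ℝ) ^ (9 / 16 : ℝ) * lamTilde c β x m *
            ((m : ℝ) ^ (1 / 16 : ℝ) / (1 / 16)) := by
          gcongr
          exact sum_rpow_sub_one_le (by norm_num) (by norm_num) m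
      _ = _ := by
          have e1 : (m : ℝ) ^ (5 / 8 : ℝ) = (m : ℝ) ^ (9 / 16 : ℝ) * (m : ℝ) ^ (1 / 16 : ℝ) := by
            rw [← Real.rpow_add hm']
            norm_num
          rw [e1]
          ring
  have hms : (m : ℝ) * lamTilde c β x m ≤ sumLamTilde c β x t :=
    mul_lamTilde_le_sumLamTilde c x hβ0 hβ1 t
  have hmt : (m : ℝ) ^ (-(3 / 8) : ℝ) ≤ 2 * (t : ℝ) ^ (-(3 / 8) : ℝ) := by
    have h1 : (t : ℝ) ≤ 2 * m := by exact_mod_cast (by omega : t ≤ 2 * m)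
    have h2 : (2 : ℝ) ^ (-1 : ℝ) ≤ (2 : ℝ) ^ (-(3 / 8) : ℝ) :=
      Real.rpow_le_rpow_of_exponent_le (by norm_num) (by norm_num)
    have h3 : (2 * m : ℝ) ^ (-(3 / 8) : ℝ) ≤ (t : ℝ) ^ (-(3 / 8) : ℝ) :=
      Real.rpow_le_rpow_of_nonpos ht' h1 (by norm_num)
    rw [Real.mul_rpow (by norm_num) hm'.le] at h3
    rw [Real.rpow_neg_one] at h2
    have h4 : 0 < (m : ℝ) ^ (-(3 / 8) : ℝ) := by positivity
    nlinarith
  rw [e, norm_smul, norm_inv, Real.norm_of_nonneg hS.le, inv_mul_le_iff₀ hS]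
  calc _ ≤ 512 * C * G * (m : ℝ) ^ (5 / 8 : ℝ) * lamTilde c β x m := habel.trans hsum
    _ = (m * lamTilde c β x m) * (512 * C * G * (m : ℝ) ^ (-(3 / 8) : ℝ)) := by
        have : (m : ℝ) ^ (5 / 8 : ℝ) = (m : ℝ) ^ (-(3 / 8) : ℝ) * m := by
          rw [← Real.rpow_add_one hm'.ne']
          norm_num
        rw [this]
        ring
    _ ≤ sumLamTilde c β x t * (512 * C * G * (2 * (t : ℝ) ^ (-(3 / 8) : ℝ))) := by gcongr
    _ ≤ _ := by
        refine mul_le_mul_of_nonneg_left ?_ hS.le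
        have : 0 ≤ (t : ℝ) ^ (-(3 / 8) : ℝ) := by positivity
        linarith

theorem RegularPath.exists_norm_muHat_sub_le {x : ℕ → H} {μ : H} {s v : ℝ}
    (hx : RegularPath x μ s v) (c : Tuning H) (rule : MeanRule) :
    ∃ C : ℝ, 0 ≤ C ∧ ∀ β : ℝ, 0 < β → β ≤ 1 → ∀ i : ℕ, 1 ≤ i →
      ‖muHat c rule β x i - μ‖ ≤ C * (i : ℝ) ^ (-(3 / 8) : ℝ) := by
  cases rule with
  | running =>
    obtain ⟨C, hC0, hC⟩ := hx.exists_norm_runningMean_sub_le c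
    exact ⟨C, hC0, fun _ _ _ => hC⟩
  | weighted => exact hx.exists_norm_weightedMean_sub_le c

/-- The residual `‖x_i - m_i‖² - σ̂_i²` whose squares are averaged in the fourth moment
estimator. -/
def residual (c : Tuning H) (mu x : ℕ → H) (i : ℕ) : ℝ := ‖x i - mu i‖ ^ 2 - sigmaHatSq c x i

/-- Asymptotic control of the residuals and of the fourth moment estimator, by a constant `C`. -/
structure ResidualBounds (c : Tuning H) (x mu : ℕ → H) (s v C : ℝ) : Prop where
  norm_sq_le : ∀ i : ℕ, 1 ≤ i → ‖x i - mu i‖ ^ 2 ≤ C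
  residual_sq_le : ∀ i : ℕ, 1 ≤ i → residual c mu x i ^ 2 ≤ C
  residual_sq_le_rpow : v = 0 → ∀ i : ℕ, 1 ≤ i →
    residual c mu x i ^ 2 ≤ C * (i : ℝ) ^ (-(3 / 4) : ℝ)
  average_le : ∀ i : ℕ, 1 ≤ i →
    |(∑ k ∈ Finset.Icc 1 (i - 1), residual c mu x k ^ 2) / i - v| ≤ C * (i : ℝ) ^ (-(3 / 8) : ℝ)
  m4_le : ∀ i : ℕ, 1 ≤ i → |m4HatSq c mu x i - v| ≤ C * (i : ℝ) ^ (-(3 / 8) : ℝ)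
  m4_le_rpow : v = 0 → ∀ i : ℕ, 1 ≤ i → m4HatSq c mu x i ≤ C * (i : ℝ) ^ (-(3 / 4) : ℝ)

theorem m4HatSq_lower (c : Tuning H) (mu x : ℕ → H) (i : ℕ) : c.c₂ / i ≤ m4HatSq c mu x i := by
  unfold m4HatSq
  gcongr
  exact le_add_of_nonneg_right (by positivity)

theorem m4HatSq_pos (c : Tuning H) (mu x : ℕ → H) {i : ℕ} (hi : 1 ≤ i) : 0 < m4HatSq c mu x i := by
  have hi' : (0 : ℝ) < i := by exact_mod_cast hi
  have := c.c₂_pos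
  exact lt_of_lt_of_le (by positivity) (m4HatSq_lower c mu x i)

/-- Squared residuals differ from `(‖x_i - μ‖² - s)²` by `O(i ^ (-3/8))`, and averaging keeps that
rate. The constant is chosen before `mu`, so it serves the mean estimators of all sample sizes at
once. -/
theorem RegularPath.exists_residualBounds {x : ℕ → H} {μ : H} {s v : ℝ}
    (hx : RegularPath x μ s v) (c : Tuning H) {D : ℝ} (hD0 : 0 ≤ D) :
    ∃ C : ℝ, 0 < C ∧ ∀ mu : ℕ → H,
      (∀ i : ℕ, 1 ≤ i → ‖mu i - μ‖ ≤ D * (i : ℝ) ^ (-(3 / 8) : ℝ)) →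
      ResidualBounds c x mu s v C := by
  obtain ⟨S, hS0, hS⟩ := hx.exists_abs_sigmaHatSq_sub_le c
  obtain ⟨Q, hQ⟩ := hx.sum_varSq
  have hQ0 : 0 ≤ Q := by simpa using (abs_nonneg _).trans (hQ 1)
  have hs1 : s ≤ 1 + S := by
    have h1 := (abs_le.1 (hS 1 le_rfl)).1
    have h2 := sigmaHatSq_le_one c hx.norm_le le_rfl
    simp only [Nat.cast_one, Real.one_rpow, mul_one] at h1
    linarith
  have hs0 := hx.var_nonneg
  have hv0 := hx.varSq_nonneg
  have hc2 := c.c₂_pos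
  set Z : ℝ := (2 + D) * D + S with hZ
  have hZ0 : 0 ≤ Z := by positivity
  set Y : ℝ := 2 + S with hY
  set T : ℝ := Z * (2 * Y + Z) with hT
  have hT0 : 0 ≤ T := by positivity
  have hone : ∀ i : ℕ, 1 ≤ i → (i : ℝ) ^ (-(3 / 8) : ℝ) ≤ 1 := fun i hi =>
    rpow_le_one_of_one_le_cast hi (by norm_num)
  -- One group of summands for each of the six bounds; `1 + (2 + D) * D` serves the norms.
  refine ⟨1 + (2 + D) * D + (Y + Z) ^ 2 + Z ^ 2 + (|c.c₂ - v| + 8 / 5 * T + Q) +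
    (v + 8 / 5 * T + Q) + (c.c₂ + 4 * Z ^ 2), by positivity, fun mu hmu => ?_⟩
  have hpos1 : 0 ≤ (2 + D) * D := by positivity
  have hpos2 : 0 ≤ (Y + Z) ^ 2 := by positivity
  have hpos3 : 0 ≤ Z ^ 2 := by positivity
  have hpos4 : 0 ≤ |c.c₂ - v| + 8 / 5 * T + Q := by positivity
  have hpos5 : 0 ≤ v + 8 / 5 * T + Q := by positivity
  have hdist : ∀ i : ℕ, 1 ≤ i → |‖x i - mu i‖ ^ 2 - ‖x i - μ‖ ^ 2| ≤
      (2 + D) * (D * (i : ℝ) ^ (-(3 / 8) : ℝ)) := fun i hi =>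
    hx.abs_norm_sq_sub_le hi ((hmu i hi).trans (mul_le_of_le_one_right hD0 (hone i hi))) (hmu i hi)
  have hY1 : ∀ i, 1 ≤ i → ‖x i - μ‖ ^ 2 ≤ 1 := fun i hi =>
    pow_le_one₀ (norm_nonneg _) (hx.norm_sub_le hi)
  have hdev : ∀ i, 1 ≤ i → |‖x i - μ‖ ^ 2 - s| ≤ Y := fun i hi => by
    rw [abs_le]
    constructor <;> nlinarith [hY1 i hi, sq_nonneg ‖x i - μ‖]
  have hres : ∀ i : ℕ, 1 ≤ i → |residual c mu x i - (‖x i - μ‖ ^ 2 - s)| ≤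
      Z * (i : ℝ) ^ (-(3 / 8) : ℝ) := fun i hi => by
    have e : residual c mu x i - (‖x i - μ‖ ^ 2 - s) =
        (‖x i - mu i‖ ^ 2 - ‖x i - μ‖ ^ 2) - (sigmaHatSq c x i - s) := by
      unfold residual
      ring
    rw [e]
    refine (abs_sub _ _).trans ?_
    rw [hZ, add_mul]
    linarith [hdist i hi, hS i hi]
  have hres1 : ∀ i : ℕ, 1 ≤ i → |residual c mu x i| ≤ Y + Z := fun i hi => by
    have h1 := (hres i hi).trans (mul_le_of_le_one_right hZ0 (hone i hi))
    have h2 := hdev i hi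
    rw [abs_le] at h1 h2 ⊢
    constructor <;> linarith [h1.1, h1.2, h2.1, h2.2]
  have hsq : ∀ i : ℕ, 1 ≤ i → |residual c mu x i ^ 2 - (‖x i - μ‖ ^ 2 - s) ^ 2| ≤
      T * (i : ℝ) ^ (-(3 / 8) : ℝ) := fun i hi => by
    have e : residual c mu x i ^ 2 - (‖x i - μ‖ ^ 2 - s) ^ 2 =
        (residual c mu x i - (‖x i - μ‖ ^ 2 - s)) *
          (residual c mu x i + (‖x i - μ‖ ^ 2 - s)) := by ring
    rw [e, abs_mul]
    calc _ ≤ (Z * (i : ℝ) ^ (-(3 / 8) : ℝ)) * (2 * Y + Z) := by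
          refine mul_le_mul (hres i hi) ?_ (abs_nonneg _) (by positivity)
          exact (abs_add_le _ _).trans (by linarith [hres1 i hi, hdev i hi])
      _ = _ := by rw [hT]; ring
  -- When `v = 0` the residual consists of estimation error only, so its square has twice the
  -- exponent.
  have hzero : v = 0 → ∀ i : ℕ, 1 ≤ i →
      residual c mu x i ^ 2 ≤ Z ^ 2 * (i : ℝ) ^ (-(3 / 4) : ℝ) := fun hv i hi => by
    have h1 := hres i hi
    rw [hx.norm_sq_eq hv i hi, sub_self, sub_zero] at h1
    have e1 : (i : ℝ) ^ (-(3 / 4) : ℝ) = ((i : ℝ) ^ (-(3 / 8) : ℝ)) ^ 2 := by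
      rw [← Real.rpow_natCast, ← Real.rpow_mul (by positivity)]
      norm_num
    rw [← sq_abs, e1, ← mul_pow]
    exact pow_le_pow_left₀ (abs_nonneg _) h1 2
  have hlift : ∀ {A B : ℝ} (i : ℕ) (p : ℝ), A ≤ B → A * (i : ℝ) ^ p ≤ B * (i : ℝ) ^ p :=
    fun i p h => by gcongr
  refine ⟨fun i hi => ?_, fun i hi => ?_, fun hv i hi => ?_, fun i hi => ?_, fun i hi => ?_,
    fun hv i hi => ?_⟩
  · have h1 := (abs_le.1 (hdist i hi)).2
    have h2 : (2 + D) * (D * (i : ℝ) ^ (-(3 / 8) : ℝ)) ≤ (2 + D) * D := by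
      gcongr
      exact mul_le_of_le_one_right hD0 (hone i hi)
    linarith [hY1 i hi]
  · have h1 : residual c mu x i ^ 2 ≤ (Y + Z) ^ 2 := by
      rw [← sq_abs]
      exact pow_le_pow_left₀ (abs_nonneg _) (hres1 i hi) 2
    linarith
  · exact (hzero hv i hi).trans (hlift i _ (by linarith))
  · have h1 := exists_abs_shifted_average_sub_le _ (fun k => residual c mu x k ^ 2) v 0 Q T hQ
      hsq i hi
    rw [zero_add, zero_sub, abs_neg, abs_of_nonneg hv0] at h1
    exact h1.trans (hlift i _ (by linarith))
  · exact (exists_abs_shifted_average_sub_le _ (fun k => residual c mu x k ^ 2) v c.c₂ Q T hQ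
      hsq i hi).trans (hlift i _ (by linarith))
  · refine le_trans ?_ (hlift i (-(3 / 4) : ℝ) (by linarith : c.c₂ + 4 * Z ^ 2 ≤ _))
    have hi' : (0 : ℝ) < i := by exact_mod_cast hi
    have e1 : (c.c₂ + 4 * Z ^ 2) * (i : ℝ) ^ (-(3 / 4) : ℝ) * i =
        (c.c₂ + 4 * Z ^ 2) * (i : ℝ) ^ (1 / 4 : ℝ) := by
      rw [mul_assoc, ← Real.rpow_add_one hi'.ne']
      norm_num
    change (c.c₂ + ∑ k ∈ Finset.Icc 1 (i - 1), residual c mu x k ^ 2) / i ≤ _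
    rw [div_le_iff₀ hi', e1]
    have h1 : ∑ k ∈ Finset.Icc 1 (i - 1), residual c mu x k ^ 2 ≤
        4 * Z ^ 2 * (i : ℝ) ^ (1 / 4 : ℝ) :=
      calc _ ≤ ∑ k ∈ Finset.Icc 1 (i - 1), Z ^ 2 * (k : ℝ) ^ ((1 / 4 : ℝ) - 1) := by
            refine Finset.sum_le_sum fun k hk => (hzero hv k (Finset.mem_Icc.1 hk).1).trans ?_
            norm_num
        _ ≤ Z ^ 2 * (((i - 1 : ℕ) : ℝ) ^ (1 / 4 : ℝ) / (1 / 4)) := by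
            rw [← Finset.mul_sum]
            gcongr
            exact sum_rpow_sub_one_le (by norm_num) (by norm_num) _
        _ ≤ Z ^ 2 * ((i : ℝ) ^ (1 / 4 : ℝ) / (1 / 4)) := by
            gcongr
            exact_mod_cast Nat.sub_le i 1
        _ = _ := by ring
    have h2 : c.c₂ ≤ c.c₂ * (i : ℝ) ^ (1 / 4 : ℝ) :=
      le_mul_of_one_le_right hc2.le (one_le_rpow_of_one_le_cast hi (by norm_num))
    linarith

/-- Bounds for the coefficients of the squared radius of the mean confidence sequence, uniform over
levels whose logarithms are at most `l`. -/
theorem RegularPath.exists_tilde_bounds {x : ℕ → H} {μ : H} {s v : ℝ}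
    (hx : RegularPath x μ s v) (c : Tuning H) :
    ∃ C : ℝ, 0 < C ∧ ∀ β δ l : ℝ, 0 < β → β ≤ 1 → 0 < δ → δ ≤ 1 → Real.log (2 / β) ≤ l →
      Real.log (2 / δ) ≤ l → ∀ t : ℕ, 1 ≤ t →
      (0 ≤ Atilde c β x t ∧ Atilde c β x t ≤ C ∧
        (0 < s → Atilde c β x t ≤ C * l ^ 2 * (t : ℝ) ^ (-(3 / 4) : ℝ))) ∧
      (0 ≤ Btilde c β x δ t ∧
        (0 < s → Btilde c β x δ t ≤ C * l ^ 2 * (t : ℝ) ^ (-(3 / 4) : ℝ))) ∧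
      (0 ≤ Ctilde c β x δ t ∧ Ctilde c β x δ t ≤ C * l ^ 2 * (t : ℝ) ^ (-(3 / 4) : ℝ)) ∧
      (2 ≤ t → C * l ≤ (t : ℝ) ^ (3 / 8 : ℝ) →
        (Real.log (2 / δ) + sigmaHatSq c x t * sumPsiP c β x t) / sumLamTilde c β x t ≤ 1) := by
  obtain ⟨G, hG1, hG⟩ := hx.exists_sigmaHatSq_le_mul c
  have hc5 := c.c₅_pos
  set κ : ℝ := min (1 / 4) c.c₅ / 2 with hκ
  have hκ0 : 0 < κ := by positivity
  -- For `s = 0` the value of `m` is a dummy: the bounds that involve it are claimed only for `s >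
  -- 0`.
  obtain ⟨m, hm0, hm⟩ : ∃ m : ℝ, 0 < m ∧ (0 < s → ∀ k : ℕ, 1 ≤ k → m ≤ sigmaHatSq c x k) := by
    by_cases hs : 0 < s
    · obtain ⟨m, hm0, hm⟩ := hx.exists_sigmaHatSq_lower c hs
      exact ⟨m, hm0, fun _ => hm⟩
    · exact ⟨1, one_pos, fun h => absurd h hs⟩
  set U : ℝ := 64 * Real.exp c.c₅ * G with hU
  have hU0 : 0 < U := by positivity
  set V : ℝ := U / m with hV
  have hV0 : 0 < V := by positivity
  refine ⟨(Real.exp c.c₅ * c.c₅) ^ 2 + V ^ 2 / κ ^ 2 + 2 * V / κ ^ 2 + 1 + 1 / κ ^ 2 + (1 + U) / κ,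
    by positivity, fun β δ l hβ0 hβ1 hδ0 hδ1 hβl hδl t ht => ?_⟩
  have k1 : 0 ≤ (Real.exp c.c₅ * c.c₅) ^ 2 := by positivity
  have k2 : 0 ≤ V ^ 2 / κ ^ 2 := by positivity
  have k3 : 0 ≤ 2 * V / κ ^ 2 := by positivity
  have k4 : 0 ≤ 1 / κ ^ 2 := by positivity
  have k5 : 0 ≤ (1 + U) / κ := by positivity
  set C : ℝ := (Real.exp c.c₅ * c.c₅) ^ 2 + V ^ 2 / κ ^ 2 + 2 * V / κ ^ 2 + 1 + 1 / κ ^ 2 +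
    (1 + U) / κ with hC
  have hC0 : 0 < C := by positivity
  have hlβ := one_le_two_mul_log hβ0 hβ1
  have hlδ := one_le_two_mul_log hδ0 hδ1
  have hl : 1 / 2 ≤ l := by linarith
  have hlδ0 : 0 ≤ Real.log (2 / δ) := by linarith
  have ht' : (0 : ℝ) < t := by exact_mod_cast ht
  rcases ht.eq_or_lt with rfl | ht2
  -- At `t = 1` only `Ctilde = 1/4` is nonzero, and it is at most `C l²` because `C ≥ 1` and `l ≥
  -- 1/2`.
  · simp only [Atilde, Btilde, Ctilde, le_refl, if_true, Nat.cast_one, Real.one_rpow, mul_one]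
    refine ⟨⟨trivial, by positivity, fun _ => by positivity⟩, ⟨trivial, fun _ => by positivity⟩,
      ⟨by norm_num, ?_⟩, fun h => by omega⟩
    have : 1 ≤ C := by linarith
    nlinarith
  have ht2' : 2 ≤ t := ht2
  have hnot : ¬ t ≤ 1 := by omega
  have hS := sumLamTilde_pos c x hβ0 hβ1 ht2'
  have hSl : κ * (t : ℝ) ^ (7 / 16 : ℝ) ≤ sumLamTilde c β x t :=
    sumLamTilde_lower c x hβ0 hβ1 hx.norm_le ht2'
  have hSsq : κ ^ 2 * (t : ℝ) ^ (7 / 8 : ℝ) ≤ sumLamTilde c β x t ^ 2 := by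
    have e : (t : ℝ) ^ (7 / 8 : ℝ) = ((t : ℝ) ^ (7 / 16 : ℝ)) ^ 2 := by
      rw [← Real.rpow_natCast, ← Real.rpow_mul ht'.le]
      norm_num
    rw [e, ← mul_pow]
    exact pow_le_pow_left₀ (by positivity) hSl 2
  have hP := sumPsiP_pos c x hβ0 hβ1 ht2'
  have hPS := sumPsiP_le_mul_sumLamTilde c x hβ0 hβ1 t
  have hσP : sigmaHatSq c x t * sumPsiP c β x t ≤ U * l * (t : ℝ) ^ (1 / 16 : ℝ) := by
    refine (sigmaHatSq_mul_sumPsiP_le c x hβ0 hβ1 (by linarith) hG t).trans ?_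
    gcongr
  have hPs : 0 < s → sumPsiP c β x t ≤ V * l * (t : ℝ) ^ (1 / 16 : ℝ) := fun hs => by
    have h1 : m * sumPsiP c β x t ≤ U * l * (t : ℝ) ^ (1 / 16 : ℝ) :=
      le_trans (by gcongr; exact hm hs t ht) hσP
    rw [← le_div_iff₀' hm0] at h1
    refine h1.trans_eq ?_
    rw [hV]
    ring
  have hlift : ∀ {A : ℝ}, A ≤ C → A * l ^ 2 * (t : ℝ) ^ (-(3 / 4) : ℝ) ≤
      C * l ^ 2 * (t : ℝ) ^ (-(3 / 4) : ℝ) := fun h => by gcongr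
  have hquot : ∀ {p : ℝ}, p ≤ 1 / 8 → (t : ℝ) ^ p / (t : ℝ) ^ (7 / 8 : ℝ) ≤
      (t : ℝ) ^ (-(3 / 4) : ℝ) := fun h => by
    rw [← Real.rpow_sub ht']
    exact rpow_le_rpow_of_one_le_cast ht (by linarith)
  refine ⟨⟨?_, ?_, fun hs => ?_⟩, ⟨?_, fun hs => ?_⟩, ⟨?_, ?_⟩, fun _ hlt => ?_⟩
  · rw [Atilde, if_neg hnot]
    positivity
  · rw [Atilde, if_neg hnot, div_le_iff₀ (by positivity)]
    calc sumPsiP c β x t ^ 2 ≤ (Real.exp c.c₅ * c.c₅ * sumLamTilde c β x t) ^ 2 :=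
          pow_le_pow_left₀ hP.le hPS 2
      _ = (Real.exp c.c₅ * c.c₅) ^ 2 * sumLamTilde c β x t ^ 2 := by ring
      _ ≤ _ := by gcongr; linarith
  · rw [Atilde, if_neg hnot]
    refine le_trans ?_ (hlift (by linarith : V ^ 2 / κ ^ 2 ≤ C))
    calc sumPsiP c β x t ^ 2 / sumLamTilde c β x t ^ 2
        ≤ (V * l * (t : ℝ) ^ (1 / 16 : ℝ)) ^ 2 / (κ ^ 2 * (t : ℝ) ^ (7 / 8 : ℝ)) := by
          gcongr
          exact hPs hs
      _ = V ^ 2 / κ ^ 2 * l ^ 2 * ((t : ℝ) ^ (1 / 8 : ℝ) / (t : ℝ) ^ (7 / 8 : ℝ)) := by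
          have e : ((t : ℝ) ^ (1 / 16 : ℝ)) ^ 2 = (t : ℝ) ^ (1 / 8 : ℝ) := by
            rw [← Real.rpow_natCast, ← Real.rpow_mul ht'.le]
            norm_num
          rw [mul_pow, mul_pow, e]
          ring
      _ ≤ _ := by
          gcongr
          exact hquot le_rfl
  · rw [Btilde, if_neg hnot]
    positivity
  · rw [Btilde, if_neg hnot]
    refine le_trans ?_ (hlift (by linarith : 2 * V / κ ^ 2 ≤ C))
    calc 2 * Real.log (2 / δ) * sumPsiP c β x t / sumLamTilde c β x t ^ 2
        ≤ 2 * l * (V * l * (t : ℝ) ^ (1 / 16 : ℝ)) / (κ ^ 2 * (t : ℝ) ^ (7 / 8 : ℝ)) := by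
          gcongr
          exact hPs hs
      _ = 2 * V / κ ^ 2 * l ^ 2 * ((t : ℝ) ^ (1 / 16 : ℝ) / (t : ℝ) ^ (7 / 8 : ℝ)) := by ring
      _ ≤ _ := by
          gcongr
          exact hquot (by norm_num)
  · rw [Ctilde, if_neg hnot]
    positivity
  · rw [Ctilde, if_neg hnot]
    refine le_trans ?_ (hlift (by linarith : 1 / κ ^ 2 ≤ C))
    calc Real.log (2 / δ) ^ 2 / sumLamTilde c β x t ^ 2
        ≤ l ^ 2 / (κ ^ 2 * (t : ℝ) ^ (7 / 8 : ℝ)) := by gcongr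
      _ = 1 / κ ^ 2 * l ^ 2 * ((t : ℝ) ^ (0 : ℝ) / (t : ℝ) ^ (7 / 8 : ℝ)) := by
          rw [Real.rpow_zero]
          ring
      _ ≤ _ := by
          gcongr
          exact hquot (by norm_num)
  -- The numerator is at most `(1 + U) l t ^ (1/16)` and the denominator at least `κ t ^ (7/16)`;
  -- the gap in the exponents is the `3/8` of the hypothesis.
  · rw [div_le_one hS]
    have h1 : 1 ≤ (t : ℝ) ^ (1 / 16 : ℝ) := one_le_rpow_of_one_le_cast ht (by norm_num)
    have e : (t : ℝ) ^ (7 / 16 : ℝ) = (t : ℝ) ^ (3 / 8 : ℝ) * (t : ℝ) ^ (1 / 16 : ℝ) := by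
      rw [← Real.rpow_add ht']
      norm_num
    have h2 : (1 + U) / κ * l ≤ (t : ℝ) ^ (3 / 8 : ℝ) :=
      le_trans (by gcongr; linarith) hlt
    calc Real.log (2 / δ) + sigmaHatSq c x t * sumPsiP c β x t
        ≤ l * (t : ℝ) ^ (1 / 16 : ℝ) + U * l * (t : ℝ) ^ (1 / 16 : ℝ) := by
          refine add_le_add ?_ hσP
          nlinarith
      _ = κ * ((1 + U) / κ * l * (t : ℝ) ^ (1 / 16 : ℝ)) := by
          field_simp
      _ ≤ κ * ((t : ℝ) ^ (3 / 8 : ℝ) * (t : ℝ) ^ (1 / 16 : ℝ)) := by gcongr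
      _ ≤ _ := by rw [← e]; exact hSl

end Path

/-! ### Triangular arrays of plug-ins and the limit of the scaled radius. -/

section Arrays

theorem tendsto_natCast_rpow_neg {p : ℝ} (hp : 0 < p) :
    Tendsto (fun n : ℕ => (n : ℝ) ^ (-p)) atTop (𝓝 0) :=
  (tendsto_rpow_neg_atTop hp).comp tendsto_natCast_atTop_atTop

theorem sqrt_mul_rpow {n : ℕ} (hn : 1 ≤ n) (p : ℝ) :
    √(n : ℝ) * (n : ℝ) ^ p = (n : ℝ) ^ (1 / 2 + p) := by
  have hn' : (0 : ℝ) < n := by exact_mod_cast hn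
  rw [Real.sqrt_eq_rpow, ← Real.rpow_add hn']

/-- A weighted Cesàro lemma for triangular arrays: factors that are bounded, and uniformly close to
`A` beyond the index `√n`, can be replaced by `A`. -/
theorem tendsto_average_mul {a b : ℕ → ℕ → ℝ} {A v M K : ℝ}
    (ha : ∀ᶠ n : ℕ in atTop, ∀ i, 1 ≤ i → i ≤ n → |a n i| ≤ M)
    (hA : ∀ ε : ℝ, 0 < ε → ∀ᶠ n : ℕ in atTop, ∀ i, 1 ≤ i → i ≤ n → n ≤ i ^ 2 → |a n i - A| ≤ ε)
    (hb : ∀ᶠ n : ℕ in atTop, ∀ i, 1 ≤ i → i ≤ n → |b n i| ≤ K)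
    (hv : Tendsto (fun n : ℕ => (∑ i ∈ Finset.Icc 1 n, b n i) / n) atTop (𝓝 v)) :
    Tendsto (fun n : ℕ => (∑ i ∈ Finset.Icc 1 n, a n i * b n i) / n) atTop (𝓝 (A * v)) := by
  obtain ⟨n₀, hn₀⟩ := (ha.and (hb.and (eventually_ge_atTop 1))).exists
  have hM : 0 ≤ M := (abs_nonneg _).trans (hn₀.1 1 le_rfl hn₀.2.2)
  have hK : 0 ≤ K := (abs_nonneg _).trans (hn₀.2.1 1 le_rfl hn₀.2.2)
  have hdiff : Tendsto (fun n : ℕ => (∑ i ∈ Finset.Icc 1 n, (a n i - A) * b n i) / n) atTop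
      (𝓝 0) := by
    rw [Metric.tendsto_nhds]
    intro ε hε
    set η : ℝ := ε / (2 * (K + 1)) with hη
    have hη0 : 0 < η := by positivity
    have hsmall : Tendsto (fun n : ℕ => (M + |A|) * K * (n : ℝ) ^ (-(1 / 2) : ℝ)) atTop
        (𝓝 ((M + |A|) * K * 0)) := (tendsto_natCast_rpow_neg (by norm_num)).const_mul _
    rw [mul_zero] at hsmall
    filter_upwards [ha, hA η hη0, hb, hsmall.eventually (gt_mem_nhds (half_pos hε)),
      eventually_ge_atTop 1] with n h1 h2 h3 h4 h5
    have hn' : (0 : ℝ) < n := by exact_mod_cast h5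
    rw [dist_zero_right, Real.norm_eq_abs, abs_div, abs_of_pos hn', div_lt_iff₀ hn']
    have hterm : ∀ i ∈ Finset.Icc 1 n, |(a n i - A) * b n i| ≤
        η * K + if i ^ 2 < n then (M + |A|) * K else 0 := by
      intro i hi
      obtain ⟨hi1, hi2⟩ := Finset.mem_Icc.1 hi
      rw [abs_mul]
      split_ifs with h
      · have : |a n i - A| * |b n i| ≤ (M + |A|) * K :=
          mul_le_mul ((abs_sub _ _).trans (by linarith [h1 i hi1 hi2])) (h3 i hi1 hi2)
            (abs_nonneg _) (by positivity)
        have : 0 ≤ η * K := by positivity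
        linarith
      · rw [add_zero]
        exact mul_le_mul (h2 i hi1 hi2 (by omega)) (h3 i hi1 hi2) (abs_nonneg _) hη0.le
    -- The exceptional indices `i < √n` number at most `√n`, so after division by `n` their bounded
    -- terms are negligible.
    have hcard : (((Finset.Icc 1 n).filter fun i => i ^ 2 < n).card : ℝ) ≤ √(n : ℝ) := by
      have hsub : (Finset.Icc 1 n).filter (fun i => i ^ 2 < n) ⊆ Finset.Icc 1 n.sqrt := by
        intro i hi
        simp only [Finset.mem_filter, Finset.mem_Icc] at hi ⊢
        exact ⟨hi.1.1, Nat.le_sqrt'.2 hi.2.le⟩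
      have h6 := Finset.card_le_card hsub
      rw [Nat.card_Icc, Nat.add_sub_cancel] at h6
      calc _ ≤ (n.sqrt : ℝ) := by exact_mod_cast h6
        _ ≤ _ := Real.nat_sqrt_le_real_sqrt
    have hsqrt : √(n : ℝ) = (n : ℝ) ^ (-(1 / 2) : ℝ) * n := by
      rw [← Real.rpow_add_one hn'.ne', Real.sqrt_eq_rpow]
      norm_num
    calc |∑ i ∈ Finset.Icc 1 n, (a n i - A) * b n i|
        ≤ ∑ i ∈ Finset.Icc 1 n, |(a n i - A) * b n i| := Finset.abs_sum_le_sum_abs _ _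
      _ ≤ ∑ i ∈ Finset.Icc 1 n, (η * K + if i ^ 2 < n then (M + |A|) * K else 0) :=
          Finset.sum_le_sum hterm
      _ = n * (η * K) + ((Finset.Icc 1 n).filter fun i => i ^ 2 < n).card * ((M + |A|) * K) := by
          rw [Finset.sum_add_distrib, ← Finset.sum_filter]
          simp
      _ ≤ n * (η * K) + √(n : ℝ) * ((M + |A|) * K) := by gcongr
      _ = (η * K + (M + |A|) * K * (n : ℝ) ^ (-(1 / 2) : ℝ)) * n := by
          rw [hsqrt]
          ring
      _ < ε * n := by
          have h7 : η * K ≤ ε / 2 := by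
            rw [hη, div_mul_eq_mul_div, div_le_div_iff₀ (by positivity) (by norm_num)]
            nlinarith
          gcongr
          linarith
  have h := hdiff.add (hv.const_mul A)
  rw [zero_add] at h
  refine h.congr fun n => ?_
  simp only [sub_mul, Finset.sum_sub_distrib, ← Finset.mul_sum]
  ring

theorem wAvg_nonneg {lam f : ℕ → ℝ} {n : ℕ} (hlam : ∀ i, 1 ≤ i → i ≤ n → 0 ≤ lam i)
    (hf : ∀ i, 1 ≤ i → i ≤ n → 0 ≤ f i) : 0 ≤ wAvg lam f n :=
  div_nonneg
    (Finset.sum_nonneg fun i hi => mul_nonneg (hlam i (Finset.mem_Icc.1 hi).1 (Finset.mem_Icc.1 hi).2)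
      (hf i (Finset.mem_Icc.1 hi).1 (Finset.mem_Icc.1 hi).2))
    (Finset.sum_nonneg fun i hi => hlam i (Finset.mem_Icc.1 hi).1 (Finset.mem_Icc.1 hi).2)

theorem wAvg_le_of_le {lam f : ℕ → ℝ} {n : ℕ} {F : ℝ} (hlam : ∀ i, 1 ≤ i → i ≤ n → 0 ≤ lam i)
    (hsum : 0 < ∑ i ∈ Finset.Icc 1 n, lam i) (hf : ∀ i, 1 ≤ i → i ≤ n → f i ≤ F) :
    wAvg lam f n ≤ F := by
  rw [wAvg, div_le_iff₀ hsum, Finset.mul_sum]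
  refine Finset.sum_le_sum fun i hi => ?_
  obtain ⟨h1, h2⟩ := Finset.mem_Icc.1 hi
  rw [mul_comm]
  exact mul_le_mul_of_nonneg_right (hf i h1 h2) (hlam i h1 h2)

/-- Weights of which none exceeds the fraction `C n ^ (-7/8)` of their sum. -/
structure IsSpread (lam : ℕ → ℝ) (C : ℝ) (n : ℕ) : Prop where
  nonneg : ∀ i, 1 ≤ i → i ≤ n → 0 ≤ lam i
  sum_pos : 0 < ∑ i ∈ Finset.Icc 1 n, lam i
  le : ∀ i, 1 ≤ i → i ≤ n → lam i ≤ C * (n : ℝ) ^ (-(7 / 8) : ℝ) * ∑ i ∈ Finset.Icc 1 n, lam i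

/-- Early terms, where `f` is not small, are harmless because no weight dominates: the average is of
order `n ^ (-7/8) ∑ i ^ (-3/4)`, that is `n ^ (-5/8)`, which beats `√n` by `n ^ (-1/8)`. -/
theorem IsSpread.sqrt_mul_wAvg_le {lam f : ℕ → ℝ} {n : ℕ} {C F : ℝ} (h : IsSpread lam C n)
    (hn : 1 ≤ n) (hC : 0 ≤ C) (hF : 0 ≤ F)
    (hf : ∀ i, 1 ≤ i → i ≤ n → f i ≤ F * (i : ℝ) ^ (-(3 / 4) : ℝ)) :
    √(n : ℝ) * wAvg lam f n ≤ 4 * C * F * (n : ℝ) ^ (-(1 / 8) : ℝ) := by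
  have hn' : (0 : ℝ) < n := by exact_mod_cast hn
  have hS := h.sum_pos
  set S := ∑ i ∈ Finset.Icc 1 n, lam i with hSdef
  have h1 : wAvg lam f n ≤ 4 * C * F * (n : ℝ) ^ (-(5 / 8) : ℝ) := by
    rw [wAvg, div_le_iff₀ hS]
    calc ∑ i ∈ Finset.Icc 1 n, lam i * f i
        ≤ ∑ i ∈ Finset.Icc 1 n, (C * (n : ℝ) ^ (-(7 / 8) : ℝ) * S * F) *
            (i : ℝ) ^ ((1 / 4 : ℝ) - 1) := by
          refine Finset.sum_le_sum fun i hi => ?_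
          obtain ⟨hi1, hi2⟩ := Finset.mem_Icc.1 hi
          have e : (i : ℝ) ^ ((1 / 4 : ℝ) - 1) = (i : ℝ) ^ (-(3 / 4) : ℝ) := by norm_num
          rw [e]
          calc lam i * f i ≤ lam i * (F * (i : ℝ) ^ (-(3 / 4) : ℝ)) :=
                mul_le_mul_of_nonneg_left (hf i hi1 hi2) (h.nonneg i hi1 hi2)
            _ ≤ (C * (n : ℝ) ^ (-(7 / 8) : ℝ) * S) * (F * (i : ℝ) ^ (-(3 / 4) : ℝ)) := by
                gcongr
                exact h.le i hi1 hi2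
            _ = _ := by ring
      _ ≤ (C * (n : ℝ) ^ (-(7 / 8) : ℝ) * S * F) * ((n : ℝ) ^ (1 / 4 : ℝ) / (1 / 4)) := by
          rw [← Finset.mul_sum]
          gcongr
          exact sum_rpow_sub_one_le (by norm_num) (by norm_num) n
      _ = 4 * C * F * ((n : ℝ) ^ (-(7 / 8) : ℝ) * (n : ℝ) ^ (1 / 4 : ℝ)) * S := by ring
      _ = _ := by
          rw [← Real.rpow_add hn']
          norm_num
  calc √(n : ℝ) * wAvg lam f n ≤ √(n : ℝ) * (4 * C * F * (n : ℝ) ^ (-(5 / 8) : ℝ)) := by gcongr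
    _ = 4 * C * F * (√(n : ℝ) * (n : ℝ) ^ (-(5 / 8) : ℝ)) := by ring
    _ = _ := by
        rw [sqrt_mul_rpow hn]
        norm_num

variable {H : Type*} [NormedAddCommGroup H] [InnerProductSpace ℝ H]

/-- An array of weights that, for sample size `n`, are the plug-ins of the upper confidence
interval at level `δ n`, some of those with small index being replaced by zero. -/
structure IsPluginArray (c : Tuning H) (x : ℕ → H) (mu : ℕ → ℕ → H) (δ : ℕ → ℝ)
    (lam : ℕ → ℕ → ℝ) : Prop where
  eq_or_eq_zero : ∀ n i, lam n i = lamUpper c (mu n) x n (δ n) i ∨ lam n i = 0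
  eq_lamUpper : ∀ᶠ n : ℕ in atTop, ∀ i, 1 ≤ i → i ≤ n → n ≤ i ^ 2 →
    lam n i = lamUpper c (mu n) x n (δ n) i

theorem lamUpper_nonneg (c : Tuning H) (mu x : ℕ → H) (n : ℕ) (δ : ℝ) (i : ℕ) :
    0 ≤ lamUpper c mu x n δ i := le_min (Real.sqrt_nonneg _) c.c₁_pos.le

theorem lamUpper_pos (c : Tuning H) (mu x : ℕ → H) {n i : ℕ} {δ : ℝ} (hn : 1 ≤ n) (hi : 1 ≤ i)
    (hδ : 0 < Real.log (1 / δ)) : 0 < lamUpper c mu x n δ i := by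
  have hn' : (0 : ℝ) < n := by exact_mod_cast hn
  have := m4HatSq_pos c mu x hi
  exact lt_min (Real.sqrt_pos.2 (by positivity)) c.c₁_pos

theorem lamUpper_sq_le (c : Tuning H) (mu x : ℕ → H) {n i : ℕ} {δ : ℝ} (hi : 1 ≤ i)
    (hδ : 0 ≤ Real.log (1 / δ)) :
    lamUpper c mu x n δ i ^ 2 ≤ 2 * Real.log (1 / δ) / (m4HatSq c mu x i * n) := by
  have := m4HatSq_pos c mu x hi
  calc lamUpper c mu x n δ i ^ 2 ≤ √(2 * Real.log (1 / δ) / (m4HatSq c mu x i * n)) ^ 2 :=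
        pow_le_pow_left₀ (lamUpper_nonneg c mu x n δ i) (min_le_left _ _) 2
    _ = _ := Real.sq_sqrt (by positivity)

theorem sqrt_mul_lamUpper (c : Tuning H) (mu x : ℕ → H) {n : ℕ} (hn : 1 ≤ n) (δ : ℝ) (i : ℕ) :
    √(n : ℝ) * lamUpper c mu x n δ i =
      min (√(2 * Real.log (1 / δ) / m4HatSq c mu x i)) (√(n : ℝ) * c.c₁) := by
  have hn' : (0 : ℝ) < n := by exact_mod_cast hn
  rw [lamUpper, mul_min_of_nonneg _ _ (Real.sqrt_nonneg _), ← Real.sqrt_mul hn'.le]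
  congr 2
  field_simp

namespace IsPluginArray

variable {c : Tuning H} {x : ℕ → H} {mu : ℕ → ℕ → H} {δ : ℕ → ℝ} {lam : ℕ → ℕ → ℝ}

theorem nonneg (h : IsPluginArray c x mu δ lam) (n i : ℕ) : 0 ≤ lam n i := by
  rcases h.eq_or_eq_zero n i with e | e
  · rw [e]
    exact lamUpper_nonneg ..
  · exact e.ge

theorem le_lamUpper (h : IsPluginArray c x mu δ lam) (n i : ℕ) :
    lam n i ≤ lamUpper c (mu n) x n (δ n) i := by
  rcases h.eq_or_eq_zero n i with e | e
  · exact e.le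
  · rw [e]
    exact lamUpper_nonneg ..

theorem le_c₁ (h : IsPluginArray c x mu δ lam) (n i : ℕ) : lam n i ≤ c.c₁ :=
  (h.le_lamUpper n i).trans (min_le_right _ _)

theorem radius_eq (n : ℕ) : radius c (lam n) (mu n) x (δ n) n =
    (Real.log (1 / δ n) + ∑ i ∈ Finset.Icc 1 n, psiE (lam n i) * residual c (mu n) x i ^ 2) /
      ∑ i ∈ Finset.Icc 1 n, lam n i := rfl

variable {α s v C : ℝ}

theorem tendsto_log (hα0 : 0 < α) (hδ : Tendsto δ atTop (𝓝 α)) :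
    Tendsto (fun n => Real.log (1 / δ n)) atTop (𝓝 (Real.log (1 / α))) :=
  (tendsto_const_nhds.div hδ hα0.ne').log (by positivity)

/-- For `v > 0` the fourth moment estimates stay away from zero. The second bound, on the uncapped
plug-ins, serves to show that the cap `c₁` becomes inactive. -/
theorem exists_sqrt_mul_le (h : IsPluginArray c x mu δ lam) (hα0 : 0 < α) (hα1 : α < 1)
    (hδ : Tendsto δ atTop (𝓝 α)) (hr : ∀ᶠ n in atTop, ResidualBounds c x (mu n) s v C)
    (hv : 0 < v) :
    ∃ M : ℝ, 0 < M ∧ ∀ᶠ n : ℕ in atTop, ∀ i, 1 ≤ i → i ≤ n → √(n : ℝ) * lam n i ≤ M ∧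
      √(2 * Real.log (1 / δ n) / m4HatSq c (mu n) x i) ≤ M := by
  obtain ⟨m, hm0, hm⟩ := exists_pos_lower_bound c.c₂_pos hv C
  have hL : 0 < Real.log (1 / α) := Real.log_pos (by rw [lt_div_iff₀ hα0]; linarith)
  refine ⟨√(2 * (2 * Real.log (1 / α)) / m), by positivity, ?_⟩
  filter_upwards [hr, eventually_ge_atTop 1,
    (tendsto_log hα0 hδ).eventually (gt_mem_nhds (by linarith : _ < 2 * Real.log (1 / α)))]
    with n h1 h2 h3 i hi _
  have hmi : m ≤ m4HatSq c (mu n) x i := hm i _ hi (m4HatSq_lower c _ x i) (h1.m4_le i hi)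
  have key : √(2 * Real.log (1 / δ n) / m4HatSq c (mu n) x i) ≤
      √(2 * (2 * Real.log (1 / α)) / m) := by
    apply Real.sqrt_le_sqrt
    calc 2 * Real.log (1 / δ n) / m4HatSq c (mu n) x i
        ≤ 2 * (2 * Real.log (1 / α)) / m4HatSq c (mu n) x i := by
          have := hm0.trans_le hmi
          gcongr
      _ ≤ _ := by gcongr
  refine ⟨?_, key⟩
  calc √(n : ℝ) * lam n i ≤ √(n : ℝ) * lamUpper c (mu n) x n (δ n) i := by
        gcongr
        exact h.le_lamUpper n i
    _ ≤ _ := by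
        rw [sqrt_mul_lamUpper c _ x h2]
        exact (min_le_left _ _).trans key

/-- Beyond `√n` the error `i ^ (-3/8)` of the fourth moment estimator is at most `n ^ (-3/16)`,
uniformly in `i`; the rest is continuity of `√(2 p / q)` at `(log(1/α), v)`. -/
theorem eventually_abs_sqrt_mul_sub_le (h : IsPluginArray c x mu δ lam) (hα0 : 0 < α) (hα1 : α < 1)
    (hδ : Tendsto δ atTop (𝓝 α)) (hr : ∀ᶠ n in atTop, ResidualBounds c x (mu n) s v C)
    (hC : 0 < C) (hv : 0 < v) (ε : ℝ) (hε : 0 < ε) :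
    ∀ᶠ n : ℕ in atTop, ∀ i, 1 ≤ i → i ≤ n → n ≤ i ^ 2 →
      |√(n : ℝ) * lam n i - √(2 * Real.log (1 / α) / v)| ≤ ε := by
  obtain ⟨M, hM0, hM⟩ := h.exists_sqrt_mul_le hα0 hα1 hδ hr hv
  have hcont : ContinuousAt (fun p : ℝ × ℝ => √(2 * p.1 / p.2)) (Real.log (1 / α), v) := by
    refine Real.continuous_sqrt.continuousAt.comp ?_
    exact (continuousAt_const.mul continuousAt_fst).div continuousAt_snd hv.ne'
  obtain ⟨η, hη0, hη⟩ := Metric.continuousAt_iff.1 hcont ε hε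
  have hsmall : Tendsto (fun n : ℕ => C * (n : ℝ) ^ (-(3 / 16) : ℝ)) atTop (𝓝 (C * 0)) :=
    (tendsto_natCast_rpow_neg (by norm_num)).const_mul _
  rw [mul_zero] at hsmall
  have hsq : Tendsto (fun n : ℕ => √(n : ℝ)) atTop atTop :=
    Real.tendsto_sqrt_atTop.comp tendsto_natCast_atTop_atTop
  filter_upwards [hr, hM, h.eq_lamUpper, hsmall.eventually (gt_mem_nhds hη0),
    Metric.tendsto_nhds.1 (tendsto_log hα0 hδ) η hη0, eventually_ge_atTop 1,
    hsq.eventually_ge_atTop (M / c.c₁)] with n h1 h2 h3 h4 h5 h6 h7 i hi1 hi2 hi3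
  have hi' : (0 : ℝ) < i := by exact_mod_cast hi1
  have hn' : (0 : ℝ) < n := by exact_mod_cast h6
  rw [div_le_iff₀ c.c₁_pos] at h7
  rw [h3 i hi1 hi2 hi3, sqrt_mul_lamUpper c _ x h6,
    min_eq_left ((h2 i hi1 hi2).2.trans h7)]
  have h8 : |m4HatSq c (mu n) x i - v| < η := by
    refine (h1.m4_le i hi1).trans_lt (lt_of_le_of_lt ?_ h4)
    gcongr C * ?_
    have e : (n : ℝ) ^ (-(3 / 16) : ℝ) ≥ ((i : ℝ) ^ 2) ^ (-(3 / 16) : ℝ) :=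
      Real.rpow_le_rpow_of_nonpos hn' (by exact_mod_cast hi3) (by norm_num)
    rw [← Real.rpow_natCast, ← Real.rpow_mul hi'.le] at e
    norm_num at e ⊢
    exact e
  have h9 := @hη (Real.log (1 / δ n), m4HatSq c (mu n) x i) (by
    rw [Prod.dist_eq]
    exact max_lt h5 h8)
  rw [Real.dist_eq] at h9
  exact h9.le

theorem tendsto_average_residual_sq (hr : ∀ᶠ n in atTop, ResidualBounds c x (mu n) s v C) :
    Tendsto (fun n : ℕ => (∑ i ∈ Finset.Icc 1 n, residual c (mu n) x i ^ 2) / n) atTop (𝓝 v) := by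
  -- `average_le` at index `n + 1` sums up to `n`, hence the divisor `n + 1`, exchanged for `n`
  -- afterwards.
  have h1 : Tendsto (fun n : ℕ => (∑ i ∈ Finset.Icc 1 n, residual c (mu n) x i ^ 2) /
      ((n + 1 : ℕ) : ℝ)) atTop (𝓝 v) := by
    rw [tendsto_iff_norm_sub_tendsto_zero]
    have hsmall : Tendsto (fun n : ℕ => C * ((n + 1 : ℕ) : ℝ) ^ (-(3 / 8) : ℝ)) atTop
        (𝓝 (C * 0)) :=
      ((tendsto_natCast_rpow_neg (by norm_num)).comp (tendsto_add_atTop_nat 1)).const_mul _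
    rw [mul_zero] at hsmall
    refine squeeze_zero' (Eventually.of_forall fun n => norm_nonneg _) ?_ hsmall
    filter_upwards [hr] with n hn
    exact hn.average_le (n + 1) (by omega)
  have h2 : Tendsto (fun n : ℕ => ((n + 1 : ℕ) : ℝ) / n) atTop (𝓝 1) := by
    have h3 : Tendsto (fun n : ℕ => 1 + 1 / (n : ℝ)) atTop (𝓝 (1 + 0)) :=
      tendsto_const_nhds.add tendsto_one_div_atTop_nhds_zero_nat
    rw [add_zero] at h3
    refine h3.congr' ?_
    filter_upwards [eventually_ge_atTop 1] with n hn
    have hn' : (n : ℝ) ≠ 0 := by positivity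
    push_cast
    field_simp
  have h3 := h1.mul h2
  rw [mul_one] at h3
  refine h3.congr' ?_
  filter_upwards [eventually_ge_atTop 1] with n hn
  have hn' : (n : ℝ) ≠ 0 := by positivity
  field_simp

theorem tendsto_sum_div_sqrt (h : IsPluginArray c x mu δ lam) (hα0 : 0 < α) (hα1 : α < 1)
    (hδ : Tendsto δ atTop (𝓝 α)) (hr : ∀ᶠ n in atTop, ResidualBounds c x (mu n) s v C)
    (hC : 0 < C) (hv : 0 < v) :
    Tendsto (fun n : ℕ => (∑ i ∈ Finset.Icc 1 n, lam n i) / √(n : ℝ)) atTop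
      (𝓝 (√(2 * Real.log (1 / α) / v))) := by
  obtain ⟨M, hM0, hM⟩ := h.exists_sqrt_mul_le hα0 hα1 hδ hr hv
  have h1 := tendsto_average_mul (a := fun n i => √(n : ℝ) * lam n i) (b := fun _ _ => 1) (v := 1)
    (M := M) (K := 1) (by
      filter_upwards [hM] with n hn i hi1 hi2
      rw [abs_of_nonneg (mul_nonneg (Real.sqrt_nonneg _) (h.nonneg n i))]
      exact (hn i hi1 hi2).1)
    (h.eventually_abs_sqrt_mul_sub_le hα0 hα1 hδ hr hC hv)
    (Eventually.of_forall fun _ _ _ _ => by simp) (by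
      refine tendsto_const_nhds.congr' ?_
      filter_upwards [eventually_ge_atTop 1] with n hn
      have hn' : (n : ℝ) ≠ 0 := by positivity
      simp [hn'])
  rw [mul_one] at h1
  refine h1.congr' ?_
  filter_upwards [eventually_ge_atTop 1] with n hn
  have hn' : (0 : ℝ) < n := by exact_mod_cast hn
  simp only [mul_one]
  rw [← Finset.mul_sum, div_eq_div_iff hn'.ne' (by positivity), mul_right_comm,
    Real.mul_self_sqrt hn'.le]
  ring

/-- Here `n ψ_E(λ) ≈ (√n λ)² / 2 → log(1/α) / v`, while the squared residuals average to `v`; the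
product no longer depends on `v`. -/
theorem tendsto_sum_psiE (h : IsPluginArray c x mu δ lam) (hα0 : 0 < α) (hα1 : α < 1)
    (hδ : Tendsto δ atTop (𝓝 α)) (hr : ∀ᶠ n in atTop, ResidualBounds c x (mu n) s v C)
    (hC : 0 < C) (hv : 0 < v) :
    Tendsto (fun n : ℕ => ∑ i ∈ Finset.Icc 1 n, psiE (lam n i) * residual c (mu n) x i ^ 2) atTop
      (𝓝 (Real.log (1 / α))) := by
  obtain ⟨M, hM0, hM⟩ := h.exists_sqrt_mul_le hα0 hα1 hδ hr hv
  have hL : 0 < Real.log (1 / α) := Real.log_pos (by rw [lt_div_iff₀ hα0]; linarith)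
  set s₀ := √(2 * Real.log (1 / α) / v) with hs₀
  have hs₀0 : 0 < s₀ := by positivity
  have hs₀sq : s₀ ^ 2 = 2 * Real.log (1 / α) / v := Real.sq_sqrt (by positivity)
  have hc1 : 0 < 1 - c.c₁ := by linarith [c.c₁_lt_one]
  have e1 : ∀ (n i : ℕ), (n : ℝ) * lam n i ^ 2 = (√(n : ℝ) * lam n i) ^ 2 := fun n i => by
    rw [mul_pow, Real.sq_sqrt (Nat.cast_nonneg n)]
  have h1 := tendsto_average_mul (a := fun n i => (n : ℝ) * psiE (lam n i))
    (b := fun n i => residual c (mu n) x i ^ 2) (v := v) (A := s₀ ^ 2 / 2)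
    (M := (1 + 1 / (1 - c.c₁)) * M ^ 2) (K := C) (by
      filter_upwards [hM] with n hn i hi1 hi2
      have h0 : 0 ≤ psiE (lam n i) := psiE_nonneg ((h.le_c₁ n i).trans_lt c.c₁_lt_one)
      rw [abs_of_nonneg (by positivity)]
      calc (n : ℝ) * psiE (lam n i) ≤ n * ((1 + 1 / (1 - c.c₁)) * lam n i ^ 2) := by
            gcongr
            exact psiE_le (h.nonneg n i) (h.le_c₁ n i) c.c₁_lt_one
        _ = (1 + 1 / (1 - c.c₁)) * (√(n : ℝ) * lam n i) ^ 2 := by rw [← e1]; ring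
        _ ≤ _ := by
            gcongr
            · exact mul_nonneg (Real.sqrt_nonneg _) (h.nonneg n i)
            · exact (hn i hi1 hi2).1)
    (by
      intro ε hε
      have hsmall : Tendsto (fun n : ℕ => M ^ 3 / (1 - c.c₁) * (n : ℝ) ^ (-(1 / 2) : ℝ)) atTop
          (𝓝 (M ^ 3 / (1 - c.c₁) * 0)) := (tendsto_natCast_rpow_neg (by norm_num)).const_mul _
      rw [mul_zero] at hsmall
      filter_upwards [hM, hsmall.eventually (gt_mem_nhds (half_pos hε)), eventually_ge_atTop 1,
        h.eventually_abs_sqrt_mul_sub_le hα0 hα1 hδ hr hC hv (ε / (M + s₀)) (by positivity)]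
        with n h2 h3 h4 h5 i hi1 hi2 hi3
      have hn' : (0 : ℝ) < n := by exact_mod_cast h4
      set y := √(n : ℝ) * lam n i with hy
      have hy0 : 0 ≤ y := mul_nonneg (Real.sqrt_nonneg _) (h.nonneg n i)
      have hyM : y ≤ M := (h2 i hi1 hi2).1
      have h6 : |(n : ℝ) * psiE (lam n i) - y ^ 2 / 2| ≤ ε / 2 := by
        have e2 : (n : ℝ) * psiE (lam n i) - y ^ 2 / 2 =
            n * (psiE (lam n i) - lam n i ^ 2 / 2) := by rw [hy, ← e1]; ring
        rw [e2, abs_mul, abs_of_pos hn']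
        refine le_trans ?_ h3.le
        -- The cubic Taylor remainder, multiplied by `n`, still carries a factor `n ^ (-1/2)`.
        have e3 : (n : ℝ) * lam n i ^ 3 = y ^ 3 * (n : ℝ) ^ (-(1 / 2) : ℝ) := by
          have e4 : (n : ℝ) ^ (-(1 / 2) : ℝ) = (√(n : ℝ))⁻¹ := by
            rw [Real.rpow_neg hn'.le, Real.sqrt_eq_rpow]
          have e5 : √(n : ℝ) ^ 2 = n := Real.sq_sqrt hn'.le
          have e6 : √(n : ℝ) ≠ 0 := by positivity
          have e7 : √(n : ℝ) ^ 3 = n * √(n : ℝ) := by rw [pow_succ, e5]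
          rw [e4, hy, mul_pow, e7]
          field_simp
        calc (n : ℝ) * |psiE (lam n i) - lam n i ^ 2 / 2|
            ≤ n * (lam n i ^ 3 / (1 - c.c₁)) := by
              gcongr
              exact abs_psiE_sub_le (h.nonneg n i) (h.le_c₁ n i) c.c₁_lt_one
          _ = y ^ 3 / (1 - c.c₁) * (n : ℝ) ^ (-(1 / 2) : ℝ) := by
              rw [← mul_div_assoc, e3]
              ring
          _ ≤ _ := by gcongr
      have h7 : |y ^ 2 / 2 - s₀ ^ 2 / 2| ≤ ε / 2 := by
        have e2 : y ^ 2 / 2 - s₀ ^ 2 / 2 = (y - s₀) * (y + s₀) / 2 := by ring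
        rw [e2, abs_div, abs_mul, abs_of_nonneg (by positivity : 0 ≤ y + s₀), abs_two]
        gcongr
        calc |y - s₀| * (y + s₀) ≤ ε / (M + s₀) * (M + s₀) :=
              mul_le_mul (h5 i hi1 hi2 hi3) (by linarith) (by positivity) (by positivity)
          _ = ε := div_mul_cancel₀ _ (by positivity)
      have h8 := abs_sub_le ((n : ℝ) * psiE (lam n i)) (y ^ 2 / 2) (s₀ ^ 2 / 2)
      linarith)
    (by
      filter_upwards [hr] with n hn i hi1 _
      rw [abs_of_nonneg (sq_nonneg _)]
      exact hn.residual_sq_le i hi1)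
    (tendsto_average_residual_sq hr)
  have e : s₀ ^ 2 / 2 * v = Real.log (1 / α) := by
    rw [hs₀sq]
    field_simp
  rw [e] at h1
  refine h1.congr' ?_
  filter_upwards [eventually_ge_atTop 1] with n hn
  have hn' : (n : ℝ) ≠ 0 := by positivity
  simp only [mul_assoc]
  rw [← Finset.mul_sum, mul_div_cancel_left₀ _ hn']

/-- In the degenerate case the sum of the plug-ins is of order at least `n ^ (7/8)`. -/
theorem exists_sum_lower (h : IsPluginArray c x mu δ lam) (hα0 : 0 < α) (hα1 : α < 1)
    (hδ : Tendsto δ atTop (𝓝 α)) (hr : ∀ᶠ n in atTop, ResidualBounds c x (mu n) s v C)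
    (hC : 0 < C) (hv : v = 0) :
    ∃ κ : ℝ, 0 < κ ∧ ∀ᶠ n : ℕ in atTop,
      κ * (n : ℝ) ^ (7 / 8 : ℝ) ≤ ∑ i ∈ Finset.Icc 1 n, lam n i := by
  have hL : 0 < Real.log (1 / α) := Real.log_pos (by rw [lt_div_iff₀ hα0]; linarith)
  have hc1 := c.c₁_pos
  set κ := min (√(Real.log (1 / α) / (2 * C))) c.c₁ with hκ
  have hκ0 : 0 < κ := by positivity
  refine ⟨κ / 2, by positivity, ?_⟩
  filter_upwards [hr, h.eq_lamUpper, eventually_ge_atTop 3,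
    (tendsto_log hα0 hδ).eventually (lt_mem_nhds (half_lt_self hL))] with n h1 h2 h3 h4
  have hn' : (0 : ℝ) < n := by positivity
  have hn1 : 1 ≤ n := by omega
  -- The upper half of the indices suffices: there `m̂₄² n` is at most of order `n ^ (1/4)`, so each
  -- plug-in is at least of order `n ^ (-1/8)`. With `n ≥ 3` these indices satisfy `n ≤ i ^ 2`, so
  -- none has been replaced by zero.
  have hterm : ∀ i ∈ Finset.Icc ((n + 1) / 2) n, κ * (n : ℝ) ^ (-(1 / 8) : ℝ) ≤ lam n i := by
    intro i hi
    obtain ⟨hi1, hi2⟩ := Finset.mem_Icc.1 hi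
    have hi0 : 1 ≤ i := by omega
    have hni : n ≤ 2 * i := by omega
    have hsq : n ≤ i ^ 2 := by
      have : 2 ≤ i := by omega
      nlinarith
    have hi' : (0 : ℝ) < i := by exact_mod_cast hi0
    rw [h2 i hi0 hi2 hsq]
    refine le_min ?_ ?_
    · have hm0 := m4HatSq_pos c (mu n) x hi0
      have hm : m4HatSq c (mu n) x i * n ≤ 2 * C * (n : ℝ) ^ (1 / 4 : ℝ) := by
        have hi4 : (i : ℝ) ^ (-(3 / 4) : ℝ) ≤ 2 * (n : ℝ) ^ (-(3 / 4) : ℝ) := by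
          have h5 : (n : ℝ) ≤ 2 * i := by exact_mod_cast hni
          have h6 : (2 * i : ℝ) ^ (-(3 / 4) : ℝ) ≤ (n : ℝ) ^ (-(3 / 4) : ℝ) :=
            Real.rpow_le_rpow_of_nonpos hn' h5 (by norm_num)
          have h7 : (2 : ℝ) ^ (-1 : ℝ) ≤ (2 : ℝ) ^ (-(3 / 4) : ℝ) :=
            Real.rpow_le_rpow_of_exponent_le (by norm_num) (by norm_num)
          rw [Real.mul_rpow (by norm_num) hi'.le] at h6
          rw [Real.rpow_neg_one] at h7
          have h8 : 0 < (i : ℝ) ^ (-(3 / 4) : ℝ) := by positivity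
          nlinarith
        calc m4HatSq c (mu n) x i * n ≤ C * (2 * (n : ℝ) ^ (-(3 / 4) : ℝ)) * n := by
              gcongr
              exact (h1.m4_le_rpow hv i hi0).trans (by gcongr)
          _ = 2 * C * ((n : ℝ) ^ (-(3 / 4) : ℝ) * n) := by ring
          _ = _ := by
              rw [← Real.rpow_add_one hn'.ne']
              norm_num
      calc κ * (n : ℝ) ^ (-(1 / 8) : ℝ)
          ≤ √(Real.log (1 / α) / (2 * C)) * (n : ℝ) ^ (-(1 / 8) : ℝ) := by
            gcongr
            exact min_le_left _ _
        _ = √(Real.log (1 / α) / (2 * C * (n : ℝ) ^ (1 / 4 : ℝ))) := by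
            have e : (n : ℝ) ^ (-(1 / 8) : ℝ) = √(((n : ℝ) ^ (1 / 4 : ℝ))⁻¹) := by
              rw [← Real.rpow_neg hn'.le, Real.sqrt_eq_rpow, ← Real.rpow_mul hn'.le]
              norm_num
            rw [e, ← Real.sqrt_mul (by positivity)]
            congr 1
            field_simp
        _ ≤ √(2 * Real.log (1 / δ n) / (m4HatSq c (mu n) x i * n)) := by
            apply Real.sqrt_le_sqrt
            gcongr <;> linarith
    · calc κ * (n : ℝ) ^ (-(1 / 8) : ℝ) ≤ c.c₁ * 1 := by
            gcongr
            · exact min_le_right _ _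
            · exact rpow_le_one_of_one_le_cast hn1 (by norm_num)
        _ = c.c₁ := mul_one _
  calc κ / 2 * (n : ℝ) ^ (7 / 8 : ℝ) = (n : ℝ) / 2 * (κ * (n : ℝ) ^ (-(1 / 8) : ℝ)) := by
        have e : (n : ℝ) ^ (7 / 8 : ℝ) = (n : ℝ) ^ (-(1 / 8) : ℝ) * n := by
          rw [← Real.rpow_add_one hn'.ne']
          norm_num
        rw [e]
        ring
    _ ≤ ((Finset.Icc ((n + 1) / 2) n).card : ℝ) * (κ * (n : ℝ) ^ (-(1 / 8) : ℝ)) := by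
        gcongr
        rw [Nat.card_Icc, div_le_iff₀ (by norm_num)]
        exact_mod_cast (by omega : n ≤ (n + 1 - (n + 1) / 2) * 2)
    _ = ∑ i ∈ Finset.Icc ((n + 1) / 2) n, κ * (n : ℝ) ^ (-(1 / 8) : ℝ) := by simp
    _ ≤ ∑ i ∈ Finset.Icc ((n + 1) / 2) n, lam n i := Finset.sum_le_sum hterm
    _ ≤ _ := Finset.sum_le_sum_of_subset_of_nonneg
        (Finset.Icc_subset_Icc_left (by omega)) fun i _ _ => h.nonneg n i

/-- For `v > 0` each weight is at most of order `n ^ (-1/2)` and the sum is of order `n ^ (1/2)`, a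
fraction `1 / n`. The exponent `7/8` is dictated by `v = 0`, where the weights are merely bounded.
-/
theorem exists_isSpread (h : IsPluginArray c x mu δ lam) (hα0 : 0 < α) (hα1 : α < 1)
    (hδ : Tendsto δ atTop (𝓝 α)) (hr : ∀ᶠ n in atTop, ResidualBounds c x (mu n) s v C)
    (hC : 0 < C) (hv : 0 ≤ v) :
    ∃ B : ℝ, 0 ≤ B ∧ ∀ᶠ n : ℕ in atTop, IsSpread (lam n) B n := by
  have hL : 0 < Real.log (1 / α) := Real.log_pos (by rw [lt_div_iff₀ hα0]; linarith)
  rcases hv.eq_or_lt with hv | hv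
  · obtain ⟨κ, hκ0, hκ⟩ := h.exists_sum_lower hα0 hα1 hδ hr hC hv.symm
    refine ⟨1 / κ, by positivity, ?_⟩
    filter_upwards [hκ, eventually_ge_atTop 1] with n h1 h2
    have hn' : (0 : ℝ) < n := by exact_mod_cast h2
    refine ⟨fun i _ _ => h.nonneg n i, lt_of_lt_of_le (by positivity) h1, fun i _ _ => ?_⟩
    calc lam n i ≤ 1 := (h.le_c₁ n i).trans c.c₁_lt_one.le
      _ = 1 / κ * (n : ℝ) ^ (-(7 / 8) : ℝ) * (κ * (n : ℝ) ^ (7 / 8 : ℝ)) := by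
          rw [Real.rpow_neg hn'.le]
          field_simp
      _ ≤ _ := by gcongr
  · obtain ⟨M, hM0, hM⟩ := h.exists_sqrt_mul_le hα0 hα1 hδ hr hv
    have hlim := h.tendsto_sum_div_sqrt hα0 hα1 hδ hr hC hv
    set s₀ := √(2 * Real.log (1 / α) / v) with hs₀
    have hs₀0 : 0 < s₀ := by positivity
    refine ⟨2 * M / s₀, by positivity, ?_⟩
    filter_upwards [hM, eventually_ge_atTop 1, hlim.eventually (lt_mem_nhds (half_lt_self hs₀0))]
      with n h1 h2 h3
    have hn' : (0 : ℝ) < n := by exact_mod_cast h2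
    have hsn : 0 < √(n : ℝ) := by positivity
    rw [lt_div_iff₀ hsn] at h3
    refine ⟨fun i _ _ => h.nonneg n i, lt_trans (by positivity) h3, fun i hi1 hi2 => ?_⟩
    have h4 := (h1 i hi1 hi2).1
    rw [mul_comm, ← le_div_iff₀ hsn] at h4
    refine h4.trans ?_
    calc M / √(n : ℝ) = 2 * M / s₀ * (n : ℝ)⁻¹ * (s₀ / 2 * √(n : ℝ)) := by
          have e5 : √(n : ℝ) ^ 2 = n := Real.sq_sqrt hn'.le
          field_simp
          rw [e5]
      _ ≤ _ := by
          gcongr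
          rw [← Real.rpow_neg_one]
          exact rpow_le_rpow_of_one_le_cast h2 (by norm_num)

/-- The limit of the scaled radius. -/
theorem tendsto_sqrt_mul_radius (h : IsPluginArray c x mu δ lam) (hα0 : 0 < α) (hα1 : α < 1)
    (hδ : Tendsto δ atTop (𝓝 α)) (hr : ∀ᶠ n in atTop, ResidualBounds c x (mu n) s v C)
    (hC : 0 < C) (hv : 0 ≤ v) :
    Tendsto (fun n : ℕ => √(n : ℝ) * radius c (lam n) (mu n) x (δ n) n) atTop
      (𝓝 (√(2 * v * Real.log (1 / α)))) := by
  have hL : 0 < Real.log (1 / α) := Real.log_pos (by rw [lt_div_iff₀ hα0]; linarith)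
  rcases hv.eq_or_lt with hv | hv
  · obtain ⟨κ, hκ0, hκ⟩ := h.exists_sum_lower hα0 hα1 hδ hr hC hv.symm
    rw [← hv, mul_zero, zero_mul, Real.sqrt_zero]
    have hc1 : 0 < 1 - c.c₁ := by linarith [c.c₁_lt_one]
    have hc2 := c.c₂_pos
    set K : ℝ := (1 + 1 / (1 - c.c₁)) * (4 * Real.log (1 / α) / c.c₂) * C with hK
    have hK0 : 0 < K := by positivity
    have hsmall : Tendsto (fun n : ℕ => (2 * Real.log (1 / α) + K) / κ *
        (n : ℝ) ^ (-(1 / 8) : ℝ)) atTop (𝓝 ((2 * Real.log (1 / α) + K) / κ * 0)) :=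
      (tendsto_natCast_rpow_neg (by norm_num)).const_mul _
    rw [mul_zero] at hsmall
    have hev : ∀ᶠ n : ℕ in atTop, 0 ≤ √(n : ℝ) * radius c (lam n) (mu n) x (δ n) n ∧
        √(n : ℝ) * radius c (lam n) (mu n) x (δ n) n ≤
          (2 * Real.log (1 / α) + K) / κ * (n : ℝ) ^ (-(1 / 8) : ℝ) := by
      filter_upwards [hr, hκ, eventually_ge_atTop 1,
        (tendsto_log hα0 hδ).eventually (lt_mem_nhds hL),
        (tendsto_log hα0 hδ).eventually (gt_mem_nhds (by linarith : _ < 2 * Real.log (1 / α)))]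
        with n h1 h2 h3 h4 h5
      have hn' : (0 : ℝ) < n := by exact_mod_cast h3
      have hS : 0 < ∑ i ∈ Finset.Icc 1 n, lam n i := lt_of_lt_of_le (by positivity) h2
      have hpsi0 : ∀ i, 0 ≤ psiE (lam n i) := fun i =>
        psiE_nonneg ((h.le_c₁ n i).trans_lt c.c₁_lt_one)
      have hN0 : 0 ≤ ∑ i ∈ Finset.Icc 1 n, psiE (lam n i) * residual c (mu n) x i ^ 2 :=
        Finset.sum_nonneg fun i _ => mul_nonneg (hpsi0 i) (sq_nonneg _)
      -- The regularisation `m̂₄² ≥ c₂ / i` gives `λ_i² ≤ const * i / n`; against squared residuals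
      -- of order `i ^ (-3/4)` each summand is at most of order `n ^ (1/4) / n`.
      have hN : ∑ i ∈ Finset.Icc 1 n, psiE (lam n i) * residual c (mu n) x i ^ 2 ≤
          K * (n : ℝ) ^ (1 / 4 : ℝ) := by
        calc ∑ i ∈ Finset.Icc 1 n, psiE (lam n i) * residual c (mu n) x i ^ 2
            ≤ ∑ i ∈ Finset.Icc 1 n, K * (n : ℝ) ^ (1 / 4 : ℝ) / n := by
              refine Finset.sum_le_sum fun i hi => ?_
              obtain ⟨hi1, hi2⟩ := Finset.mem_Icc.1 hi
              have hi' : (0 : ℝ) < i := by exact_mod_cast hi1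
              have hin : (i : ℝ) ≤ n := by exact_mod_cast hi2
              have hl2 : lam n i ^ 2 ≤ 4 * Real.log (1 / α) / c.c₂ * (i / n) :=
                calc lam n i ^ 2 ≤ lamUpper c (mu n) x n (δ n) i ^ 2 :=
                      pow_le_pow_left₀ (h.nonneg n i) (h.le_lamUpper n i) 2
                  _ ≤ 2 * Real.log (1 / δ n) / (m4HatSq c (mu n) x i * n) :=
                      lamUpper_sq_le c _ x hi1 h4.le
                  _ ≤ 2 * (2 * Real.log (1 / α)) / (c.c₂ / i * n) := by
                      gcongr
                      exact m4HatSq_lower c _ x i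
                  _ = _ := by field_simp; norm_num
              have e : (i : ℝ) * (i : ℝ) ^ (-(3 / 4) : ℝ) = (i : ℝ) ^ (1 / 4 : ℝ) := by
                rw [mul_comm, ← Real.rpow_add_one hi'.ne']
                norm_num
              calc psiE (lam n i) * residual c (mu n) x i ^ 2
                  ≤ ((1 + 1 / (1 - c.c₁)) * (4 * Real.log (1 / α) / c.c₂ * (i / n))) *
                      (C * (i : ℝ) ^ (-(3 / 4) : ℝ)) := by
                    refine mul_le_mul ?_ (h1.residual_sq_le_rpow hv.symm i hi1) (sq_nonneg _)
                      (by positivity)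
                    refine (psiE_le (h.nonneg n i) (h.le_c₁ n i) c.c₁_lt_one).trans ?_
                    gcongr
                _ = K * ((i : ℝ) * (i : ℝ) ^ (-(3 / 4) : ℝ)) / n := by rw [hK]; ring
                _ ≤ _ := by
                    rw [e]
                    gcongr
          _ = _ := by
              rw [Finset.sum_const, Nat.card_Icc, Nat.add_sub_cancel, nsmul_eq_mul]
              field_simp
      rw [radius_eq]
      refine ⟨by positivity, ?_⟩
      have h6 : 1 ≤ (n : ℝ) ^ (1 / 4 : ℝ) := one_le_rpow_of_one_le_cast h3 (by norm_num)
      calc √(n : ℝ) * ((Real.log (1 / δ n) +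
              ∑ i ∈ Finset.Icc 1 n, psiE (lam n i) * residual c (mu n) x i ^ 2) /
              ∑ i ∈ Finset.Icc 1 n, lam n i)
          ≤ √(n : ℝ) * ((2 * Real.log (1 / α) * (n : ℝ) ^ (1 / 4 : ℝ) +
              K * (n : ℝ) ^ (1 / 4 : ℝ)) / (κ * (n : ℝ) ^ (7 / 8 : ℝ))) := by
            gcongr
            nlinarith
        _ = (2 * Real.log (1 / α) + K) / κ *
              (√(n : ℝ) * ((n : ℝ) ^ (1 / 4 : ℝ) / (n : ℝ) ^ (7 / 8 : ℝ))) := by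
            field_simp
        _ = _ := by
            rw [← Real.rpow_sub hn', sqrt_mul_rpow h3]
            norm_num
    exact squeeze_zero' (hev.mono fun n hn => hn.1) (hev.mono fun n hn => hn.2) hsmall
  · set s₀ := √(2 * Real.log (1 / α) / v) with hs₀
    have hs₀0 : 0 < s₀ := by positivity
    have h1 := ((tendsto_log hα0 hδ).add (h.tendsto_sum_psiE hα0 hα1 hδ hr hC hv)).div
      (h.tendsto_sum_div_sqrt hα0 hα1 hδ hr hC hv) hs₀0.ne'
    -- The choice of plug-ins balances the numerator: both of its terms tend to `log(1/α)`.
    have e : (Real.log (1 / α) + Real.log (1 / α)) / s₀ = √(2 * v * Real.log (1 / α)) := by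
      rw [div_eq_iff hs₀0.ne', hs₀, ← Real.sqrt_mul (by positivity)]
      have e2 : 2 * v * Real.log (1 / α) * (2 * Real.log (1 / α) / v) =
          (Real.log (1 / α) + Real.log (1 / α)) ^ 2 := by
        field_simp
        ring
      rw [e2, Real.sqrt_sq (by positivity)]
    rw [e] at h1
    refine h1.congr fun n => ?_
    rw [radius_eq]
    simp only [Pi.div_apply]
    rw [div_div_eq_mul_div]
    ring

end IsPluginArray

end Arrays

/-! ### The lower bound as the root of a quadratic equation, and its limit. -/

section Quadratic

/-- The positive root of `A L² + B L = y`. -/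
theorem quadratic_root_spec {A B y : ℝ} (hA : 0 < A) (hB : 1 ≤ B) (hy : 4 * A * |y| ≤ 1) :
    A * ((-B + √(B ^ 2 + 4 * A * y)) / (2 * A)) ^ 2 +
        B * ((-B + √(B ^ 2 + 4 * A * y)) / (2 * A)) = y ∧
      |(-B + √(B ^ 2 + 4 * A * y)) / (2 * A)| ≤ 2 * |y| := by
  have hdisc : 0 ≤ B ^ 2 + 4 * A * y := by
    have h1 : -(4 * A * |y|) ≤ 4 * A * y := by nlinarith [neg_abs_le y]
    nlinarith
  set r := √(B ^ 2 + 4 * A * y) with hr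
  have hr0 : 0 ≤ r := Real.sqrt_nonneg _
  have hr2 : r ^ 2 = B ^ 2 + 4 * A * y := Real.sq_sqrt hdisc
  set L := (-B + r) / (2 * A) with hL
  have h1 : 2 * A * L = r - B := by
    rw [hL]
    field_simp
    ring
  -- Rationalising removes the division by `A`: since `r + B ≥ 1`, the bound on `L` stays uniform as
  -- `A → 0`.
  have h2 : L * (r + B) = 2 * y := by
    have : 2 * A * (L * (r + B)) = 2 * A * (2 * y) := by
      rw [← mul_assoc, h1]
      nlinarith
    exact mul_left_cancel₀ (by positivity) this
  refine ⟨?_, ?_⟩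
  · have : r = 2 * A * L + B := by linarith
    rw [this] at h2
    linarith
  · have h3 : |L| * (r + B) = 2 * |y| := by
      rw [← abs_of_nonneg (by linarith : 0 ≤ r + B), ← abs_mul, h2, abs_mul, abs_two]
    nlinarith [abs_nonneg L]

end Quadratic

section Limits

/-- On a constant path every summand of the third law equals `-v`, so `n v = O(n ^ (9/16))`. -/
theorem RegularPath.varSq_eq_zero {H : Type*} [NormedAddCommGroup H] {x : ℕ → H}
    {μ : H} {s v : ℝ} (hx : RegularPath x μ s v) (hs : s = 0) : v = 0 := by
  obtain ⟨C, hC⟩ := hx.sum_varSq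
  refine le_antisymm ?_ hx.varSq_nonneg
  have hsmall : Tendsto (fun n : ℕ => C * (n : ℝ) ^ (-(7 / 16) : ℝ)) atTop (𝓝 (C * 0)) :=
    (tendsto_natCast_rpow_neg (by norm_num)).const_mul _
  rw [mul_zero] at hsmall
  refine ge_of_tendsto hsmall ?_
  filter_upwards [eventually_ge_atTop 1] with n hn
  have hn' : (0 : ℝ) < n := by exact_mod_cast hn
  have h1 := hC n
  have h2 : ∑ i ∈ Finset.Icc 1 n, ((‖x i - μ‖ ^ 2 - s) ^ 2 - v) = -(n * v) := by
    rw [Finset.sum_congr rfl fun i hi => by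
      rw [hx.eq_mean hs i (Finset.mem_Icc.1 hi).1, hs]]
    simp
  rw [h2, abs_neg, abs_of_nonneg (mul_nonneg hn'.le hx.varSq_nonneg)] at h1
  have e : (n : ℝ) ^ (9 / 16 : ℝ) = (n : ℝ) ^ (-(7 / 16) : ℝ) * n := by
    rw [← Real.rpow_add_one hn'.ne']
    norm_num
  rw [e, ← mul_assoc, mul_comm] at h1
  exact le_of_mul_le_mul_right h1 hn'

theorem tendsto_of_tendsto_sqrt_mul {f : ℕ → ℝ} {r : ℝ}
    (h : Tendsto (fun n : ℕ => √(n : ℝ) * f n) atTop (𝓝 r)) : Tendsto f atTop (𝓝 0) := by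
  have h1 := h.mul (tendsto_natCast_rpow_neg (by norm_num : (0 : ℝ) < 1 / 2))
  rw [mul_zero] at h1
  refine h1.congr' ?_
  filter_upwards [eventually_ge_atTop 1] with n hn
  have hn' : (0 : ℝ) < n := by exact_mod_cast hn
  rw [Real.rpow_neg hn'.le, Real.sqrt_eq_rpow]
  field_simp

variable {H : Type*} [NormedAddCommGroup H] [InnerProductSpace ℝ H]

/-- The limit of the scaled distance of the lower bound to the centre. -/
theorem RegularPath.tendsto_sqrt_mul_center_sub_lowerBound {x : ℕ → H} {μ : H} {s v : ℝ}
    (hx : RegularPath x μ s v) {c : Tuning H} {rule : MeanRule} {β δ₁ δ₂ l : ℕ → ℝ} {α : ℝ}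
    {lam : ℕ → ℕ → ℝ} (hα0 : 0 < α) (hα1 : α < 1)
    (hβ : ∀ᶠ n in atTop, 0 < β n ∧ β n ≤ 1 ∧ Real.log (2 / β n) ≤ l n)
    (hδ₁ : ∀ᶠ n in atTop, 0 < δ₁ n ∧ δ₁ n ≤ 1 ∧ Real.log (2 / δ₁ n) ≤ l n)
    (hl : Tendsto (fun n : ℕ => l n ^ 2 * (n : ℝ) ^ (-(1 / 8) : ℝ)) atTop (𝓝 0))
    (hδ₂ : Tendsto δ₂ atTop (𝓝 α))
    (h : IsPluginArray c x (fun n => muHat c rule (β n) x) δ₂ lam) :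
    Tendsto (fun n : ℕ => √(n : ℝ) * (center (lam n) (muHat c rule (β n) x) x n -
      lowerBound c (lam n) (muHat c rule (β n) x) (β n) x (δ₁ n) (δ₂ n) n)) atTop
      (𝓝 (√(2 * v * Real.log (1 / α)))) := by
  have hL : 0 < Real.log (1 / α) := Real.log_pos (by rw [lt_div_iff₀ hα0]; linarith)
  obtain ⟨D, hD0, hD⟩ := hx.exists_norm_muHat_sub_le c rule
  obtain ⟨C, hC0, hC⟩ := hx.exists_residualBounds c hD0
  have hr : ∀ᶠ n in atTop, ResidualBounds c x (muHat c rule (β n) x) s v C :=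
    hβ.mono fun n hn => hC _ (hD (β n) hn.1 hn.2.1)
  have hR := h.tendsto_sqrt_mul_radius hα0 hα1 hδ₂ hr hC0 hx.varSq_nonneg
  obtain ⟨B, hB0, hB⟩ := h.exists_isSpread hα0 hα1 hδ₂ hr hC0 hx.varSq_nonneg
  obtain ⟨T, hT0, hT⟩ := hx.exists_tilde_bounds c
  set R : ℕ → ℝ := fun n => radius c (lam n) (muHat c rule (β n) x) x (δ₂ n) n with hRdef
  set dd : ℕ → ℝ := fun n => center (lam n) (muHat c rule (β n) x) x n with hdd
  set aa : ℕ → ℝ := fun n => Acoef c (lam n) (β n) x n with haa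
  set bb : ℕ → ℝ := fun n => wAvg (lam n) (Btilde c (β n) x (δ₁ n)) n with hbb
  set cc : ℕ → ℝ := fun n => Ccoef c (lam n) (β n) x (δ₁ n) n with hcc
  set y : ℕ → ℝ := fun n => dd n - cc n - R n with hy
  have htb := (hβ.and hδ₁).mono fun n h => hT (β n) (δ₁ n) (l n) h.1.1 h.1.2.1 h.2.1 h.2.2.1
    h.1.2.2 h.2.2.2
  have hrate : ∀ F : ℝ, Tendsto (fun n : ℕ => 4 * B * (F * l n ^ 2) * (n : ℝ) ^ (-(1 / 8) : ℝ))
      atTop (𝓝 0) := fun F => by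
    have := hl.const_mul (4 * B * F)
    rw [mul_zero] at this
    refine this.congr fun n => ?_
    ring
  -- The lower bound divides by `2 A`. The weight at the last index is certainly not replaced by
  -- zero, and `Atilde` is positive there.
  have hApos : ∀ᶠ n in atTop, 0 < aa n := by
    filter_upwards [htb, hB, h.eq_lamUpper, eventually_ge_atTop 2, hβ,
      (IsPluginArray.tendsto_log hα0 hδ₂).eventually (lt_mem_nhds hL)] with n h1 h2 h3 h4 h5 h6
    refine div_pos ?_ h2.sum_pos
    refine Finset.sum_pos' (fun i hi => mul_nonneg (h.nonneg n i)
      (h1 i (Finset.mem_Icc.1 hi).1).1.1) ⟨n, Finset.mem_Icc.2 ⟨by omega, le_rfl⟩, ?_⟩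
    refine mul_pos ?_ ?_
    · rw [h3 n (by omega) le_rfl (by nlinarith)]
      exact lamUpper_pos c _ x (by omega) (by omega) h6
    · rw [Atilde, if_neg (by omega)]
      have := sumPsiP_pos c x h5.1 h5.2.1 h4
      have := sumLamTilde_pos c x h5.1 h5.2.1 h4
      positivity
  have hAle : ∀ᶠ n in atTop, aa n ≤ T := by
    filter_upwards [htb, hB] with n h1 h2
    exact wAvg_le_of_le h2.nonneg h2.sum_pos fun i hi _ => (h1 i hi).1.2.1
  have hb0 : ∀ᶠ n in atTop, 0 ≤ bb n := by
    filter_upwards [htb, hB] with n h1 h2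
    exact wAvg_nonneg h2.nonneg fun i hi _ => (h1 i hi).2.1.1
  have hcc0 : Tendsto (fun n : ℕ => √(n : ℝ) * cc n) atTop (𝓝 0) := by
    refine squeeze_zero' ?_ ?_ (hrate T)
    · filter_upwards [htb, hB] with n h1 h2
      exact mul_nonneg (Real.sqrt_nonneg _)
        (wAvg_nonneg h2.nonneg fun i hi _ => (h1 i hi).2.2.1.1)
    · filter_upwards [htb, hB, eventually_ge_atTop 1] with n h1 h2 h3
      exact h2.sqrt_mul_wAvg_le h3 hB0 (by positivity) fun i hi _ => (h1 i hi).2.2.1.2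
  have hd0 : ∀ᶠ n in atTop, 0 ≤ dd n := by
    filter_upwards [hB] with n h2
    exact wAvg_nonneg h2.nonneg fun i _ _ => by positivity
  have hc0 := tendsto_of_tendsto_sqrt_mul hcc0
  have hR0 := tendsto_of_tendsto_sqrt_mul hR
  have hlow : ∀ n, lowerBound c (lam n) (muHat c rule (β n) x) (β n) x (δ₁ n) (δ₂ n) n =
      (-(1 + bb n) + √((1 + bb n) ^ 2 + 4 * aa n * y n)) / (2 * aa n) := fun n => rfl
  set L : ℕ → ℝ := fun n =>
    (-(1 + bb n) + √((1 + bb n) ^ 2 + 4 * aa n * y n)) / (2 * aa n) with hLdef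
  simp only [hlow]
  change Tendsto (fun n : ℕ => √(n : ℝ) * (dd n - L n)) atTop _
  -- If `s = 0`, `A` is only known to be bounded, but then `v = 0` and `D` is an average of squared
  -- errors of the mean estimator. So `√n y → 0`, and `|L| ≤ 2 |y|` finishes.
  rcases hx.var_nonneg.eq_or_lt with hs | hs
  · have hv := hx.varSq_eq_zero hs.symm
    rw [hv, mul_zero, zero_mul, Real.sqrt_zero] at hR ⊢
    have hdd0 : Tendsto (fun n : ℕ => √(n : ℝ) * dd n) atTop (𝓝 0) := by
      have hsmall : Tendsto (fun n : ℕ => 4 * B * D ^ 2 * (n : ℝ) ^ (-(1 / 8) : ℝ)) atTop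
          (𝓝 (4 * B * D ^ 2 * 0)) := (tendsto_natCast_rpow_neg (by norm_num)).const_mul _
      rw [mul_zero] at hsmall
      refine squeeze_zero' ?_ ?_ hsmall
      · filter_upwards [hd0] with n h1
        positivity
      · filter_upwards [hβ, hB, eventually_ge_atTop 1] with n h1 h2 h3
        refine h2.sqrt_mul_wAvg_le h3 hB0 (by positivity) fun i hi _ => ?_
        have e : (i : ℝ) ^ (-(3 / 4) : ℝ) = ((i : ℝ) ^ (-(3 / 8) : ℝ)) ^ 2 := by
          rw [← Real.rpow_natCast, ← Real.rpow_mul (by positivity)]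
          norm_num
        rw [hx.eq_mean hs.symm i hi, norm_sub_rev, e, ← mul_pow]
        exact pow_le_pow_left₀ (norm_nonneg _) (hD (β n) h1.1 h1.2.1 i hi) 2
    have hy0 : Tendsto (fun n : ℕ => √(n : ℝ) * y n) atTop (𝓝 0) := by
      have h1 := (hdd0.sub hcc0).sub hR
      simp only [sub_zero] at h1
      refine h1.congr fun n => ?_
      simp only [hy]
      ring
    have hy1 := (tendsto_of_tendsto_sqrt_mul hy0).abs
    rw [abs_zero] at hy1
    refine squeeze_zero_norm' (a := fun n : ℕ => √(n : ℝ) * dd n + 2 * |√(n : ℝ) * y n|) ?_ ?_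
    · filter_upwards [hApos, hAle, hb0, hd0,
        hy1.eventually (gt_mem_nhds (by positivity : 0 < 1 / (4 * T)))] with n h1 h2 h3 h4 h5
      rw [lt_div_iff₀ (by positivity)] at h5
      have h6 := (quadratic_root_spec (A := aa n) (B := 1 + bb n) (y := y n) h1 (by linarith)
        (by nlinarith [abs_nonneg (y n)])).2
      rw [norm_mul, Real.norm_of_nonneg (Real.sqrt_nonneg _), Real.norm_eq_abs, abs_mul,
        abs_of_nonneg (Real.sqrt_nonneg _)]
      have h7 : |dd n - L n| ≤ dd n + 2 * |y n| := by
        refine (abs_sub _ _).trans ?_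
        rw [abs_of_nonneg h4]
        linarith
      calc √(n : ℝ) * |dd n - L n| ≤ √(n : ℝ) * (dd n + 2 * |y n|) := by gcongr
        _ = _ := by ring
    · have := hdd0.add (hy0.abs.const_mul 2)
      simpa using this
  -- For `s > 0`, `L` is bounded while `√n A` and `√n (B - 1)` vanish, so in `D - L = C + R + A L² +
  -- (B - 1) L` only `R` survives the scaling.
  · have hA0 : Tendsto (fun n : ℕ => √(n : ℝ) * aa n) atTop (𝓝 0) := by
      refine squeeze_zero' ?_ ?_ (hrate T)
      · filter_upwards [hApos] with n h1
        positivity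
      · filter_upwards [htb, hB, eventually_ge_atTop 1] with n h1 h2 h3
        exact h2.sqrt_mul_wAvg_le h3 hB0 (by positivity) fun i hi _ => (h1 i hi).1.2.2 hs
    have hbb0 : Tendsto (fun n : ℕ => √(n : ℝ) * bb n) atTop (𝓝 0) := by
      refine squeeze_zero' ?_ ?_ (hrate T)
      · filter_upwards [hb0] with n h1
        positivity
      · filter_upwards [htb, hB, eventually_ge_atTop 1] with n h1 h2 h3
        exact h2.sqrt_mul_wAvg_le h3 hB0 (by positivity) fun i hi _ => (h1 i hi).2.1.2 hs
    have hdC : ∀ᶠ n in atTop, dd n ≤ C := by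
      filter_upwards [hr, hB] with n h1 h2
      exact wAvg_le_of_le h2.nonneg h2.sum_pos fun i hi _ => h1.norm_sq_le i hi
    have hc1 := hc0.abs
    have hR1 := hR0.abs
    rw [abs_zero] at hc1 hR1
    have hyb : ∀ᶠ n in atTop, |y n| ≤ C + 2 := by
      filter_upwards [hd0, hdC, hc1.eventually (gt_mem_nhds one_pos),
        hR1.eventually (gt_mem_nhds one_pos)] with n h1 h2 h3 h4
      have h5 : |y n| ≤ |dd n| + |cc n| + |R n| := by
        simp only [hy]
        exact (abs_sub _ _).trans (by linarith [abs_sub (dd n) (cc n)])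
      rw [abs_of_nonneg h1] at h5
      linarith
    have hK : 0 < C + 2 := by linarith
    have hspec : ∀ᶠ n in atTop, aa n * L n ^ 2 + (1 + bb n) * L n = y n ∧
        |L n| ≤ 2 * (C + 2) := by
      filter_upwards [hApos, hb0, hyb, (tendsto_of_tendsto_sqrt_mul hA0).eventually
        (gt_mem_nhds (by positivity : 0 < 1 / (4 * (C + 2))))] with n h1 h2 h3 h4
      rw [lt_div_iff₀ (by positivity)] at h4
      have h5 := quadratic_root_spec (A := aa n) (B := 1 + bb n) (y := y n) h1 (by linarith)
        (by nlinarith [abs_nonneg (y n)])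
      exact ⟨h5.1, h5.2.trans (by linarith)⟩
    have hAL : Tendsto (fun n : ℕ => √(n : ℝ) * aa n * L n ^ 2) atTop (𝓝 0) := by
      have h1 := hA0.mul_const ((2 * (C + 2)) ^ 2)
      rw [zero_mul] at h1
      refine squeeze_zero' ?_ ?_ h1
      · filter_upwards [hApos] with n h2
        positivity
      · filter_upwards [hApos, hspec] with n h2 h3
        gcongr ?_ * ?_
        rw [← sq_abs]
        exact pow_le_pow_left₀ (abs_nonneg _) h3.2 2
    have hBL : Tendsto (fun n : ℕ => √(n : ℝ) * bb n * L n) atTop (𝓝 0) := by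
      have h1 := hbb0.mul_const (2 * (C + 2))
      rw [zero_mul] at h1
      refine squeeze_zero_norm' ?_ h1
      filter_upwards [hb0, hspec] with n h2 h3
      rw [norm_mul, Real.norm_of_nonneg (by positivity), Real.norm_eq_abs]
      gcongr
      exact h3.2
    have h1 := ((hcc0.add hR).add hAL).add hBL
    simp only [zero_add, add_zero] at h1
    refine h1.congr' ?_
    filter_upwards [hspec] with n h2
    have h3 : dd n - L n = cc n + R n + aa n * L n ^ 2 + bb n * L n := by
      have h4 := h2.1
      have h5 : y n = dd n - cc n - R n := rfl
      linarith
    rw [h3]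
    ring

end Limits

/-! ### The confidence levels and their logarithms. -/

section Levels

theorem tendsto_log_natCast : Tendsto (fun n : ℕ => Real.log n) atTop atTop :=
  Real.tendsto_log_atTop.comp tendsto_natCast_atTop_atTop

theorem tendsto_alphaTwo (α : ℝ) : Tendsto (alphaTwo α) atTop (𝓝 α) := by
  have h1 : Tendsto (fun n : ℕ => (1 - (Real.log n)⁻¹) * α) atTop (𝓝 ((1 - 0) * α)) :=
    (tendsto_const_nhds.sub (tendsto_inv_atTop_zero.comp tendsto_log_natCast)).mul_const α
  rw [sub_zero, one_mul] at h1
  refine h1.congr' ?_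
  filter_upwards [tendsto_log_natCast.eventually_ge_atTop 1] with n hn
  rw [alphaTwo]
  field_simp

/-- A common upper bound for the logarithms of the inverse levels. -/
def logLevel (α : ℝ) (n : ℕ) : ℝ := Real.log (2 / α) + Real.log n

/-- The logarithm is `log(2/α) + log log n`; replacing `log log n` by `log n` is crude but harmless
against powers of `n`. -/
theorem alphaOne_bounds {α : ℝ} (hα0 : 0 < α) (hα1 : α < 1) :
    ∀ᶠ n in atTop, 0 < alphaOne α n ∧ alphaOne α n ≤ 1 ∧
      Real.log (2 / alphaOne α n) ≤ logLevel α n := by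
  filter_upwards [tendsto_log_natCast.eventually_ge_atTop 1, eventually_ge_atTop 1] with n hn hn1
  have hn' : (0 : ℝ) < n := by exact_mod_cast hn1
  have hl : 0 < Real.log n := by linarith
  refine ⟨by unfold alphaOne; positivity, ?_, ?_⟩
  · have h1 : 1 / Real.log n ≤ 1 := by rw [div_le_one hl]; exact hn
    unfold alphaOne
    nlinarith
  · have e : 2 / alphaOne α n = 2 / α * Real.log n := by
      unfold alphaOne
      field_simp
    rw [e, Real.log_mul (by positivity) hl.ne', logLevel]
    have := Real.log_le_log hl (Real.log_le_self hn'.le)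
    linarith

theorem level_bounds {α : ℝ} (hα0 : 0 < α) (hα1 : α < 1) {β : ℕ → ℝ}
    (hβ : (∀ n, β n = α) ∨ (∀ n, β n = alphaOne α n)) :
    ∀ᶠ n in atTop, 0 < β n ∧ β n ≤ 1 ∧ Real.log (2 / β n) ≤ logLevel α n := by
  rcases hβ with h | h
  · filter_upwards [tendsto_log_natCast.eventually_ge_atTop 1] with n hn
    rw [h, logLevel]
    exact ⟨hα0, hα1.le, by linarith⟩
  · simp only [h]
    exact alphaOne_bounds hα0 hα1

theorem tendsto_logLevel_mul_rpow (α : ℝ) {p : ℝ} (hp : 0 < p) :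
    Tendsto (fun n : ℕ => logLevel α n * (n : ℝ) ^ (-p)) atTop (𝓝 0) := by
  have h1 : Tendsto (fun n : ℕ => Real.log n * (n : ℝ) ^ (-p)) atTop (𝓝 0) := by
    have h := ((isLittleO_log_rpow_atTop hp).tendsto_div_nhds_zero).comp
      (tendsto_natCast_atTop_atTop (R := ℝ))
    refine h.congr fun n => ?_
    simp only [Function.comp_apply]
    rw [Real.rpow_neg (Nat.cast_nonneg n), div_eq_mul_inv]
  have h2 := ((tendsto_natCast_rpow_neg hp).const_mul (Real.log (2 / α))).add h1
  rw [mul_zero, add_zero] at h2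
  refine h2.congr fun n => ?_
  rw [logLevel]
  ring

theorem tendsto_logLevel_sq_mul_rpow (α : ℝ) :
    Tendsto (fun n : ℕ => logLevel α n ^ 2 * (n : ℝ) ^ (-(1 / 8) : ℝ)) atTop (𝓝 0) := by
  have h := (tendsto_logLevel_mul_rpow α (by norm_num : (0 : ℝ) < 1 / 16)).pow 2
  rw [zero_pow two_ne_zero] at h
  refine h.congr fun n => ?_
  rw [mul_pow, ← Real.rpow_natCast ((n : ℝ) ^ _), ← Real.rpow_mul (Nat.cast_nonneg n)]
  norm_num

end Levels

/-! ### Both choices of weights are plug-in arrays. -/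

section PluginArrays

variable {H : Type*} [NormedAddCommGroup H] [InnerProductSpace ℝ H]

theorem isPluginArray_lamUpper (c : Tuning H) (x : ℕ → H) (mu : ℕ → ℕ → H) (δ : ℕ → ℝ) :
    IsPluginArray c x mu δ fun n => lamUpper c (mu n) x n (δ n) :=
  ⟨fun _ _ => Or.inl rfl, Eventually.of_forall fun _ _ _ _ _ => rfl⟩

/-- The test on the mean radius succeeds as soon as `i ^ (3/8)` exceeds a multiple of the log level.
For `i ≥ √n` this holds eventually, as `i ^ (3/8) ≥ n ^ (3/16)`, so only weights of small index are
cut off. -/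
theorem RegularPath.isPluginArray_lamLower {x : ℕ → H} {μ : H} {s v : ℝ}
    (hx : RegularPath x μ s v) (c : Tuning H) (mu : ℕ → ℕ → H) {α : ℝ} (hα0 : 0 < α)
    (hα1 : α < 1) {β : ℕ → ℝ} (hβ : (∀ n, β n = α) ∨ (∀ n, β n = alphaOne α n)) (δ₂ : ℕ → ℝ) :
    IsPluginArray c x mu δ₂
      fun n => lamLower c (mu n) (β n) x n (alphaOne α n) (δ₂ n) := by
  refine ⟨fun n i => ?_, ?_⟩
  · by_cases h : 2 ≤ i ∧ (Real.log (2 / alphaOne α n) + sigmaHatSq c x i * sumPsiP c (β n) x i) /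
        sumLamTilde c (β n) x i ≤ 1
    · exact Or.inl (if_pos h)
    · exact Or.inr (if_neg h)
  · obtain ⟨T, hT0, hT⟩ := hx.exists_tilde_bounds c
    have h1 := tendsto_logLevel_mul_rpow α (by norm_num : (0 : ℝ) < 3 / 16)
    filter_upwards [level_bounds hα0 hα1 hβ, alphaOne_bounds hα0 hα1,
      h1.eventually (gt_mem_nhds (by positivity : 0 < 1 / T)), eventually_ge_atTop 2]
      with n h2 h3 h4 h5 i hi1 _ hi3
    have hn' : (0 : ℝ) < n := by positivity
    have hi' : (0 : ℝ) < i := by exact_mod_cast hi1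
    have hi2 : 2 ≤ i := by
      by_contra! h
      have : i = 1 := by omega
      subst this
      omega
    refine if_pos ⟨hi2, (hT (β n) (alphaOne α n) (logLevel α n) h2.1 h2.2.1 h3.1 h3.2.1 h2.2.2
      h3.2.2 i hi1).2.2.2 hi2 ?_⟩
    have h6 : (n : ℝ) ^ (3 / 16 : ℝ) ≤ (i : ℝ) ^ (3 / 8 : ℝ) := by
      have h7 : (n : ℝ) ^ (3 / 16 : ℝ) ≤ ((i : ℝ) ^ 2) ^ (3 / 16 : ℝ) :=
        Real.rpow_le_rpow hn'.le (by exact_mod_cast hi3) (by norm_num)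
      rw [← Real.rpow_natCast, ← Real.rpow_mul hi'.le] at h7
      norm_num at h7 ⊢
      exact h7
    refine le_trans ?_ h6
    rw [Real.rpow_neg hn'.le, ← div_eq_mul_inv, div_lt_div_iff₀ (by positivity) hT0] at h4
    linarith

end PluginArrays

end

end HilbertVariance

/-! ### The almost sure limits, path by path. -/

theorem mainTheorem11 {Ω H : Type*} [MeasurableSpace Ω] (P : Measure Ω) [IsProbabilityMeasure P]
    [NormedAddCommGroup H] [InnerProductSpace ℝ H] [CompleteSpace H]
    [TopologicalSpace.SeparableSpace H] [MeasurableSpace H] [BorelSpace H]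
    (X : ℕ → Ω → H) (μ : H) (σ : ℝ)
    (hX : HilbertVariance.BoundedStream P X μ σ)
    (hV : HilbertVariance.ConstantCondVar P X μ)
    (c : HilbertVariance.Tuning H)
    (α : ℝ) (hα0 : 0 < α) (hα1 : α < 1)
    -- the mean estimator, and the level of the mean plug-ins for each sample size
    (rule : HilbertVariance.MeanRule) (β : ℕ → ℝ)
    (hβ : (∀ n, β n = α) ∨ (∀ n, β n = HilbertVariance.alphaOne α n))
    (j : ℕ) (hj : 1 ≤ j) :
    -- the upper confidence interval, of level `α`
    (∀ᵐ ω ∂P, Tendsto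
      (fun n : ℕ =>
        let x : ℕ → H := fun i => X i ω
        let mu : ℕ → H := HilbertVariance.muHat c rule (β n) x
        let lam : ℕ → ℝ := HilbertVariance.lamUpper c mu x n α
        √(n : ℝ) * (HilbertVariance.upperBound c lam mu x α n
          - HilbertVariance.center lam mu x n))
      atTop (𝓝 (√(2 * variance (fun ω => ‖X j ω - μ‖ ^ 2) P * Real.log (1 / α))))) ∧
    -- the lower confidence interval, with its own plug-ins
    (∀ᵐ ω ∂P, Tendsto
      (fun n : ℕ =>
        let x : ℕ → H := fun i => X i ω
        let α₁ : ℝ := HilbertVariance.alphaOne α n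
        let α₂ : ℝ := HilbertVariance.alphaTwo α n
        let mu : ℕ → H := HilbertVariance.muHat c rule (β n) x
        let lam : ℕ → ℝ := HilbertVariance.lamLower c mu (β n) x n α₁ α₂
        √(n : ℝ) * (HilbertVariance.center lam mu x n
          - HilbertVariance.lowerBound c lam mu (β n) x α₁ α₂ n))
      atTop (𝓝 (√(2 * variance (fun ω => ‖X j ω - μ‖ ^ 2) P * Real.log (1 / α))))) ∧
    -- the lower confidence interval, with the plug-ins of the upper one at level `α_{2,n}`
    (∀ᵐ ω ∂P, Tendsto
      (fun n : ℕ =>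
        let x : ℕ → H := fun i => X i ω
        let α₁ : ℝ := HilbertVariance.alphaOne α n
        let α₂ : ℝ := HilbertVariance.alphaTwo α n
        let mu : ℕ → H := HilbertVariance.muHat c rule (β n) x
        let lam : ℕ → ℝ := HilbertVariance.lamUpper c mu x n α₂
        √(n : ℝ) * (HilbertVariance.center lam mu x n
          - HilbertVariance.lowerBound c lam mu (β n) x α₁ α₂ n))
      atTop (𝓝 (√(2 * variance (fun ω => ‖X j ω - μ‖ ^ 2) P * Real.log (1 / α))))) := by
  obtain ⟨v, hv, hreg⟩ := hX.regularPath hV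
  rw [hv j hj]
  refine ⟨?_, ?_, ?_⟩
  · filter_upwards [hreg] with ω hx
    obtain ⟨D, hD0, hD⟩ := hx.exists_norm_muHat_sub_le c rule
    obtain ⟨C, hC0, hC⟩ := hx.exists_residualBounds c hD0
    have hr : ∀ᶠ n in atTop, HilbertVariance.ResidualBounds c (fun i => X i ω)
        (HilbertVariance.muHat c rule (β n) fun i => X i ω) (σ ^ 2) v C :=
      (HilbertVariance.level_bounds hα0 hα1 hβ).mono fun n hn => hC _ (hD (β n) hn.1 hn.2.1)
    refine ((HilbertVariance.isPluginArray_lamUpper c (fun i => X i ω) _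
      fun _ => α).tendsto_sqrt_mul_radius hα0 hα1 tendsto_const_nhds hr hC0
        hx.varSq_nonneg).congr fun n => ?_
    simp only [HilbertVariance.upperBound, add_sub_cancel_left]
  -- The level `α_{1,n} → 0` costs only logarithmic factors, and `α_{2,n} → α` is the level seen in
  -- the limit.
  · filter_upwards [hreg] with ω hx
    exact hx.tendsto_sqrt_mul_center_sub_lowerBound hα0 hα1
      (HilbertVariance.level_bounds hα0 hα1 hβ) (HilbertVariance.alphaOne_bounds hα0 hα1)
      (HilbertVariance.tendsto_logLevel_sq_mul_rpow α) (HilbertVariance.tendsto_alphaTwo α)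
      (hx.isPluginArray_lamLower c _ hα0 hα1 hβ _)
  · filter_upwards [hreg] with ω hx
    exact hx.tendsto_sqrt_mul_center_sub_lowerBound hα0 hα1
      (HilbertVariance.level_bounds hα0 hα1 hβ) (HilbertVariance.alphaOne_bounds hα0 hα1)
      (HilbertVariance.tendsto_logLevel_sq_mul_rpow α) (HilbertVariance.tendsto_alphaTwo α)
      (HilbertVariance.isPluginArray_lamUpper c _ _ _)
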